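/- **Conventions.** Matroids may be infinite: $M$ is a matroid on a (possibly infinite) set $E$ in the sense of Bruhn, Diestel, Kriesell, Pendavingh and Wollan. $M$ is *tame* if every intersection of a circuit with a cocircuit is finite, and *connected* if it is 2-connected, i.e. there is no partition $E=A\sqcup B$ into nonempty sets for which there are bases $s_A$ of $A$, $s_B$ of $B$ and $s$ of $M$ with $s_A\cup s_B\subseteq s$. The empty space counts as connected. **Graph frameworks.** A *graph framework* $\Gamma$ on a tame matroid $M$ consists of functions $c_o:o\to\{-1,1\}$ for each circuit $o$, and $d_b:b\to\{-1,1\}$, $\sigma_b:E\setminus b\to\{-1,1\}$ for each cocircuit $b$, such that the following hold. (a) $\sum_{e\in o\cap b}c_o(e)d_b(e)=0$ in $\mathbb Z$ for every circuit $o$ and cocircuit $b$. (b) For every circuit $o$ the relation $R_o$ is a cyclic order on $o$ (cyclic, asymmetric, transitive, total on distinct triples), where $[e,f,g]_{R_o}$ holds if and only if $e,f,g\in o$ are distinct and there is a cocircuit $b$ with $b\cap o=\{e,f\}$ and $\sigma_b(g)=c_o(f)d_b(f)$. (c) Let $o$ be a circuit, $b$ a cocircuit, $s$ a finite set with $b\cap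 o\subseteq s\subseteq o$, and let $p\neq q$ in $s$ be clockwise adjacent in $R_o\restriction_s$, i.e. $[p,q,g]_{R_o}$ for all $g\in s\setminus\{p,q\}$. Then: $c_o(p)d_b(p)=-c_o(q)d_b(q)$ if $p,q\in b$; $\sigma_b(p)=\sigma_b(q)$ if $p,q\notin b$; $c_o(p)d_b(p)=\sigma_b(q)$ if $p\in b$, $q\notin b$; $c_o(q)d_b(q)=-\sigma_b(p)$ if $p\notin b$, $q\in b$. **Graph-like spaces.** A *graph-like space* $G$ with vertex set $V$ and edge set $E$ is a topology on $V\sqcup((0,1)\times E)$ together with continuous maps $\iota_e:[0,1]\to G$ for $e\in E$ such that $\iota_e(r)=(r,e)$ for $0<r<1$; $\iota_e(0),\iota_e(1)\in V$ (the endvertices of $e$); $\iota_e\restriction_{(0,1)}$ is open; and for any distinct $v,v'\in V$ there are disjoint open sets $U\ni v$, $U'\ni v'$ with $V\subseteq U\cup U'$. Removing a set of edges means deleting their interior points $(0,1)\times\{e\}$; two vertices are separated by this if they lie in different components of what remains. A *map of graph-like spaces* is a continuous map that sends vertices to vertices and, on the interior of each edge $e$, is either constant with value a vertex, or $(r,e)\mapsto(r,f)$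 for some edge $f$, or $(r,e)\mapsto(1-r,f)$ for some edge $f$. A *pseudo-line* is a compact connected graph-like space with a start-vertex $s$ and an end-vertex $t$ such that removing any one edge separates $s$ from $t$, and any two distinct vertices can be separated by removing a single edge. A *pseudo-arc* from $v$ to $w$ in $G$ is the image of an injective map of graph-like spaces from a pseudo-line to $G$ with $s\mapsto v$, $t\mapsto w$. A *pseudo-circle* is a compact connected graph-like space with at least one edge such that removing any one edge does not disconnect it, removing any two distinct edges does, and any two distinct vertices can be separated by removing a pair of edges; a pseudo-circle in $G$ is the image of an injective map of graph-like spaces from a pseudo-circle to $G$. A subset $H$ of $G$ is *pseudo-arc connected* if either it is a connected subset of the set of interior points of some edge, or else any two vertices in $H$ are joined by a pseudo-arc of $G$ included in $H$ and any interior point of an edge $e$ lying in $H$ can be joined to an endvertex of $e$ by an arc (continuous injective image of $[0,1]$) in $H\cap\iota_e([0,1])$. For disjoint open sets $U,W$ of $G$ with $V\subseteq U\cup W$, the set $b$ of edges with one endvertex in $U$ and one in $W$ is a *topological cut* with sides $U\cap V$ and $W\cap V$. A *topological bond* is a minimal nonempty topological cut. For a set $X$ of edges, the *standard subspace* $\overline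 X$ consists of the interior points of the edges in $X$ and the vertices in the closure of $(0,1)\times X$; its edges are the elements of $X$. A subset of $G$ meets both sides of a cut if it contains a vertex from each side. $\hat G$ denotes the subspace of $G$ with the same edges and with those vertices that are an endvertex of some edge or lie on some pseudo-circle in $G$. **The space $G(M,\Gamma)$.** It has vertex set $V=\{-1,1\}^{\mathcal C^*(M)}$, where $\mathcal C^*(M)$ is the set of cocircuits, and edge set $E$. A subbasis of its topology consists of the sets $U\times\{e\}$ with $e\in E$ and $U\subseteq(0,1)$ open, and the sets $$U_b^i(\epsilon)=\{v\in V: v(b)=i\}\cup\bigcup_{e\notin b,\ \sigma_b(e)=i}(0,1)\times\{e\}\cup\bigcup_{e\in b,\ d_b(e)=i}(1-\epsilon(e),1)\times\{e\}\cup\bigcup_{e\in b,\ d_b(e)=-i}(0,\epsilon(e))\times\{e\}$$ for $i\in\{-1,1\}$, $b\in\mathcal C^*(M)$ and $\epsilon:b\to(0,1)$. The endvertices are given by $\iota_e(0)(b)=\iota_e(1)(b)=\sigma_b(e)$ if $e\notin b$, and $\iota_e(0)(b)=-d_b(e)$, $\iota_e(1)(b)=d_b(e)$ if $e\in b$. **Theorem.**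 Let $M$ be a connected tame matroid, let $\Gamma$ be a graph framework on $M$, let $X\subseteq E(M)$, and let $\overline X$ be the standard subspace of $\hat G(M,\Gamma)$ with edge set $X$. The following are equivalent: 1. $\overline X$ is connected. 2. $\overline X$ is pseudo-arc connected (as a subset of $\hat G(M,\Gamma)$). 3. $\overline X$ contains an edge of every topological cut of $\hat G(M,\Gamma)$ of which it meets both sides. 4. $\overline X$ contains an edge of every topological bond of $\hat G(M,\Gamma)$ of which it meets both sides. -/

import Mathlib

namespace InfGraphic

universe u v w z

/-! ## Matroids -/

section Matroids

variable {α : Type u}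

/-- A (possibly infinite) matroid is tame if every circuit-cocircuit intersection is finite. -/
def IsTame (M : Matroid α) : Prop :=
  ∀ o b, M.IsCircuit o → M.IsCocircuit b → (o ∩ b).Finite

/-- `(A, B)` is a `k`-separation of `M`. -/
def IsSeparation (M : Matroid α) (k : ℕ) (A B : Set α) : Prop :=
  A ∪ B = M.E ∧ Disjoint A B ∧ (k : ℕ∞) ≤ A.encard ∧ (k : ℕ∞) ≤ B.encard ∧
    ∃ sA sB s, M.IsBasis sA A ∧ M.IsBasis sB B ∧ M.IsBase s ∧
      ((sA ∪ sB) \ s).encard < (k : ℕ∞)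

/-- `M` is `k`-connected if it has no `l`-separation for `l < k`. -/
def IsKConnected (M : Matroid α) (k : ℕ) : Prop :=
  ∀ l < k, ∀ A B, ¬ IsSeparation M l A B

/-- A matroid is connected if it is `2`-connected. -/
def IsConnectedMatroid (M : Matroid α) : Prop := IsKConnected M 2

/-- The ternary relation `R` is a cyclic order on the set `X`. -/
structure IsCyclicOrder (X : Set α) (R : α → α → α → Prop) : Prop where
  mem : ∀ a b c, R a b c → a ∈ X ∧ b ∈ X ∧ c ∈ X
  cyclic : ∀ a b c, R a b c → R b c a
  asymm : ∀ a b c, R a b c → ¬ R c b a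
  trans : ∀ a b c d, R a b c → R a c d → R a b d
  total : ∀ a ∈ X, ∀ b ∈ X, ∀ c ∈ X, a ≠ b → b ≠ c → a ≠ c → R a b c ∨ R c b a

/-- `p` and `q` are two elements of `s` that are clockwise adjacent in the restriction of the
cyclic order `R` to `s`. -/
def ClockwiseAdj (R : α → α → α → Prop) (s : Set α) (p q : α) : Prop :=
  p ∈ s ∧ q ∈ s ∧ p ≠ q ∧ ∀ g ∈ s, g ≠ p → g ≠ q → R p q g

/-- A signing of the (tame) matroid `M`.  The set `{-1, 1}` is modelled by `ℤˣ`.  The function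
`c o` is only used on the circuit `o`, and `d b` only on the cocircuit `b`; other values are
irrelevant. -/
structure Signing (M : Matroid α) where
  c : Set α → α → ℤˣ
  d : Set α → α → ℤˣ
  sum_eq_zero : ∀ o b, M.IsCircuit o → M.IsCocircuit b →
    ∑ᶠ e ∈ o ∩ b, ((c o e : ℤ) * (d b e : ℤ)) = 0

/-- The ternary relation `R_o` on `M` induced by a signing and side maps
`σ b : E \ b → {-1, 1}`. -/
def Signing.cyc {M : Matroid α} (S : Signing M) (σ : Set α → α → ℤˣ) (o : Set α)
    (e f g : α) : Prop :=
  e ≠ f ∧ f ≠ g ∧ e ≠ g ∧ e ∈ o ∧ f ∈ o ∧ g ∈ o ∧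
    ∃ b, M.IsCocircuit b ∧ b ∩ o = {e, f} ∧ σ b g = S.c o f * S.d b f

/-- A graph framework on the (tame) matroid `M`.  The function `σ b` is only used on `E \ b`, for
`b` a cocircuit. -/
structure GraphFramework (M : Matroid α) extends Signing M where
  σ : Set α → α → ℤˣ
  isCyclicOrder : ∀ o, M.IsCircuit o → IsCyclicOrder o (toSigning.cyc σ o)
  adj_mem_mem : ∀ o b s, M.IsCircuit o → M.IsCocircuit b → s.Finite → b ∩ o ⊆ s → s ⊆ o →
    ∀ p q, ClockwiseAdj (toSigning.cyc σ o) s p q → p ∈ b → q ∈ b →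
      c o p * d b p = -(c o q * d b q)
  adj_notMem_notMem : ∀ o b s, M.IsCircuit o → M.IsCocircuit b → s.Finite → b ∩ o ⊆ s → s ⊆ o →
    ∀ p q, ClockwiseAdj (toSigning.cyc σ o) s p q → p ∉ b → q ∉ b →
      σ b p = σ b q
  adj_mem_notMem : ∀ o b s, M.IsCircuit o → M.IsCocircuit b → s.Finite → b ∩ o ⊆ s → s ⊆ o →
    ∀ p q, ClockwiseAdj (toSigning.cyc σ o) s p q → p ∈ b → q ∉ b →
      c o p * d b p = σ b q
  adj_notMem_mem : ∀ o b s, M.IsCircuit o → M.IsCocircuit b → s.Finite → b ∩ o ⊆ s → s ⊆ o →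
    ∀ p q, ClockwiseAdj (toSigning.cyc σ o) s p q → p ∉ b → q ∈ b →
      c o q * d b q = -(σ b p)

end Matroids

/-! ## Graph-like spaces -/

/-- The disjoint union `V ⊔ ((0,1) × E)`: vertices and interior points of edges. -/
inductive Pt (V : Type v) (E : Type w) : Type (max v w)
  | vert (x : V) : Pt V E
  | inner (e : E) (r : Set.Ioo (0 : ℝ) 1) : Pt V E

/-- The map `ι_e : [0,1] → V ⊔ ((0,1) × E)` of an edge `e` with `ι_e 0 = a` and `ι_e 1 = b`. -/
noncomputable def Pt.edgeMap {V : Type v} {E : Type w} (e : E) (a b : V)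
    (x : unitInterval) : Pt V E :=
  if h : 0 < (x : ℝ) ∧ (x : ℝ) < 1 then .inner e ⟨x, h⟩
  else if x = 0 then .vert a else .vert b

/-- A graph-like space with vertex set `V` and edge set `E`; `src e` and `tgt e` are the
endvertices `ι_e 0` and `ι_e 1` of `e`. -/
structure GraphLikeSpace (V : Type v) (E : Type w) where
  top : TopologicalSpace (Pt V E)
  src : E → V
  tgt : E → V
  continuous_edgeMap : ∀ e, Continuous (Pt.edgeMap e (src e) (tgt e))
  isOpenMap_inner : ∀ e : E, IsOpenMap (Pt.inner (V := V) (E := E) e)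
  exists_separation : ∀ x y : V, x ≠ y → ∃ U W : Set (Pt V E),
    IsOpen U ∧ IsOpen W ∧ Disjoint U W ∧ (∀ z, Pt.vert z ∈ U ∪ W) ∧
      Pt.vert x ∈ U ∧ Pt.vert y ∈ W

namespace GraphLikeSpace

variable {V : Type v} {E : Type w} {V' : Type u} {E' : Type z}

/-- The set of points of a graph-like space, carrying its topology. -/
def Carrier (_G : GraphLikeSpace V E) : Type (max v w) := Pt V E

instance (G : GraphLikeSpace V E) : TopologicalSpace G.Carrier := G.top

/-- A vertex as a point of the space. -/
def vert (G : GraphLikeSpace V E) (x : V) : G.Carrier := Pt.vert x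

/-- The interior point `(r, e)` of the edge `e`. -/
def inner (G : GraphLikeSpace V E) (e : E) (r : Set.Ioo (0 : ℝ) 1) : G.Carrier := Pt.inner e r

/-- The edge map `ι_e : [0,1] → G`. -/
noncomputable def ι (G : GraphLikeSpace V E) (e : E) : unitInterval → G.Carrier :=
  Pt.edgeMap e (G.src e) (G.tgt e)

/-- The set of interior points of the edges in `R`. -/
def innerPts (G : GraphLikeSpace V E) (R : Set E) : Set G.Carrier :=
  {p | ∃ e ∈ R, ∃ r, p = G.inner e r}

/-- The subspace left after removing the (interior points of the) edges in `R`. -/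
def removeEdges (G : GraphLikeSpace V E) (R : Set E) : Set G.Carrier := (G.innerPts R)ᶜ

/-- The standard subspace with edge set `R`: its edges are those in `R`, and its vertices are
those in the closure of the set of interior points of edges in `R`. -/
def stdSubspace (G : GraphLikeSpace V E) (R : Set E) : Set G.Carrier :=
  G.innerPts R ∪ {p | (∃ x, p = G.vert x) ∧ p ∈ closure (G.innerPts R)}

/-! ### Maps of graph-like spaces -/

/-- The function on points induced by maps `φV` and `φE`.  A value `.inl (f, true)` of `φE` stands
for `(f, +)`, and `.inl (f, false)` for `(f, -)`. -/
def ptMap (φV : V → V') (φE : E → (E' × Bool) ⊕ V') : Pt V E → Pt V' E'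
  | .vert x => .vert (φV x)
  | .inner e r =>
    match φE e with
    | .inl (f, true) => .inner f r
    | .inl (f, false) => .inner f ⟨1 - (r : ℝ), by linarith [r.2.2], by linarith [r.2.1]⟩
    | .inr x => .vert x

/-- A map of graph-like spaces. -/
structure Map (G : GraphLikeSpace V E) (H : GraphLikeSpace V' E') where
  onVerts : V → V'
  onEdges : E → (E' × Bool) ⊕ V'
  continuous_ptMap : @Continuous _ _ G.top H.top (ptMap onVerts onEdges)

/-- The underlying function of a map of graph-like spaces. -/
def Map.toFun {G : GraphLikeSpace V E} {H : GraphLikeSpace V' E'} (φ : Map G H) :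
    G.Carrier → H.Carrier :=
  ptMap φ.onVerts φ.onEdges

/-! ### Pseudo-lines, pseudo-arcs and pseudo-circles -/

/-- `x` and `y` lie in different components of the space left after removing the edges in `R`. -/
def SeparatedByRemoving (G : GraphLikeSpace V E) (R : Set E) (x y : V) : Prop :=
  G.vert y ∉ connectedComponentIn (G.removeEdges R) (G.vert x)

/-- `L` is a pseudo-line with start-vertex `s` and end-vertex `t`. -/
structure IsPseudoLine (L : GraphLikeSpace V E) (s t : V) : Prop where
  compact : CompactSpace L.Carrier
  connected : ConnectedSpace L.Carrier
  separates_ends : ∀ e, L.SeparatedByRemoving {e} s t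
  separates : ∀ x y, x ≠ y → ∃ e, L.SeparatedByRemoving {e} x y

/-- `C` is a pseudo-circle. -/
structure IsPseudoCircle (C : GraphLikeSpace V E) : Prop where
  compact : CompactSpace C.Carrier
  connected : ConnectedSpace C.Carrier
  nonempty_edges : Nonempty E
  remove_one : ∀ e, IsConnected (C.removeEdges {e})
  remove_two : ∀ e f, e ≠ f → ¬ IsConnected (C.removeEdges {e, f})
  separates : ∀ x y, x ≠ y → ∃ e f, e ≠ f ∧ C.SeparatedByRemoving {e, f} x y

/-- `P` is (the image of) a pseudo-arc from `x` to `y` in `G`: the image of an injective map of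
graph-like spaces from a pseudo-line to `G`, sending start- and end-vertex to `x` and `y`. -/
def IsPseudoArc (G : GraphLikeSpace V E) (P : Set G.Carrier) (x y : V) : Prop :=
  ∃ (V₀ : Type v) (E₀ : Type w) (L : GraphLikeSpace V₀ E₀) (s t : V₀) (φ : Map L G),
    L.IsPseudoLine s t ∧ Function.Injective φ.toFun ∧ φ.onVerts s = x ∧ φ.onVerts t = y ∧
      P = Set.range φ.toFun

/-- `P` is (the image of) a pseudo-circle in `G`. -/
def IsPseudoCircleIn (G : GraphLikeSpace V E) (P : Set G.Carrier) : Prop :=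
  ∃ (V₀ : Type v) (E₀ : Type w) (C : GraphLikeSpace V₀ E₀) (φ : Map C G),
    C.IsPseudoCircle ∧ Function.Injective φ.toFun ∧ P = Set.range φ.toFun

/-- Pseudo-arc connectedness of a subset of a graph-like space. -/
def IsPseudoArcConnected (G : GraphLikeSpace V E) (H : Set G.Carrier) : Prop :=
  (∃ e, H ⊆ G.innerPts {e} ∧ IsPreconnected H) ∨
    ((∀ x y, G.vert x ∈ H → G.vert y ∈ H → ∃ P, G.IsPseudoArc P x y ∧ P ⊆ H) ∧
      ∀ e r, G.inner e r ∈ H → ∃ γ : unitInterval → G.Carrier,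
        Continuous γ ∧ Function.Injective γ ∧ γ 0 = G.inner e r ∧
          (γ 1 = G.vert (G.src e) ∨ γ 1 = G.vert (G.tgt e)) ∧
          Set.range γ ⊆ H ∩ Set.range (G.ι e))

/-! ### Topological cuts and bonds -/

/-- `U` and `W` are disjoint open subsets partitioning the vertices. -/
def IsVertexPartition (G : GraphLikeSpace V E) (U W : Set G.Carrier) : Prop :=
  IsOpen U ∧ IsOpen W ∧ Disjoint U W ∧ ∀ x, G.vert x ∈ U ∪ W

/-- The set of edges having an endvertex in each of `U` and `W`. -/
def cut (G : GraphLikeSpace V E) (U W : Set G.Carrier) : Set E :=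
  {e | (G.vert (G.src e) ∈ U ∧ G.vert (G.tgt e) ∈ W) ∨
    (G.vert (G.src e) ∈ W ∧ G.vert (G.tgt e) ∈ U)}

/-- `b` is the topological cut with sides (the vertices in) `U` and `W`. -/
def IsTopCutWithSides (G : GraphLikeSpace V E) (b : Set E) (U W : Set G.Carrier) : Prop :=
  G.IsVertexPartition U W ∧ b = G.cut U W

/-- `b` is a topological cut. -/
def IsTopCut (G : GraphLikeSpace V E) (b : Set E) : Prop :=
  ∃ U W, G.IsTopCutWithSides b U W

/-- `b` is a topological bond: a minimal nonempty topological cut. -/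
def IsTopBond (G : GraphLikeSpace V E) (b : Set E) : Prop :=
  Minimal (fun t => G.IsTopCut t ∧ t.Nonempty) b

/-- `H` contains a vertex on each of the sides `U` and `W` of a topological cut. -/
def MeetsBothSides (G : GraphLikeSpace V E) (H U W : Set G.Carrier) : Prop :=
  (∃ x, G.vert x ∈ H ∩ U) ∧ ∃ y, G.vert y ∈ H ∩ W

/-! ### Deleting superfluous vertices -/

/-- The subspace of `G` with the same edges and with vertex set `S`. -/
def restrictVerts (G : GraphLikeSpace V E) (S : Set V)
    (hs : ∀ e, G.src e ∈ S) (ht : ∀ e, G.tgt e ∈ S) : GraphLikeSpace S E where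
  top := G.top.induced (ptMap Subtype.val fun e => .inl (e, true))
  src e := ⟨G.src e, hs e⟩
  tgt e := ⟨G.tgt e, ht e⟩
  continuous_edgeMap e := by
    rw [continuous_induced_rng]
    convert G.continuous_edgeMap e using 1
    funext x
    simp only [Function.comp, Pt.edgeMap]
    split_ifs <;> rfl
  isOpenMap_inner e := by
    intro O hO
    refine ⟨_, G.isOpenMap_inner e O hO, ?_⟩
    ext p
    cases p with
    | vert x => simp [ptMap]
    | inner f r => simp [ptMap]
  exists_separation x y hxy := by
    obtain ⟨U, W, hU, hW, hd, hc, hx, hy⟩ :=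
      G.exists_separation x y (fun h => hxy (Subtype.ext h))
    exact ⟨_, _, ⟨U, hU, rfl⟩, ⟨W, hW, rfl⟩, hd.preimage _, fun z => hc z, hx, hy⟩

/-- The vertices of `G` that lie on at least one edge or pseudo-circle of `G`. -/
def hatVerts (G : GraphLikeSpace V E) : Set V :=
  {x | (∃ e, x = G.src e ∨ x = G.tgt e) ∨ ∃ P, G.IsPseudoCircleIn P ∧ G.vert x ∈ P}

/-- The space obtained from `G` by keeping all edges, but only those vertices that lie on at least
one edge or pseudo-circle. -/
def hat (G : GraphLikeSpace V E) : GraphLikeSpace G.hatVerts E :=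
  G.restrictVerts G.hatVerts (fun e => .inl ⟨e, .inl rfl⟩) (fun e => .inl ⟨e, .inr rfl⟩)

end GraphLikeSpace

/-! ## The graph-like space of a graph framework -/

namespace GraphFramework

variable {α : Type u} {M : Matroid α}

/-- The vertex set `{-1, 1}^{C*(M)}`. -/
abbrev Verts (M : Matroid α) : Type u := {b : Set α // M.IsCocircuit b} → ℤˣ

/-- The subbasic open set `U_b^i(ε)`. -/
def subbasic (Γ : GraphFramework M) (b : {b : Set α // M.IsCocircuit b}) (i : ℤˣ)
    (ε : M.E → Set.Ioo (0 : ℝ) 1) : Set (Pt (Verts M) M.E)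
  | .vert x => x b = i
  | .inner e r =>
    (e.1 ∉ b.1 ∧ Γ.σ b.1 e.1 = i) ∨
    (e.1 ∈ b.1 ∧ Γ.d b.1 e.1 = i ∧ 1 - (ε e : ℝ) < (r : ℝ)) ∨
    (e.1 ∈ b.1 ∧ Γ.d b.1 e.1 = -i ∧ (r : ℝ) < (ε e : ℝ))

/-- The topology of `G(M,Γ)`. -/
@[reducible]
def topology (Γ : GraphFramework M) : TopologicalSpace (Pt (Verts M) M.E) :=
  TopologicalSpace.generateFrom
    ({O | ∃ (e : M.E) (U : Set (Set.Ioo (0 : ℝ) 1)), IsOpen U ∧ O = Pt.inner e '' U} ∪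
      {O | ∃ b i ε, O = Γ.subbasic b i ε})

open Classical in
/-- The vertex `ι_e(0)`. -/
noncomputable def srcVert (Γ : GraphFramework M) (e : M.E) : Verts M := fun b =>
  if e.1 ∈ b.1 then -(Γ.d b.1 e.1) else Γ.σ b.1 e.1

open Classical in
/-- The vertex `ι_e(1)`. -/
noncomputable def tgtVert (Γ : GraphFramework M) (e : M.E) : Verts M := fun b =>
  if e.1 ∈ b.1 then Γ.d b.1 e.1 else Γ.σ b.1 e.1

theorem mem_subbasic_vert (Γ : GraphFramework M) (b i ε) (x : Verts M) :
    Pt.vert x ∈ Γ.subbasic b i ε ↔ x b = i := Iff.rfl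

theorem mem_subbasic_inner (Γ : GraphFramework M) (b i ε) (e : M.E) (r) :
    Pt.inner e r ∈ Γ.subbasic b i ε ↔ (e.1 ∉ b.1 ∧ Γ.σ b.1 e.1 = i) ∨
    (e.1 ∈ b.1 ∧ Γ.d b.1 e.1 = i ∧ 1 - (ε e : ℝ) < (r : ℝ)) ∨
    (e.1 ∈ b.1 ∧ Γ.d b.1 e.1 = -i ∧ (r : ℝ) < (ε e : ℝ)) := Iff.rfl

theorem units_ne_neg (i : ℤˣ) : i ≠ -i := by
  rcases Int.units_eq_one_or i with rfl | rfl <;> decide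

theorem units_eq_or (i j : ℤˣ) : i = j ∨ i = -j := by
  rcases Int.units_eq_one_or i with rfl | rfl <;>
    rcases Int.units_eq_one_or j with rfl | rfl <;> decide

theorem continuous_edgeMap (Γ : GraphFramework M) (e : M.E) :
    @Continuous _ _ _ Γ.topology (Pt.edgeMap e (Γ.srcVert e) (Γ.tgtVert e)) := by
  refine continuous_generateFrom_iff.2 ?_
  rintro O (⟨f, U, hU, rfl⟩ | ⟨b, i, ε, rfl⟩)
  · obtain ⟨U', hU', rfl⟩ := hU
    by_cases hfe : f = e
    · subst hfe
      have : Pt.edgeMap f (Γ.srcVert f) (Γ.tgtVert f) ⁻¹' (Pt.inner f '' (Subtype.val ⁻¹' U'))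
          = (Subtype.val : unitInterval → ℝ) ⁻¹' (U' ∩ Set.Ioo 0 1) := by
        ext x
        by_cases h : 0 < (x : ℝ) ∧ (x : ℝ) < 1
        · have h' : 0 < x ∧ x < 1 := h
          simp [Pt.edgeMap, h'.1, h'.2]
        · have h' : ¬ (0 < (x : ℝ) ∧ (x : ℝ) < 1) := h
          rw [Set.mem_preimage, Pt.edgeMap, dif_neg h']
          refine iff_of_false ?_ fun hx => h' hx.2
          split_ifs <;> simp
      rw [this]
      exact (hU'.inter isOpen_Ioo).preimage continuous_subtype_val
    · convert isOpen_empty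
      ext x
      simp only [Set.mem_preimage, Pt.edgeMap, Set.mem_empty_iff_false, iff_false]
      split_ifs <;> simp [hfe]
  · have hε := (ε e).2
    have key : ∀ x : unitInterval,
        Pt.edgeMap e (Γ.srcVert e) (Γ.tgtVert e) x ∈ Γ.subbasic b i ε ↔
          (e.1 ∉ b.1 ∧ Γ.σ b.1 e.1 = i) ∨
          (e.1 ∈ b.1 ∧ Γ.d b.1 e.1 = i ∧ 1 - (ε e : ℝ) < (x : ℝ)) ∨
          (e.1 ∈ b.1 ∧ Γ.d b.1 e.1 = -i ∧ (x : ℝ) < (ε e : ℝ)) := by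
      intro x
      by_cases h : 0 < (x : ℝ) ∧ (x : ℝ) < 1
      · rw [Pt.edgeMap, dif_pos h, mem_subbasic_inner]
      · have hx : x = 0 ∨ x = 1 := by
          rcases lt_or_eq_of_le x.2.1 with h0 | h0
          · right
            exact Subtype.ext (le_antisymm x.2.2 (not_lt.1 fun h1 => h ⟨h0, h1⟩))
          · exact .inl (Subtype.ext h0.symm)
        have hi := units_ne_neg i
        rcases hx with rfl | rfl
        · rw [Pt.edgeMap, dif_neg h, if_pos rfl, mem_subbasic_vert, srcVert]
          by_cases hb : e.1 ∈ b.1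
          · have h1 : ¬ (1 - (ε e : ℝ) < 0) := by linarith [hε.2]
            simp [hb, h1, hε.1, neg_eq_iff_eq_neg]
          · simp [hb]
        · rw [Pt.edgeMap, dif_neg h, if_neg (by simp), mem_subbasic_vert, tgtVert]
          by_cases hb : e.1 ∈ b.1
          · have h1 : ¬ (1 < (ε e : ℝ)) := by linarith [hε.2]
            simp [hb, h1, hε.1]
          · simp [hb]
    have : Pt.edgeMap e (Γ.srcVert e) (Γ.tgtVert e) ⁻¹' (Γ.subbasic b i ε) =
        {x : unitInterval | (e.1 ∉ b.1 ∧ Γ.σ b.1 e.1 = i)} ∪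
        ({x : unitInterval | (e.1 ∈ b.1 ∧ Γ.d b.1 e.1 = i)} ∩ {x | 1 - (ε e : ℝ) < (x : ℝ)}) ∪
        ({x : unitInterval | (e.1 ∈ b.1 ∧ Γ.d b.1 e.1 = -i)} ∩ {x | (x : ℝ) < (ε e : ℝ)}) := by
      ext x
      simp only [Set.mem_preimage, key, Set.mem_union, Set.mem_inter_iff, Set.mem_ofPred_eq]
      tauto
    rw [this]
    exact (isOpen_const.union (isOpen_const.inter
      (isOpen_lt continuous_const continuous_subtype_val))).union
      (isOpen_const.inter (isOpen_lt continuous_subtype_val continuous_const))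

theorem disjoint_subbasic (Γ : GraphFramework M) (b) (i : ℤˣ) :
    Disjoint (Γ.subbasic b i fun _ => ⟨1 / 2, by norm_num⟩)
      (Γ.subbasic b (-i) fun _ => ⟨1 / 2, by norm_num⟩) := by
  have hi := units_ne_neg i
  rw [Set.disjoint_left]
  rintro (x | ⟨e, r⟩)
  · rw [mem_subbasic_vert, mem_subbasic_vert]
    rintro rfl
    exact hi
  · rw [mem_subbasic_inner, mem_subbasic_inner, neg_neg]
    rintro (⟨h1, h2⟩ | ⟨h1, h2, h3⟩ | ⟨h1, h2, h3⟩) (⟨k1, k2⟩ | ⟨k1, k2, k3⟩ | ⟨k1, k2, k3⟩)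
    · exact hi (h2.symm.trans k2)
    · exact h1 k1
    · exact h1 k1
    · exact k1 h1
    · exact hi (h2.symm.trans k2)
    · norm_num at h3 k3
      linarith
    · exact k1 h1
    · norm_num at h3 k3
      linarith
    · exact hi (k2.symm.trans h2)

/-- The graph-like space `G(M,Γ)`. -/
noncomputable def space (Γ : GraphFramework M) : GraphLikeSpace (Verts M) M.E where
  top := Γ.topology
  src := Γ.srcVert
  tgt := Γ.tgtVert
  continuous_edgeMap := Γ.continuous_edgeMap
  isOpenMap_inner e := fun U hU =>
    TopologicalSpace.isOpen_generateFrom_of_mem (.inl ⟨e, U, hU, rfl⟩)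
  exists_separation x y hxy := by
    obtain ⟨b, hb⟩ := Function.ne_iff.1 hxy
    refine ⟨_, _, TopologicalSpace.isOpen_generateFrom_of_mem (.inr ⟨b, x b, _, rfl⟩),
      TopologicalSpace.isOpen_generateFrom_of_mem (.inr ⟨b, -(x b), _, rfl⟩),
      Γ.disjoint_subbasic b (x b), ?_, rfl, ?_⟩
    · intro z
      exact units_eq_or (z b) (x b)
    · exact (units_eq_or (y b) (x b)).resolve_left (Ne.symm hb)

end GraphFramework

end InfGraphic

namespace InfGraphic

universe u

/-! ### Triangular incidence patterns in tame matroids with even circuit-cocircuit intersections -/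

section MatroidLemmas

open Set

variable {α : Type u} {M : Matroid α}

/-! The implications run 1 → 3 → 4 → 2 → 1, and only 4 → 2 is deep. Extend a basis of `X` to a base
`S` of `M`. For vertices `x`, `z` of the standard subspace, let the path consist of those `e ∈ S`
whose fundamental cocircuit has `x` and `z` on different sides. Every cocircuit is a topological
bond (`isTopBond_of_isCocircuit`), and if `e ∈ S` is not in `X` its fundamental cocircuit misses `X`
altogether; so 4 forces every path edge into `X` (`pathSet_subset_of_forall_coc`). It remains to see
that the path, with its limit vertices, is a pseudo-arc of the hat space (`isPseudoArc_hat`).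

The main tool is a product formula, `Nice`: for vertices `v`, `w` of the hat space and a cocircuit
`b`, the sign `v b * w b` is the product of the corresponding signs at the fundamental cocircuits of
the elements of `S ∩ b`, almost all of which are 1. Hence a path meets every cocircuit finitely,
which gives compactness, and its vertices are told apart by the fundamental cocircuits of its own
edges. The formula holds across an edge because circuits meet cocircuits evenly. It passes to limits
along a circuit because only finitely many of the fundamental cocircuits involved meet that circuit
(`finite_fundCocircuit_inter_nonempty`). That finiteness is the matroidal core: an infinite
counterexample contains a triangular incidence pattern, which tameness excludes.

By `σ_coc_or` the edges of a path are linearly ordered, and walking back over finitely many relevant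
edges at a time shows that no finite set of cocircuits can break the path (`pathVerts_subset`).
Compactness turns this combinatorial connectedness into topological connectedness
(`IsChainConnected.isPreconnected`).

Finally, the path must stay inside the hat space. Its vertices are exactly those lying on an edge or
in the closure of a circuit (`Good`): closures of circuits are pseudo-circles
(`isPseudoCircle_sub`), and conversely the vertices of every pseudo-circle are such
(`good_of_mem_isPseudoCircleIn`). That limits of path edges are again of this kind is
`good_of_mem_limVerts_pathSet`. -/

theorem exists_isCocircuit_of_notMem_closure {X : Set α} {e : α} (he : e ∈ M.E)
    (heX : e ∉ M.closure X) : ∃ K, M.IsCocircuit K ∧ e ∈ K ∧ Disjoint K X := by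
  obtain ⟨I, hI⟩ := M.exists_isBasis' X
  have heI : e ∉ M.closure I := by rwa [hI.closure_eq_closure]
  have hins : M.Indep (insert e I) := by
    rw [hI.indep.insert_indep_iff]; exact .inl ⟨he, heI⟩
  have heI' : e ∉ I := fun h => heI (M.mem_closure_of_mem' h)
  obtain ⟨B, hB, hIB⟩ := hins.exists_isBase_superset
  have heB : e ∈ B := hIB (mem_insert _ _)
  refine ⟨_, hB.compl_closure_sdiff_singleton_isCocircuit heB,
    ⟨he, hB.indep.notMem_closure_sdiff_of_mem heB⟩, ?_⟩
  rw [Set.disjoint_left]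
  rintro f ⟨hfE, hf⟩ hfX
  apply hf
  have : M.closure X ⊆ M.closure (B \ {e}) := by
    rw [← hI.closure_eq_closure]
    refine M.closure_subset_closure fun y hy => ⟨hIB (mem_insert_of_mem _ hy), ?_⟩
    rintro rfl; exact heI' hy
  exact this (M.mem_closure_of_mem' hfX)

/-- The complement of a cocircuit is a hyperplane: it does not span, but by minimality of `b` it
spans as soon as one element of `b` is put back. -/
theorem isBase_insert_of_isBasis_compl {b I : Set α} {e : α} (hb : M.IsCocircuit b)
    (hI : M.IsBasis I (M.E \ b)) (he : e ∈ b) : M.IsBase (insert e I) := by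
  have hmin := hb
  rw [Matroid.isCocircuit_iff_minimal_compl_nonspanning, minimal_iff_forall_ssubset] at hmin
  have heE : e ∈ M.E := hb.subset_ground he
  have hsp : M.Spanning (M.E \ (b \ {e})) :=
    not_not.1 (hmin.2 (t := b \ {e}) (sdiff_singleton_ssubset.2 he))
  have heq : M.E \ (b \ {e}) = insert e (M.E \ b) := by
    ext y; by_cases hy : y = e
    · subst hy; simp [heE]
    · simp [hy]
  have hcl : M.closure (insert e I) = M.E := by
    rw [← hsp.closure_eq, heq, ← M.closure_insert_closure_eq_closure_insert e I,
      hI.closure_eq_closure, M.closure_insert_closure_eq_closure_insert]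
  have heI : e ∉ M.closure I := by
    intro h
    apply hmin.1
    rw [Matroid.spanning_iff_closure_eq sdiff_subset, ← hI.closure_eq_closure, ← hcl,
      Matroid.closure_insert_eq_of_mem_closure h]
  refine Matroid.Indep.isBase_of_spanning ?_ ?_
  · rw [hI.indep.insert_indep_iff]; exact .inl ⟨heE, heI⟩
  · rw [Matroid.spanning_iff_closure_eq (insert_subset heE hI.indep.subset_ground), hcl]

/-- Independence of `L` after contraction of `J` depends only on the closure of `J`, so `J` may be
replaced by any basis of that closure, in particular by one containing `W`. -/
theorem indep_union_of_subset_closure {J L W : Set α} (hJL : M.Indep (J ∪ L)) (hd : Disjoint J L)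
    (hW : M.Indep W) (hWJ : W ⊆ M.closure J) :
    M.Indep (W ∪ L) ∧ Disjoint (M.closure J) L := by
  have hJ : M.Indep J := hJL.subset subset_union_left
  have hdis : Disjoint (M.closure J) L := by
    rw [Set.disjoint_right]
    intro y hyL hy
    have hyJ : y ∉ J := fun h => Set.disjoint_left.1 hd h hyL
    have := hJL.subset (I := insert y J) (insert_subset (.inr hyL) subset_union_left)
    exact (hJ.mem_closure_iff_of_notMem hyJ |>.1 hy).not_indep this
  obtain ⟨W', hW', hWW'⟩ := hW.subset_isBasis_of_subset hWJ
  have h1 := (hJ.isBasis_closure.contract_indep_iff (J := L)).2 ⟨by rwa [union_comm], hdis⟩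
  have h2 := (hW'.contract_indep_iff (J := L)).1 h1
  exact ⟨h2.1.subset (union_subset (hWW'.trans subset_union_right) subset_union_left), hdis⟩

/-- After contracting `Y`, the set `I` is independent and a subset of the finite set `F` spans;
compare ranks. -/
theorem finite_of_indep_of_spanning {Y I F : Set α} (hYI : M.Indep (Y ∪ I)) (hd : Disjoint Y I)
    (hsp : M.Spanning (Y ∪ F)) (hF : F.Finite) : I.Finite := by
  have hY : M.Indep Y := hYI.subset subset_union_left
  have h1 : (M.contract Y).Indep I := hY.contract_indep_iff.2 ⟨hd.symm, by rwa [union_comm]⟩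
  have h2 : (M.contract Y).Spanning ((Y ∪ F) \ Y) := hsp.contract Y
  have h3 : ((Y ∪ F) \ Y).Finite := hF.subset fun y hy => hy.1.resolve_left hy.2
  have h4 := h1.encard_le_eRank
  rw [← h2.eRk_eq] at h4
  exact Set.encard_lt_top_iff.1
    ((h4.trans (Matroid.eRk_le_encard _ _)).trans_lt (Set.encard_lt_top_iff.2 h3))

/-- Every circuit meets every cocircuit in an even number of elements. -/
def IsEvenMeeting (M : Matroid α) : Prop :=
  ∀ o b, M.IsCircuit o → M.IsCocircuit b → Even (o ∩ b).ncard

theorem eq_of_mem_fundCocircuit_of_mem {B : Set α} {x y : α} (hx : x ∈ B)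
    (hy : y ∈ M.fundCocircuit x B) (hyB : y ∈ B) : y = x := by
  have : y ∈ M.fundCocircuit x B ∩ B := ⟨hy, hyB⟩
  rwa [Matroid.fundCocircuit_inter_eq M hx] at this

/-- Replace all `x i` in `B` by the `E i`. Triangularity allows each `x n` to be recovered in turn,
so the new set `T` spans and some circuit through `g` lies in `T + g`. By tameness this circuit uses
only finitely many `E i`, and the fundamental cocircuit of a late `x n` then meets it in `g` alone.
-/
theorem IsBase.false_of_triangular (htame : IsTame M) {B b : Set α} (hB : M.IsBase B)
    (hb : M.IsCocircuit b) {x E : ℕ → α} {g : α} (hx : ∀ i, x i ∈ B) (hE : ∀ i, E i ∈ b)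
    (hEB : ∀ i, E i ∉ B) (hgE : g ∈ M.E) (hgB : g ∉ B) (hg : ∀ i, g ≠ E i)
    (hxg : ∀ i, x i ∈ M.fundCircuit g B) (hxE : ∀ i, x i ∈ M.fundCircuit (E i) B)
    (hlt : ∀ i j, i < j → x j ∉ M.fundCircuit (E i) B) : False := by
  set T : Set α := (B \ range x) ∪ range E with hT
  have hTE : T ⊆ M.E := union_subset (sdiff_subset.trans hB.subset_ground)
    (range_subset_iff.2 fun i => hb.subset_ground (hE i))
  have hcirc : ∀ i, M.IsCircuit (M.fundCircuit (E i) B) := fun i =>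
    hB.fundCircuit_isCircuit (hb.subset_ground (hE i)) (hEB i)
  have hxcl : ∀ n, x n ∈ M.closure T := by
    intro n
    induction n using Nat.strong_induction_on with
    | _ n ih =>
      have h1 := (hcirc n).mem_closure_sdiff_singleton_of_mem (hxE n)
      refine Matroid.closure_subset_closure_of_subset_closure ?_ h1
      rintro y ⟨hy, hyn⟩
      rcases M.fundCircuit_subset_insert _ _ hy with rfl | hyB
      · exact M.mem_closure_of_mem (.inr ⟨n, rfl⟩)
      by_cases hyx : y ∈ range x
      · obtain ⟨m, rfl⟩ := hyx
        rcases lt_trichotomy m n with h | h | h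
        · exact ih m h
        · subst h; exact absurd rfl hyn
        · exact absurd hy (hlt n m h)
      · exact M.mem_closure_of_mem (.inl ⟨hyB, hyx⟩)
  have hBcl : B ⊆ M.closure T := by
    intro y hy
    by_cases hyx : y ∈ range x
    · obtain ⟨m, rfl⟩ := hyx; exact hxcl m
    · exact M.mem_closure_of_mem (.inl ⟨hy, hyx⟩)
  have hgcl : g ∈ M.closure T := by
    refine Matroid.closure_subset_closure_of_subset_closure hBcl ?_
    rwa [hB.closure_eq]
  have hgT : g ∉ T := by
    rintro (h | ⟨i, hi⟩)
    · exact hgB h.1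
    · exact hg i hi.symm
  obtain ⟨o, hoT, ho, hgo⟩ := (Matroid.mem_closure_iff_exists_isCircuit hgT).1 hgcl
  have hinj : Function.Injective E := by
    intro i j hij
    rcases lt_trichotomy i j with h | h | h
    · exact absurd (hij ▸ hxE j) (hlt i j h)
    · exact h
    · exact absurd (hij ▸ hxE i) (hlt j i h)
  have hfin : {i | E i ∈ o}.Finite := by
    refine Set.Finite.preimage (f := E) (s := o ∩ b) hinj.injOn (htame o b ho hb) |>.subset ?_
    intro i hi; exact ⟨hi, hE i⟩
  -- `n` bounds the indices of the `E i` on `o`; by triangularity the fundamental cocircuit of `x (n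
  -- + 1)` contains none of these `E i`.
  obtain ⟨n, hn⟩ := hfin.bddAbove
  have hK := Matroid.fundCocircuit_isCocircuit (hx (n + 1)) hB
  refine ho.inter_isCocircuit_ne_singleton hK (e := g) ?_
  ext y
  constructor
  · rintro ⟨hyo, hyK⟩
    rcases hoT hyo with rfl | hy | ⟨i, rfl⟩
    · rfl
    · exact absurd ⟨_, (eq_of_mem_fundCocircuit_of_mem (hx _) hyK hy.1).symm⟩ hy.2
    · rw [hB.mem_fundCocircuit_iff_mem_fundCircuit] at hyK
      have : i ≤ n := hn hyo
      exact absurd hyK (hlt i (n + 1) (by omega))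
  · rintro rfl
    exact ⟨hgo, hB.mem_fundCocircuit_iff_mem_fundCircuit.2 (hxg _)⟩

/-- Exchanging `e` for `E 0` complements the incidence pattern: with respect to the new base, parity
puts `E i` into the fundamental cocircuit of `x j` exactly when `x j` was not in the old fundamental
circuit of `E i`. The indices `i + 1` then form a triangular pattern, with `e` in the role of `g`.
-/
theorem IsBase.false_of_cotriangular (htame : IsTame M) (heven : IsEvenMeeting M) {B b : Set α}
    (hB : M.IsBase B) (hb : M.IsCocircuit b) {x E : ℕ → α} {e : α} (he : B ∩ b = {e})
    (hx : ∀ i, x i ∈ B) (hE : ∀ i, E i ∈ b) (hEB : ∀ i, E i ∉ B)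
    (hxE : ∀ i, x i ∉ M.fundCircuit (E i) B)
    (hlt : ∀ i j, i < j → x j ∈ M.fundCircuit (E i) B) : False := by
  have heB : e ∈ B := (he.symm.subset rfl).1
  have heb : e ∈ b := (he.symm.subset rfl).2
  have hcirc : ∀ i, M.IsCircuit (M.fundCircuit (E i) B) := fun i =>
    hB.fundCircuit_isCircuit (hb.subset_ground (hE i)) (hEB i)
  have hinj : ∀ i j, i < j → E i ≠ E j := fun i j h hij => hxE j (hij ▸ hlt i j h)
  have heC : ∀ i, e ∈ M.fundCircuit (E i) B := by
    intro i
    by_contra h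
    refine (hcirc i).inter_isCocircuit_ne_singleton hb (e := E i) ?_
    ext y
    constructor
    · rintro ⟨hy, hyb⟩
      rcases M.fundCircuit_subset_insert _ _ hy with rfl | hyB
      · rfl
      · have : y ∈ B ∩ b := ⟨hyB, hyb⟩
        rw [he] at this
        rw [mem_singleton_iff] at this
        exact absurd (this ▸ hy) h
    · rintro rfl
      exact ⟨M.mem_fundCircuit _ _, hE i⟩
  have hB' : M.IsBase (insert (E 0) (B \ {e})) := by
    refine hB.exchange_isBase_of_indep (hEB 0) ?_
    have := (hB.indep.mem_fundCircuit_iff (by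
      rw [hB.closure_eq]; exact hb.subset_ground (hE 0)) (hEB 0)).1 (heC 0)
    rwa [← insert_sdiff_singleton_comm] at this
    rintro h
    exact hEB 0 (h ▸ heB)
  set B' := insert (E 0) (B \ {e}) with hB'def
  have hxe : ∀ i, x i ≠ e := fun i h => hxE i (h ▸ heC i)
  have hxB' : ∀ i, x i ∈ B' := fun i => .inr ⟨hx i, hxe i⟩
  -- With at most three candidates for the intersection, excluding intersections of size one or
  -- three settles every incidence needed below.
  have key : ∀ i j, M.fundCircuit (E i) B ∩ M.fundCocircuit (x j) B' ⊆ {x j, e, E i} := by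
    rintro i j y ⟨hy, hyK⟩
    rcases M.fundCircuit_subset_insert _ _ hy with rfl | hyB
    · simp
    by_cases hye : y = e
    · simp [hye]
    · exact .inl (eq_of_mem_fundCocircuit_of_mem (hxB' j) hyK (.inr ⟨hyB, hye⟩))
  have hK : ∀ j, M.IsCocircuit (M.fundCocircuit (x j) B') := fun j =>
    Matroid.fundCocircuit_isCocircuit (hxB' j) hB'
  have hE0 : ∀ j, 0 < j → E 0 ∉ M.fundCocircuit (x j) B' := by
    intro j hj h
    have h1 := eq_of_mem_fundCocircuit_of_mem (hxB' j) h (mem_insert _ _)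
    exact hEB 0 (h1 ▸ hx j)
  have heK : ∀ j, 0 < j → e ∈ M.fundCocircuit (x j) B' := by
    intro j hj
    by_contra h
    refine (hcirc 0).inter_isCocircuit_ne_singleton (hK j) (e := x j) ?_
    refine subset_antisymm (fun y hy => ?_) ?_
    · rcases key 0 j hy with rfl | rfl | rfl
      · rfl
      · exact absurd hy.2 h
      · exact absurd hy.2 (hE0 j hj)
    · rw [singleton_subset_iff]
      exact ⟨hlt 0 j hj, Matroid.mem_fundCocircuit _ _ _⟩
  have hEB' : ∀ i, 0 < i → E i ∉ B' := by
    rintro i hi (h | h)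
    · exact hinj 0 i hi h.symm
    · exact hEB i h.1
  refine IsBase.false_of_triangular htame hB' hb (x := fun i => x (i + 1))
    (E := fun i => E (i + 1)) (g := e) (fun i => hxB' _) (fun i => hE _)
    (fun i => hEB' _ (Nat.succ_pos i)) (hB.subset_ground heB) ?_
    (fun i h => hEB (i + 1) (h ▸ heB)) (fun i => ?_) (fun i => ?_) (fun i j hij => ?_)
  · rintro (h | h)
    · exact hEB 0 (h ▸ heB)
    · exact h.2 rfl
  · exact hB'.mem_fundCocircuit_iff_mem_fundCircuit.1 (heK _ (Nat.succ_pos i))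
  · refine hB'.mem_fundCocircuit_iff_mem_fundCircuit.1 ?_
    by_contra h
    refine (hcirc (i + 1)).inter_isCocircuit_ne_singleton (hK (i + 1)) (e := e) ?_
    refine subset_antisymm (fun y hy => ?_) ?_
    · rcases key _ _ hy with rfl | rfl | rfl
      · exact absurd hy.1 (hxE _)
      · rfl
      · exact absurd hy.2 h
    · rw [singleton_subset_iff]
      exact ⟨heC _, heK _ (Nat.succ_pos i)⟩
  · intro h
    have h := hB'.mem_fundCocircuit_iff_mem_fundCircuit.2 h
    have heq : M.fundCircuit (E (i + 1)) B ∩ M.fundCocircuit (x (j + 1)) B'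
        = {x (j + 1), e, E (i + 1)} := by
      refine subset_antisymm (key _ _) ?_
      rintro y (rfl | rfl | rfl)
      · exact ⟨hlt _ _ (by omega), Matroid.mem_fundCocircuit _ _ _⟩
      · exact ⟨heC _, heK _ (Nat.succ_pos j)⟩
      · exact ⟨M.mem_fundCircuit _ _, h⟩
    have h3 : ({x (j + 1), e, E (i + 1)} : Set α).ncard = 3 := by
      rw [Set.ncard_eq_three]
      exact ⟨_, _, _, hxe _, fun h => hEB (i + 1) (by rw [← h]; exact hx _), fun h => hEB (i + 1) (h ▸ heB), rfl⟩
    have := heven _ _ (hcirc (i + 1)) (hK (j + 1))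
    rw [heq, h3] at this
    exact absurd this (by decide)

/-- A Ramsey-type thinning. A test that separates two elements splits the infinite set of survivors;
keep an infinite half together with an element giving the opposite answer. Each chosen element then
differs at its own test from all later ones, and infinitely many of these answers have the same
truth value. -/
theorem exists_separating_sequence {β γ : Type*} {X : Set β} {𝓔 : Set γ} (r : β → γ → Prop)
    (hX : X.Infinite) (hsep : ∀ x ∈ X, ∀ y ∈ X, x ≠ y → ∃ e ∈ 𝓔, ¬ (r x e ↔ r y e)) :
    ∃ (x : ℕ → β) (e : ℕ → γ), (∀ i, x i ∈ X) ∧ (∀ i, e i ∈ 𝓔) ∧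
      (((∀ i, r (x i) (e i)) ∧ ∀ i j, i < j → ¬ r (x j) (e i)) ∨
        ((∀ i, ¬ r (x i) (e i)) ∧ ∀ i j, i < j → r (x j) (e i))) := by
  have step : ∀ Y : {Y : Set β // Y ⊆ X ∧ Y.Infinite}, ∃ (p : β × γ)
      (Y' : {Y : Set β // Y ⊆ X ∧ Y.Infinite}), p.1 ∈ Y.1 ∧ p.2 ∈ 𝓔 ∧ Y'.1 ⊆ Y.1 ∧
        ∀ y ∈ Y'.1, ¬ (r p.1 p.2 ↔ r y p.2) := by
    rintro ⟨Y, hYX, hY⟩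
    obtain ⟨p, hp⟩ := hY.nonempty
    obtain ⟨q, hq, hqp⟩ := hY.exists_notMem_finite (finite_singleton p)
    obtain ⟨e, he, hpq⟩ := hsep p (hYX hp) q (hYX hq) (fun h => hqp h.symm)
    have hun : Y = {y ∈ Y | (r p e ↔ r y e)} ∪ {y ∈ Y | ¬ (r p e ↔ r y e)} := by
      ext y; by_cases h : (r p e ↔ r y e) <;> simp [h]
    rw [hun, Set.infinite_union] at hY
    -- If infinitely many survivors answer like `p`, record `q` and keep those; otherwise record `p`
    -- and keep the rest.
    rcases hY with hY | hY
    · refine ⟨(q, e), ⟨_, (Set.sep_subset _ _).trans hYX, hY⟩, hq, he, Set.sep_subset _ _, ?_⟩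
      rintro y ⟨-, hy⟩
      simp only
      tauto
    · exact ⟨(p, e), ⟨_, (Set.sep_subset _ _).trans hYX, hY⟩, hp, he, Set.sep_subset _ _,
        fun y hy => hy.2⟩
  choose p Y' h1 h2 h3 h4 using step
  let Z : ℕ → {Y : Set β // Y ⊆ X ∧ Y.Infinite} := fun n => Y'^[n] ⟨X, Subset.rfl, hX⟩
  have hZ : ∀ n, Z (n + 1) = Y' (Z n) := fun n => Function.iterate_succ_apply' _ _ _
  have hanti : ∀ m n, m ≤ n → (Z n).1 ⊆ (Z m).1 := by
    intro m n hmn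
    induction n, hmn using Nat.le_induction with
    | base => exact Subset.rfl
    | succ n _ ih => rw [hZ]; exact (h3 _).trans ih
  have hdiff : ∀ i j, i < j → ¬ (r (p (Z i)).1 (p (Z i)).2 ↔ r (p (Z j)).1 (p (Z i)).2) := by
    intro i j hij
    have := hanti (i + 1) j hij (h1 (Z j))
    rw [hZ] at this
    exact h4 _ _ this
  have hcase : {i | r (p (Z i)).1 (p (Z i)).2}.Infinite ∨ {i | ¬ r (p (Z i)).1 (p (Z i)).2}.Infinite := by
    rw [← Set.infinite_union]
    convert! Set.infinite_univ (α := ℕ)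
    ext i
    by_cases h : r (p (Z i)).1 (p (Z i)).2 <;> simp [h]
  rcases hcase with h | h
  · refine ⟨fun n => (p (Z (Nat.nth (fun i => r (p (Z i)).1 (p (Z i)).2) n))).1,
      fun n => (p (Z (Nat.nth (fun i => r (p (Z i)).1 (p (Z i)).2) n))).2,
      fun i => (Z _).2.1 (h1 _), fun i => h2 _, .inl ⟨fun i => Nat.nth_mem_of_infinite h i, ?_⟩⟩
    intro i j hij
    have := hdiff _ _ (Nat.nth_strictMono h hij)
    have := Nat.nth_mem_of_infinite h i
    tauto
  · refine ⟨fun n => (p (Z (Nat.nth (fun i => ¬ r (p (Z i)).1 (p (Z i)).2) n))).1,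
      fun n => (p (Z (Nat.nth (fun i => ¬ r (p (Z i)).1 (p (Z i)).2) n))).2,
      fun i => (Z _).2.1 (h1 _), fun i => h2 _, .inr ⟨fun i => Nat.nth_mem_of_infinite h i, ?_⟩⟩
    intro i j hij
    have := hdiff _ _ (Nat.nth_strictMono h hij)
    have := Nat.nth_mem_of_infinite h i
    tauto

end MatroidLemmas

/-! ### Finiteness of the fundamental cocircuits meeting a circuit; linkage by circuits -/

section MatroidLemmas

open Set

variable {α : Type u} {M : Matroid α}

theorem exists_finite_representatives {β γ : Type*} {s : Set β} {f : β → γ} (h : (f '' s).Finite) :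
    ∃ t ⊆ s, t.Finite ∧ ∀ x ∈ s, ∃ y ∈ t, f x = f y := by
  obtain ⟨t, hts, ht⟩ := Set.exists_subset_bijOn s f
  refine ⟨t, hts, ?_, fun x hx => ?_⟩
  · exact Set.Finite.of_finite_image (h.subset (Set.image_mono hts)) ht.injOn
  · obtain ⟨y, hy, hyx⟩ := ht.surjOn ⟨x, hx, rfl⟩
    exact ⟨y, hy, hyx.symm⟩

/-- The elements of a basis of `o \ b` are distinguished in only finitely many ways by the
fundamental circuits of elements of the cocircuit `b`. -/
theorem IsBase.finite_image_fundCircuit_signature (htame : IsTame M) (heven : IsEvenMeeting M)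
    {B b o R : Set α} {e : α} (hB : M.IsBase B) (hb : M.IsCocircuit b) (ho : M.IsCircuit o)
    (he : B ∩ b = {e}) (hfin : (o \ ((o ∩ B) \ {e})).Finite) (hR : R ⊆ b) :
    ((fun x => {f ∈ R | x ∈ M.fundCircuit f B}) '' ((o ∩ B) \ {e})).Finite := by
  have heb : e ∈ b := (he.symm.subset rfl).2
  have heB : e ∈ B := (he.symm.subset rfl).1
  by_contra hinf
  set sig := fun x => {f ∈ R | x ∈ M.fundCircuit f B} with hsig
  set G := o \ ((o ∩ B) \ {e}) with hG
  -- The fundamental cocircuit of `x` meets `o` in a second element `g`, necessarily outside `B`.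
  -- There are finitely many choices of `g`, so infinitely many signatures would already occur
  -- inside a single fundamental circuit.
  have hcov : (o ∩ B) \ {e} ⊆ ⋃ g ∈ G \ B, {x ∈ (o ∩ B) \ {e} | x ∈ M.fundCircuit g B} := by
    rintro x ⟨⟨hxo, hxB⟩, hxe⟩
    have hK := Matroid.fundCocircuit_isCocircuit hxB hB
    obtain ⟨g, ⟨hgo, hgK⟩, hgx⟩ := (ho.isCocircuit_inter_nontrivial hK
      ⟨x, hxo, Matroid.mem_fundCocircuit _ _ _⟩).exists_ne x
    have hgB : g ∉ B := fun h => hgx (eq_of_mem_fundCocircuit_of_mem hxB hgK h)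
    simp only [mem_iUnion]
    exact ⟨g, ⟨⟨hgo, fun h => hgB h.1.2⟩, hgB⟩, ⟨⟨hxo, hxB⟩, hxe⟩,
      hB.mem_fundCocircuit_iff_mem_fundCircuit.1 hgK⟩
  have : ∃ g ∈ G \ B, (sig '' {x ∈ (o ∩ B) \ {e} | x ∈ M.fundCircuit g B}).Infinite := by
    by_contra hcon
    push Not at hcon
    refine hinf ((Set.Finite.biUnion (hfin.subset sdiff_subset) (t := fun g =>
      sig '' {x ∈ (o ∩ B) \ {e} | x ∈ M.fundCircuit g B}) (s := G \ B) ?_).subset ?_)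
    · intro g hg; exact hcon g hg
    · rintro _ ⟨x, hx, rfl⟩
      have := hcov hx
      simp only [mem_iUnion] at this ⊢
      obtain ⟨g, hg, hx⟩ := this
      exact ⟨g, hg, x, hx, rfl⟩
  obtain ⟨g, ⟨⟨hgo, -⟩, hgB⟩, hg⟩ := this
  obtain ⟨X, hXs, hX⟩ := Set.exists_subset_bijOn {x ∈ (o ∩ B) \ {e} | x ∈ M.fundCircuit g B} sig
  have hXinf : X.Infinite := fun h => hg (hX.image_eq ▸ h.image sig)
  obtain ⟨x, E, hxX, hE, h⟩ := exists_separating_sequence (𝓔 := R \ (B ∪ {g}))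
    (fun x f => x ∈ M.fundCircuit f B) hXinf (by
      intro x hx y hy hxy
      have hne : sig x ≠ sig y := fun h => hxy (hX.injOn hx hy h)
      obtain ⟨f, hf⟩ : ∃ f, ¬ (f ∈ sig x ↔ f ∈ sig y) := by
        by_contra hcon; push Not at hcon; exact hne (Set.ext hcon)
      have hfR : f ∈ R := by
        by_contra h; exact hf (iff_of_false (fun h' => h h'.1) (fun h' => h h'.1))
      have hf' : ¬ (x ∈ M.fundCircuit f B ↔ y ∈ M.fundCircuit f B) := fun h =>
        hf (and_congr Iff.rfl h)
      -- An `f` in `B` could only be `e`, whose fundamental circuit `{e}` contains neither `x` nor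
      -- `y`, while that of `g` contains both; so neither separates them.
      refine ⟨f, ⟨hfR, ?_⟩, hf'⟩
      rintro (hfB | rfl)
      · have hfe : f = e := by
          have : f ∈ B ∩ b := ⟨hfB, hR hfR⟩
          rwa [he] at this
        subst hfe
        rw [Matroid.fundCircuit_eq_of_mem hfB] at hf'
        exact hf' (iff_of_false (hXs hx).1.2 (hXs hy).1.2)
      · exact hf' (iff_of_true (hXs hx).2 (hXs hy).2))
  have hxB : ∀ i, x i ∈ B := fun i => (hXs (hxX i)).1.1.2
  rcases h with ⟨h1, h2⟩ | ⟨h1, h2⟩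
  · exact IsBase.false_of_triangular htame hB hb hxB (fun i => hR (hE i).1)
      (fun i h => (hE i).2 (.inl h)) (ho.subset_ground hgo) hgB
      (fun i h => (hE i).2 (.inr h.symm)) (fun i => (hXs (hxX i)).2) h1 h2
  · exact IsBase.false_of_cotriangular htame heven hB hb he hxB (fun i => hR (hE i).1)
      (fun i h => (hE i).2 (.inl h)) h1 h2

theorem exists_basis_sdiff_finite (htame : IsTame M) {o b : Set α} (ho : M.IsCircuit o)
    (hb : M.IsCocircuit b) : ∃ o₀, M.IsBasis o₀ (o \ b) ∧ (o \ o₀).Finite := by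
  by_cases h : (o ∩ b).Nonempty
  · obtain ⟨e, heo, heb⟩ := h
    have hss : o \ b ⊂ o := ⟨sdiff_subset, fun h => (h heo).2 heb⟩
    refine ⟨o \ b, (ho.ssubset_indep hss).isBasis_self, (htame o b ho hb).subset ?_⟩
    intro y hy
    exact ⟨hy.1, by_contra fun h => hy.2 ⟨hy.1, h⟩⟩
  · rw [Set.not_nonempty_iff_eq_empty, ← Set.disjoint_iff_inter_eq_empty] at h
    obtain ⟨e, he⟩ := ho.nonempty
    refine ⟨o \ {e}, ?_, (finite_singleton e).subset ?_⟩
    · rw [h.sdiff_eq_left]; exact ho.sdiff_singleton_isBasis he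
    · intro y hy
      by_contra hye
      exact hy.2 ⟨hy.1, hye⟩

/-- The claim is that `o` has finite rank over `S \ b`. With respect to a base `B` adapted to `o`
and `b`, the fundamental circuits of elements of `S ∩ b` have only finitely many traces on a basis
`o₀` of `o \ b`. Representatives of these traces, together with `e`, span over a suitable `Y ⊇ S \
b`, over which `I \ b` is still independent. -/
theorem exists_finite_closure_of_indep (htame : IsTame M) (heven : IsEvenMeeting M)
    {S o b : Set α} (hS : M.IsBase S) (ho : M.IsCircuit o) (hb : M.IsCocircuit b) {I : Set α}
    (hI : M.Indep ((S \ b) ∪ I)) (hd : Disjoint (S \ b) I) (hIo : I ⊆ o) : I.Finite := by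
  obtain ⟨o₀, ho₀, hfin⟩ := exists_basis_sdiff_finite htame ho hb
  have hXE : (o \ b) ∪ (S \ b) ⊆ M.E \ b := by
    rw [← union_sdiff_distrib]
    exact sdiff_subset_sdiff_left (union_subset ho.subset_ground hS.subset_ground)
  obtain ⟨J, hJ, hoJ⟩ := ho₀.indep.subset_isBasis_of_subset
    (X := (o \ b) ∪ (S \ b)) (ho₀.subset.trans subset_union_left) (hXE.trans sdiff_subset)
  obtain ⟨H, hH, hJH⟩ := hJ.indep.subset_isBasis_of_subset (hJ.subset.trans hXE) sdiff_subset
  obtain ⟨e, heS, heb⟩ : ∃ e ∈ S, e ∈ b := by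
    by_contra hcon
    push Not at hcon
    have := hb
    rw [Matroid.isCocircuit_iff_minimal_compl_nonspanning] at this
    exact this.prop (hS.spanning_of_superset (fun y hy => ⟨hS.subset_ground hy, hcon y hy⟩)
      sdiff_subset)
  set B := insert e H with hBdef
  have hB : M.IsBase B := isBase_insert_of_isBasis_compl hb hH heb
  have hBb : B ∩ b = {e} := by
    ext y; constructor
    · rintro ⟨rfl | hy, hyb⟩
      · rfl
      · exact absurd hyb (hH.subset hy).2
    · rintro rfl; exact ⟨mem_insert _ _, heb⟩
  have heo₀ : e ∉ o₀ := fun h => (ho₀.subset h).2 heb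
  have hclo : ∀ y ∈ o \ b, y ∈ H → y ∈ o₀ := by
    intro y hy hyH
    by_contra hyo
    have h1 := ho₀.subset_closure hy
    have h2 : M.Indep (insert y o₀) := hH.indep.subset (insert_subset hyH (hoJ.trans hJH))
    exact (ho₀.indep.mem_closure_iff_of_notMem hyo |>.1 h1).not_indep h2
  have hoB : (o ∩ B) \ {e} = o₀ := by
    ext y; constructor
    · rintro ⟨⟨hyo, rfl | hyH⟩, hye⟩
      · exact absurd rfl hye
      · exact hclo y ⟨hyo, (hH.subset hyH).2⟩ hyH
    · intro hy
      exact ⟨⟨(ho₀.subset hy).1, .inr (hJH (hoJ hy))⟩, fun h => heo₀ (h ▸ hy)⟩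
  have hsig := IsBase.finite_image_fundCircuit_signature htame heven hB hb ho hBb
    (by rwa [hoB]) (R := S ∩ b) inter_subset_right
  rw [hoB] at hsig
  -- Transposition: an incidence matrix with finitely many distinct rows has finitely many distinct
  -- columns.
  have htr : ((fun f => {x ∈ o₀ | x ∈ M.fundCircuit f B}) '' (S ∩ b)).Finite := by
    refine ((hsig.finite_subsets).image
      fun t => {x ∈ o₀ | {f ∈ S ∩ b | x ∈ M.fundCircuit f B} ∈ t}).subset ?_
    rintro _ ⟨f, hf, rfl⟩
    refine ⟨{s ∈ (fun x => {f ∈ S ∩ b | x ∈ M.fundCircuit f B}) '' o₀ | f ∈ s},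
      Set.sep_subset _ _, ?_⟩
    ext x
    constructor
    · rintro ⟨hx, h, h'⟩
      exact ⟨hx, h'.2⟩
    · rintro ⟨hx, h⟩
      exact ⟨hx, ⟨x, hx, rfl⟩, hf, h⟩
  obtain ⟨F, hFS, hF, hrep⟩ := exists_finite_representatives htr
  set Y := (S \ b) ∪ (H \ J) with hY
  have hHY : H \ o₀ ⊆ Y := by
    rintro y ⟨hyH, hyo⟩
    by_cases hyJ : y ∈ J
    · rcases hJ.subset hyJ with h | h
      · exact absurd (hclo y h hyH) hyo
      · exact .inl h
    · exact .inr ⟨hyH, hyJ⟩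
  have hYE : Y ∪ insert e F ⊆ M.E := by
    refine union_subset (union_subset (sdiff_subset.trans hS.subset_ground)
      (sdiff_subset.trans hH.indep.subset_ground)) (insert_subset (hS.subset_ground heS) ?_)
    exact hFS.trans (inter_subset_left.trans hS.subset_ground)
  have hspan : M.Spanning (Y ∪ insert e F) := by
    rw [Matroid.spanning_iff_ground_subset_closure hYE, ← hS.closure_eq]
    refine Matroid.closure_subset_closure_of_subset_closure fun f hfS => ?_
    by_cases hfb : f ∈ b
    swap
    · exact M.mem_closure_of_mem (.inl (.inl ⟨hfS, hfb⟩)) hYE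
    -- A cocircuit `K` through `f` that misses `Y`, `e` and `F` can meet the fundamental circuit of
    -- `f` only in `f` and in its trace on `o₀`. The representative `f'` has the same trace but is
    -- not in `K`, so both the trace and the trace plus one would meet `K` evenly.
    by_contra hfcl
    obtain ⟨K, hK, hfK, hKY⟩ :=
      exists_isCocircuit_of_notMem_closure (hS.subset_ground hfS) hfcl
    have hfB : f ∉ B := by
      intro h
      have : f ∈ B ∩ b := ⟨h, hfb⟩
      rw [hBb] at this
      exact Set.disjoint_left.1 hKY hfK (.inr (.inl this))
    obtain ⟨f', hf', heq⟩ := hrep f ⟨hfS, hfb⟩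
    have hmeet : ∀ h, M.fundCircuit h B ∩ K ⊆ insert h ({x ∈ o₀ | x ∈ M.fundCircuit h B} ∩ K) := by
      rintro h y ⟨hy, hyK⟩
      rcases M.fundCircuit_subset_insert _ _ hy with rfl | rfl | hyH
      · exact .inl rfl
      · exact absurd (.inr (.inl rfl)) (Set.disjoint_left.1 hKY hyK)
      · by_cases hyo : y ∈ o₀
        · exact .inr ⟨⟨hyo, hy⟩, hyK⟩
        · exact absurd (.inl (hHY ⟨hyH, hyo⟩)) (Set.disjoint_left.1 hKY hyK)
    have hcf := hB.fundCircuit_isCircuit (hS.subset_ground hfS) hfB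
    have hAK : M.fundCircuit f B ∩ K = insert f ({x ∈ o₀ | x ∈ M.fundCircuit f B} ∩ K) := by
      refine subset_antisymm (hmeet f) ?_
      rintro y (rfl | hy)
      · exact ⟨M.mem_fundCircuit _ _, hfK⟩
      · exact ⟨hy.1.2, hy.2⟩
    have hfin' := htame _ _ hcf hK
    have hodd := heven _ _ hcf hK
    rw [hAK, Set.ncard_insert_of_notMem (fun h => hfB (.inr (hJH (hoJ h.1.1))))
      (hfin'.subset (by rw [hAK]; exact subset_insert _ _))] at hodd
    have hev : Even (({x ∈ o₀ | x ∈ M.fundCircuit f B} ∩ K).ncard) := by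
      have heq' : {x ∈ o₀ | x ∈ M.fundCircuit f B} = {x ∈ o₀ | x ∈ M.fundCircuit f' B} := heq
      rw [heq']
      by_cases hf'B : f' ∈ B
      · have hf'e : f' = e := by
          have : f' ∈ B ∩ b := ⟨hf'B, (hFS hf').2⟩
          rwa [hBb] at this
        subst hf'e
        rw [Matroid.fundCircuit_eq_of_mem hf'B]
        have : {x ∈ o₀ | x ∈ ({f'} : Set α)} = ∅ := by
          ext x; constructor
          · rintro ⟨hx, rfl⟩; exact heo₀ hx
          · rintro ⟨⟩
        rw [this]; simp
      · have hcf' := hB.fundCircuit_isCircuit (hS.subset_ground (hFS hf').1) hf'B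
        have : M.fundCircuit f' B ∩ K = {x ∈ o₀ | x ∈ M.fundCircuit f' B} ∩ K := by
          refine subset_antisymm (fun y hy => ?_) (fun y hy => ⟨hy.1.2, hy.2⟩)
          rcases hmeet f' hy with rfl | h
          · exact absurd (.inr (.inr hf')) (Set.disjoint_left.1 hKY hy.2)
          · exact h
        rw [← this]
        exact heven _ _ hcf' hK
    rw [Nat.even_add_one] at hodd
    exact hodd hev
  -- This set lies in the closure of `J`, so it can take the place of `J` next to `H \ J`.
  have hI' : M.Indep ((S \ b) ∪ I \ b) :=
    hI.subset (union_subset_union_right _ sdiff_subset)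
  have hIJ : (S \ b) ∪ I \ b ⊆ M.closure J := by
    refine subset_trans ?_ hJ.subset_closure
    rw [union_comm]
    exact union_subset_union_left _ (sdiff_subset_sdiff_left hIo)
  have hJL : M.Indep (J ∪ H \ J) := by rw [Set.union_sdiff_cancel hJH]; exact hH.indep
  obtain ⟨hind, hdis⟩ := indep_union_of_subset_closure hJL disjoint_sdiff_right hI' hIJ
  have hfinI : (I \ b).Finite := by
    refine finite_of_indep_of_spanning (Y := Y) ?_ ?_ hspan (hF.insert e)
    · convert! hind using 1
      rw [hY, union_assoc, union_assoc, union_comm (H \ J)]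
    · rw [hY, Set.disjoint_union_left]
      exact ⟨hd.mono_right sdiff_subset,
        (hdis.mono_left (subset_union_right.trans hIJ)).symm⟩
  refine (hfinI.union (htame o b ho hb)).subset fun y hy => ?_
  by_cases hyb : y ∈ b
  · exact .inr ⟨hIo hy, hyb⟩
  · exact .inl ⟨hy, hyb⟩

/-- Only finitely many fundamental cocircuits of elements of a given cocircuit meet a given
circuit. -/
theorem finite_fundCocircuit_inter_nonempty (htame : IsTame M) (heven : IsEvenMeeting M)
    {S o b : Set α} (hS : M.IsBase S) (ho : M.IsCircuit o) (hb : M.IsCocircuit b) :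
    {e ∈ S ∩ b | (M.fundCocircuit e S ∩ o).Nonempty}.Finite := by
  -- `K` exceeds `S \ b` by finitely many elements of `o`. Expressing these in terms of `S` uses a
  -- finite `F ⊆ S ∩ b`, so `(S \ b) ∪ F` already spans `o`, and no other element of `S ∩ b` occurs
  -- in a fundamental circuit of an element of `o` outside `S`.
  obtain ⟨K, hK, hSK⟩ := (hS.indep.subset (sdiff_subset (t := b))).subset_isBasis_of_subset
    (X := (S \ b) ∪ o) subset_union_left
    (union_subset (sdiff_subset.trans hS.subset_ground) ho.subset_ground)
  have hKeq : (S \ b) ∪ (K \ (S \ b)) = K := Set.union_sdiff_cancel hSK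
  have hKo : K \ (S \ b) ⊆ o := fun y hy => (hK.subset hy.1).resolve_left hy.2
  have hfin : (K \ (S \ b)).Finite := exists_finite_closure_of_indep htame heven hS ho hb
    (by rw [hKeq]; exact hK.indep) disjoint_sdiff_right hKo
  have hFfin : (⋃ f ∈ K \ (S \ b), M.fundCircuit f S ∩ (S ∩ b)).Finite := by
    refine hfin.biUnion fun f hf => ?_
    by_cases hfS : f ∈ S
    · rw [Matroid.fundCircuit_eq_of_mem hfS]
      exact (finite_singleton f).subset inter_subset_left
    · refine (htame _ _ (hS.fundCircuit_isCircuit (ho.subset_ground (hKo hf)) hfS) hb).subset ?_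
      exact inter_subset_inter_right _ inter_subset_right
  set F := ⋃ f ∈ K \ (S \ b), M.fundCircuit f S ∩ (S ∩ b) with hF
  have hFS : F ⊆ S := by
    refine iUnion₂_subset fun f _ => inter_subset_right.trans inter_subset_left
  have hcl : o ⊆ M.closure ((S \ b) ∪ F) := by
    have h1 : o ⊆ M.closure K := subset_union_right.trans hK.subset_closure
    refine h1.trans (Matroid.closure_subset_closure_of_subset_closure fun f hf => ?_)
    have hE : (S \ b) ∪ F ⊆ M.E :=
      union_subset (sdiff_subset.trans hS.subset_ground) (hFS.trans hS.subset_ground)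
    by_cases hfb : f ∈ S \ b
    · exact M.mem_closure_of_mem (.inl hfb)
    have hfK : f ∈ K \ (S \ b) := ⟨hf, hfb⟩
    have hsub : M.fundCircuit f S ∩ S ⊆ (S \ b) ∪ F := by
      rintro y ⟨hy, hyS⟩
      by_cases hyb : y ∈ b
      · exact .inr (mem_biUnion hfK ⟨hy, hyS, hyb⟩)
      · exact .inl ⟨hyS, hyb⟩
    by_cases hfS : f ∈ S
    · exact M.mem_closure_of_mem (hsub ⟨M.mem_fundCircuit _ _, hfS⟩)
    · have hc := hS.fundCircuit_isCircuit (ho.subset_ground (hKo hfK)) hfS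
      have := hc.mem_closure_sdiff_singleton_of_mem (M.mem_fundCircuit _ _)
      rw [M.fundCircuit_sdiff_eq_inter hfS] at this
      exact M.closure_subset_closure hsub this
  refine (hFfin.union (htame o b ho hb)).subset ?_
  rintro e ⟨⟨heS, heb⟩, f, hfK, hfo⟩
  by_cases hfS : f ∈ S
  · have := eq_of_mem_fundCocircuit_of_mem heS hfK hfS
    exact .inr ⟨this ▸ hfo, heb⟩
  · by_contra hcon
    have heF : e ∉ (S \ b) ∪ F := by
      rintro (h | h)
      · exact h.2 heb
      · exact hcon (.inl h)
    obtain ⟨C, hCs, hC, hfC⟩ := (Matroid.mem_closure_iff_exists_isCircuit (fun h =>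
      hfS ((union_subset sdiff_subset hFS) h))).1 (hcl hfo)
    have hCf := hC.eq_fundCircuit_of_subset hS.indep
      (hCs.trans (insert_subset_insert (union_subset sdiff_subset hFS)))
    rw [hS.mem_fundCocircuit_iff_mem_fundCircuit, ← hCf] at hfK
    rcases hCs hfK with rfl | h
    · exact hfS heS
    · exact heF h

/-- Two elements are linked if a chain of circuits leads from one to the other. -/
def Linked (M : Matroid α) : α → α → Prop :=
  Relation.EqvGen fun e f => ∃ o, M.IsCircuit o ∧ e ∈ o ∧ f ∈ o

/-- No circuit crosses a linkage class, so a basis of the class and one of its complement together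
form a base; this would be a 1-separation. -/
theorem linked_of_isConnectedMatroid (hconn : IsConnectedMatroid M) {e f : α} (he : e ∈ M.E)
    (hf : f ∈ M.E) : Linked M e f := by
  by_contra hef
  set A := {x ∈ M.E | Linked M e x} with hA
  have hAE : A ⊆ M.E := Set.sep_subset _ _
  obtain ⟨sA, hsA⟩ := M.exists_isBasis A
  obtain ⟨sB, hsB⟩ := M.exists_isBasis (M.E \ A)
  have hside : ∀ o, M.IsCircuit o → o ⊆ A ∨ o ⊆ M.E \ A := by
    intro o ho
    by_cases h : ∃ x ∈ o, x ∈ A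
    · obtain ⟨x, hxo, hxA⟩ := h
      left
      intro y hy
      exact ⟨ho.subset_ground hy, hxA.2.trans _ _ _ (.rel _ _ ⟨o, ho, hxo, hy⟩)⟩
    · push Not at h
      exact .inr fun y hy => ⟨ho.subset_ground hy, h y hy⟩
  have hind : M.Indep (sA ∪ sB) := by
    rw [Matroid.indep_iff_forall_subset_not_isCircuit
      (union_subset hsA.indep.subset_ground hsB.indep.subset_ground)]
    intro C hC hCc
    rcases hside C hCc with h | h
    · refine hCc.not_indep (hsA.indep.subset fun y hy => (hC hy).resolve_right fun h' => ?_)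
      exact (hsB.subset h').2 (h hy)
    · refine hCc.not_indep (hsB.indep.subset fun y hy => (hC hy).resolve_left fun h' => ?_)
      exact (h hy).2 (hsA.subset h')
  have hbase : M.IsBase (sA ∪ sB) := by
    refine hind.isBase_of_spanning ?_
    rw [Matroid.spanning_iff_ground_subset_closure hind.subset_ground]
    intro y hy
    by_cases hyA : y ∈ A
    · exact M.closure_subset_closure subset_union_left (hsA.subset_closure hyA)
    · exact M.closure_subset_closure subset_union_right (hsB.subset_closure ⟨hy, hyA⟩)
  refine hconn 1 (by norm_num) A (M.E \ A) ⟨Set.union_sdiff_cancel hAE, disjoint_sdiff_right, ?_, ?_,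
    sA, sB, _, hsA, hsB, hbase, ?_⟩
  · rw [Nat.cast_one, Set.one_le_encard_iff_nonempty]
    exact ⟨e, he, .refl _⟩
  · rw [Nat.cast_one, Set.one_le_encard_iff_nonempty]
    exact ⟨f, hf, fun h => hef h.2⟩
  · simp

end MatroidLemmas

/-! ### Adjacency in finite subsets of a cyclic order -/

section CyclicOrder

variable {α : Type u} {X s : Set α} {R : α → α → α → Prop}

open Set

theorem IsCyclicOrder.reverse (h : IsCyclicOrder X R) : IsCyclicOrder X fun a b c => R c b a where
  mem _ _ _ habc := let ⟨h1, h2, h3⟩ := h.mem _ _ _ habc; ⟨h3, h2, h1⟩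
  cyclic _ _ _ habc := h.cyclic _ _ _ (h.cyclic _ _ _ habc)
  asymm _ _ _ habc hcba := h.asymm _ _ _ habc hcba
  trans a b c d habc hacd := h.cyclic _ _ _ (h.trans a d c b
    (h.cyclic _ _ _ (h.cyclic _ _ _ hacd)) (h.cyclic _ _ _ (h.cyclic _ _ _ habc)))
  total _ ha _ hb _ hc hab hbc hac := (h.total _ ha _ hb _ hc hab hbc hac).symm

/-- Cutting the cyclic order at `p` leaves the strict order `R p`. -/
theorem IsCyclicOrder.exists_minimal (h : IsCyclicOrder X R) (p : α) {t : Set α} (ht : t.Finite)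
    (hne : t.Nonempty) : ∃ g ∈ t, ∀ k ∈ t, ¬ R p k g := by
  have : IsStrictOrder α (R p) :=
    { irrefl := fun a ha => h.asymm _ _ _ (h.cyclic _ _ _ ha) ha
      trans := fun a b c hab hbc => h.trans _ _ _ _ hab hbc }
  have hwf := ht.wellFoundedOn (r := R p)
  obtain ⟨x, hx⟩ := hne
  obtain ⟨m, -, hm⟩ := WellFounded.has_min hwf univ ⟨⟨x, hx⟩, trivial⟩
  exact ⟨m, m.2, fun k hk hkm => hm ⟨k, hk⟩ trivial hkm⟩

theorem IsCyclicOrder.exists_clockwiseAdj_right (h : IsCyclicOrder X R) (hs : s.Finite)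
    (hsX : s ⊆ X) {p : α} (hp : p ∈ s) (hnt : s.Nontrivial) : ∃ q, ClockwiseAdj R s p q := by
  obtain ⟨q, ⟨hq, hqp⟩, hmin⟩ := h.exists_minimal p (hs.subset (Set.sdiff_subset (t := {p})))
    (let ⟨k, hk, hkp⟩ := hnt.exists_ne p; ⟨k, hk, hkp⟩)
  refine ⟨q, hp, hq, fun h => hqp h.symm, fun g hg hgp hgq => ?_⟩
  rcases h.total p (hsX hp) q (hsX hq) g (hsX hg) (fun h => hqp h.symm) (Ne.symm hgq)
    (Ne.symm hgp) with h' | h'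
  · exact h'
  · exact absurd (h.cyclic _ _ _ (h.cyclic _ _ _ h')) (hmin g ⟨hg, hgp⟩)

theorem IsCyclicOrder.exists_clockwiseAdj_left (h : IsCyclicOrder X R) (hs : s.Finite)
    (hsX : s ⊆ X) {q : α} (hq : q ∈ s) (hnt : s.Nontrivial) : ∃ p, ClockwiseAdj R s p q := by
  obtain ⟨p, hp⟩ := h.reverse.exists_clockwiseAdj_right hs hsX hq hnt
  exact ⟨p, hp.2.1, hp.1, hp.2.2.1.symm, fun g hg hgp hgq =>
    h.cyclic _ _ _ (hp.2.2.2 g hg hgq hgp)⟩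

/-- Consider the first element after `e` outside `W`: its clockwise predecessor in `s` would be an
earlier one. -/
theorem IsCyclicOrder.subset_of_clockwiseAdj_closed (h : IsCyclicOrder X R) (hs : s.Finite)
    (hsX : s ⊆ X) {e : α} {W : Set α} (he : e ∈ s) (heW : e ∈ W)
    (hW : ∀ p q, ClockwiseAdj R s p q → p ∈ W → q ∈ W) : s ⊆ W := by
  by_contra hcon
  obtain ⟨f₀, hf₀⟩ := Set.not_subset.1 hcon
  obtain ⟨f, ⟨hf, hfW⟩, hmin⟩ := h.exists_minimal e (hs.subset (Set.sdiff_subset (t := W))) ⟨f₀, hf₀⟩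
  have hfe : f ≠ e := fun h => hfW (h ▸ heW)
  obtain ⟨g, hg⟩ := h.exists_clockwiseAdj_left hs hsX hf ⟨f, hf, e, he, hfe⟩
  have hgW : g ∉ W := fun hgW => hfW (hW g f hg hgW)
  have hge : g ≠ e := fun h => hgW (h ▸ heW)
  have h1 := hg.2.2.2 e he (Ne.symm hge) (Ne.symm hfe)
  have h2 := h.cyclic _ _ _ (h.cyclic _ _ _ h1)
  exact hmin g ⟨hg.1, hgW⟩ h2

end CyclicOrder

/-! ### Endvertices along circuits, and limits of endvertices -/

namespace GraphFramework

open Set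

variable {α : Type u} {M : Matroid α}

/-- The cocircuits of `M`. -/
abbrev Coc (M : Matroid α) : Type u := {b : Set α // M.IsCocircuit b}

open Classical in
/-- The endvertices of the edge `e`: `endAt 1 e` is `ι_e(1)` and `endAt (-1) e` is `ι_e(0)`. -/
noncomputable def endAt (Γ : GraphFramework M) (i : ℤˣ) (e : α) : Verts M := fun b =>
  if e ∈ b.1 then i * Γ.d b.1 e else Γ.σ b.1 e

variable (Γ : GraphFramework M)

theorem endAt_of_mem {b : Coc M} {e : α} (h : e ∈ b.1) (i : ℤˣ) :
    Γ.endAt i e b = i * Γ.d b.1 e := if_pos h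

theorem endAt_of_notMem {b : Coc M} {e : α} (h : e ∉ b.1) (i : ℤˣ) :
    Γ.endAt i e b = Γ.σ b.1 e := if_neg h

theorem endAt_neg_of_mem {b : Coc M} {e : α} (h : e ∈ b.1) (i : ℤˣ) :
    Γ.endAt (-i) e b = -Γ.endAt i e b := by
  rw [endAt_of_mem Γ h, endAt_of_mem Γ h, neg_mul]

theorem tgtVert_eq (e : M.E) : Γ.tgtVert e = Γ.endAt 1 e := by
  funext b; simp [tgtVert, endAt]

theorem srcVert_eq (e : M.E) : Γ.srcVert e = Γ.endAt (-1) e := by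
  funext b; simp [srcVert, endAt]

/-- Orthogonality of the signing, read modulo 2. -/
theorem isEvenMeeting (Γ : GraphFramework M) (htame : IsTame M) : IsEvenMeeting M := by
  intro o b ho hb
  have hfin := htame o b ho hb
  have h := Γ.sum_eq_zero o b ho hb
  rw [finsum_mem_eq_finite_toFinset_sum _ hfin] at h
  have h2 := congrArg (Int.cast : ℤ → ZMod 2) h
  have hu : ∀ u : ℤˣ, ((u : ℤ) : ZMod 2) = 1 := by
    intro u; rcases Int.units_eq_one_or u with rfl | rfl <;> decide
  simp only [Int.cast_sum, Int.cast_mul, hu, mul_one, Finset.sum_const, Int.cast_zero,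
    nsmul_eq_mul] at h2
  rw [Set.ncard_eq_toFinset_card _ hfin, ← ZMod.natCast_eq_zero_iff_even]
  exact h2

/-- The four adjacency axioms in one formula. When `o` is traversed clockwise, `c o` tells in which
direction each edge is run through, and the vertex where `p` is left agrees at `b` with the vertex
where `q` is entered. -/
theorem endAt_eq_of_clockwiseAdj {o s : Set α} (ho : M.IsCircuit o) (b : Coc M) (hs : s.Finite)
    (hbs : b.1 ∩ o ⊆ s) (hso : s ⊆ o) {p q : α}
    (hpq : ClockwiseAdj (Γ.toSigning.cyc Γ.σ o) s p q) :
    Γ.endAt (Γ.c o p) p b = Γ.endAt (-(Γ.c o q)) q b := by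
  by_cases hp : p ∈ b.1 <;> by_cases hq : q ∈ b.1
  · rw [endAt_of_mem Γ hp, endAt_of_mem Γ hq,
      Γ.adj_mem_mem o b.1 s ho b.2 hs hbs hso p q hpq hp hq, neg_mul]
  · rw [endAt_of_mem Γ hp, endAt_of_notMem Γ hq,
      Γ.adj_mem_notMem o b.1 s ho b.2 hs hbs hso p q hpq hp hq]
  · rw [endAt_of_notMem Γ hp, endAt_of_mem Γ hq, neg_mul,
      Γ.adj_notMem_mem o b.1 s ho b.2 hs hbs hso p q hpq hp hq, neg_neg]
  · rw [endAt_of_notMem Γ hp, endAt_of_notMem Γ hq,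
      Γ.adj_notMem_notMem o b.1 s ho b.2 hs hbs hso p q hpq hp hq]

theorem finite_inter_biUnion (htame : IsTame M) {o : Set α} (ho : M.IsCircuit o)
    {𝓑 : Set (Coc M)} (h𝓑 : 𝓑.Finite) : (o ∩ ⋃ b ∈ 𝓑, b.1).Finite := by
  rw [Set.inter_iUnion₂]
  exact h𝓑.biUnion fun b _ => htame o b.1 ho b.2

theorem endAt_congr_of_forall_notMem {e : α} {i j : ℤˣ} {b : Coc M} (h : e ∉ b.1) :
    Γ.endAt i e b = Γ.endAt j e b := by
  rw [endAt_of_notMem Γ h, endAt_of_notMem Γ h]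

/-- Every endvertex on a circuit agrees, up to finitely many cocircuits, with an endvertex of
another edge of that circuit among a prescribed finite set. -/
theorem exists_neighbour {o s : Set α} (ho : M.IsCircuit o) {𝓑 : Set (Coc M)} (hs : s.Finite)
    (hbs : ∀ b ∈ 𝓑, b.1 ∩ o ⊆ s) (hso : s ⊆ o) (hnt : s.Nontrivial) {p : α} (hp : p ∈ s)
    (i : ℤˣ) : ∃ q ∈ s, q ≠ p ∧ ∃ j, ∀ b ∈ 𝓑, Γ.endAt j q b = Γ.endAt i p b := by
  have hcyc := Γ.isCyclicOrder o ho
  rcases units_eq_or i (Γ.c o p) with rfl | rfl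
  · obtain ⟨q, hq⟩ := hcyc.exists_clockwiseAdj_right hs hso hp hnt
    exact ⟨q, hq.2.1, hq.2.2.1.symm, _, fun b hb =>
      (Γ.endAt_eq_of_clockwiseAdj ho b hs (hbs b hb) hso hq).symm⟩
  · obtain ⟨q, hq⟩ := hcyc.exists_clockwiseAdj_left hs hso hp hnt
    exact ⟨q, hq.1, hq.2.2.1, _, fun b hb =>
      Γ.endAt_eq_of_clockwiseAdj ho b hs (hbs b hb) hso hq⟩

/-- A set of vertices determined by finitely many cocircuits, and not separating the endvertices
of any edge of the circuit `o` other than `e`, contains all or none of the endvertices on `o`. -/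
theorem endAt_mem_iff_of_isCircuit (htame : IsTame M) {o : Set α} (ho : M.IsCircuit o) {e : α}
    (he : e ∈ o) {𝓑 : Set (Coc M)} (h𝓑 : 𝓑.Finite) {T : Set (Verts M)}
    (hag : ∀ v w : Verts M, (∀ b ∈ 𝓑, v b = w b) → v ∈ T → w ∈ T)
    (hT : ∀ f ∈ o, f ≠ e → (Γ.endAt 1 f ∈ T ↔ Γ.endAt (-1) f ∈ T)) {f : α} (hf : f ∈ o)
    (i : ℤˣ) : Γ.endAt i f ∈ T ↔ Γ.endAt (Γ.c o e) e ∈ T := by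
  have hag' : ∀ v w : Verts M, (∀ b ∈ 𝓑, v b = w b) → (v ∈ T ↔ w ∈ T) := fun v w h =>
    ⟨hag v w h, hag w v fun b hb => (h b hb).symm⟩
  have hT' : ∀ f ∈ o, f ≠ e → ∀ i, (Γ.endAt (-i) f ∈ T ↔ Γ.endAt i f ∈ T) := by
    intro f hf hfe i
    rcases Int.units_eq_one_or i with rfl | rfl
    · exact (hT f hf hfe).symm
    · rw [neg_neg]; exact hT f hf hfe
  -- A one-element circuit has no adjacent pairs; but its element lies in no cocircuit, so its two
  -- ends coincide.
  by_cases hsub : o.Subsingleton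
  · have hoe := hsub.eq_singleton_of_mem he
    have hfe : f = e := hsub hf he
    subst hfe
    refine hag' _ _ fun b _ => Γ.endAt_congr_of_forall_notMem fun h => ?_
    refine ho.inter_isCocircuit_ne_singleton b.2 (e := f) ?_
    rw [hoe]; simpa using h
  rw [Set.not_subsingleton_iff] at hsub
  obtain ⟨k, hk, hke⟩ := hsub.exists_ne e
  -- Adding `e`, `f`, `k` puts both edges of interest into `s` and makes it nontrivial even if no
  -- cocircuit of `𝓑` meets `o`.
  set s := (o ∩ ⋃ b ∈ 𝓑, b.1) ∪ {e, f, k} with hs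
  have hsfin : s.Finite := (finite_inter_biUnion htame ho h𝓑).union (by simp)
  have hso : s ⊆ o := union_subset inter_subset_left (by
    rintro x (rfl | rfl | rfl) <;> assumption)
  have hes : e ∈ s := .inr (by simp)
  have hfs : f ∈ s := .inr (by simp)
  have hks : k ∈ s := .inr (by simp)
  have hbs : ∀ b ∈ 𝓑, b.1 ∩ o ⊆ s := fun b hb x hx =>
    .inl ⟨hx.2, mem_biUnion hb hx.1⟩
  have hcyc := Γ.isCyclicOrder o ho
  have hadj : ∀ p q, ClockwiseAdj (Γ.toSigning.cyc Γ.σ o) s p q →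
      (Γ.endAt (Γ.c o p) p ∈ T ↔ Γ.endAt (-(Γ.c o q)) q ∈ T) := fun p q hpq =>
    hag' _ _ fun b hb => Γ.endAt_eq_of_clockwiseAdj ho b hsfin (hbs b hb) hso hpq
  have hall : s ⊆ {q | Γ.endAt (Γ.c o q) q ∈ T ↔ Γ.endAt (Γ.c o e) e ∈ T} := by
    refine hcyc.subset_of_clockwiseAdj_closed hsfin hso hes Iff.rfl fun p q hpq hp => ?_
    by_cases hqe : q = e
    · subst hqe; exact Iff.rfl
    · exact (hT' q (hso hpq.2.1) hqe _).symm.trans ((hadj p q hpq).symm.trans hp)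
  rcases units_eq_or i (Γ.c o f) with rfl | rfl
  · exact hall hfs
  · obtain ⟨p, hp⟩ := hcyc.exists_clockwiseAdj_left hsfin hso hfs ⟨e, hes, k, hks, hke.symm⟩
    exact (hadj p f hp).symm.trans (hall hp.1)

theorem σ_eq_of_isCircuit (htame : IsTame M) {o : Set α} (ho : M.IsCircuit o) {b : Coc M}
    (hob : Disjoint o b.1) {e f : α} (he : e ∈ o) (hf : f ∈ o) : Γ.σ b.1 e = Γ.σ b.1 f := by
  have h := Γ.endAt_mem_iff_of_isCircuit htame ho he (finite_singleton b)
    (T := {v | v b = Γ.σ b.1 e}) (fun v w h hv => (h b rfl).symm.trans hv)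
    (fun g hg _ => by
      simp only [mem_ofPred_eq]
      rw [Γ.endAt_congr_of_forall_notMem (Set.disjoint_left.1 hob hg)]) hf 1
  simp only [mem_ofPred_eq, endAt_of_notMem Γ (Set.disjoint_left.1 hob hf),
    endAt_of_notMem Γ (Set.disjoint_left.1 hob he), iff_true] at h
  exact h.symm

/-- A set of vertices determined by finitely many cocircuits, and not separating the endvertices
of any edge, contains all or none of the endvertices of linked edges. -/
theorem endAt_mem_iff_of_linked (htame : IsTame M) {𝓑 : Set (Coc M)} (h𝓑 : 𝓑.Finite)
    {T : Set (Verts M)} (hag : ∀ v w : Verts M, (∀ b ∈ 𝓑, v b = w b) → v ∈ T → w ∈ T)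
    (hT : ∀ f, (Γ.endAt 1 f ∈ T ↔ Γ.endAt (-1) f ∈ T)) {e f : α} (hef : Linked M e f) (i j : ℤˣ) :
    Γ.endAt i e ∈ T ↔ Γ.endAt j f ∈ T := by
  have hT' : ∀ e i j, Γ.endAt i e ∈ T ↔ Γ.endAt j e ∈ T := by
    intro e i j
    rcases Int.units_eq_one_or i with rfl | rfl <;> rcases Int.units_eq_one_or j with rfl | rfl
    · rfl
    · exact hT e
    · exact (hT e).symm
    · rfl
  induction hef generalizing i j with
  | rel e f h =>
    obtain ⟨o, ho, he, hf⟩ := h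
    rw [Γ.endAt_mem_iff_of_isCircuit htame ho he h𝓑 hag (fun f _ _ => hT f) hf j]
    exact hT' _ _ _
  | refl e => exact hT' _ _ _
  | symm e f _ ih => exact (ih _ _).symm
  | trans e f g _ _ ih1 ih2 => exact (ih1 i 1).trans (ih2 1 j)

/-- The vertices in the closure of the set of endvertices of the edges in `D`. -/
def limVerts (D : Set α) : Set (Verts M) :=
  {v | ∀ 𝓑 : Set (Coc M), 𝓑.Finite → ∃ e ∈ D, ∃ i, ∀ b ∈ 𝓑, Γ.endAt i e b = v b}

theorem endAt_mem_limVerts {D : Set α} {e : α} (he : e ∈ D) (i : ℤˣ) : Γ.endAt i e ∈ Γ.limVerts D :=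
  fun _ _ => ⟨e, he, i, fun _ _ => rfl⟩

theorem limVerts_mono {D D' : Set α} (h : D ⊆ D') : Γ.limVerts D ⊆ Γ.limVerts D' := by
  intro v hv 𝓑 h𝓑
  obtain ⟨e, he, i, hi⟩ := hv 𝓑 h𝓑
  exact ⟨e, h he, i, hi⟩

theorem limVerts_union (D D' : Set α) : Γ.limVerts (D ∪ D') = Γ.limVerts D ∪ Γ.limVerts D' := by
  refine subset_antisymm (fun v hv => ?_)
    (union_subset (Γ.limVerts_mono subset_union_left) (Γ.limVerts_mono subset_union_right))
  by_contra hcon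
  rw [Set.mem_union, not_or] at hcon
  obtain ⟨h1, h2⟩ := hcon
  simp only [limVerts, mem_ofPred_eq, not_forall] at h1 h2
  obtain ⟨𝓑₁, h𝓑₁, h1⟩ := h1
  obtain ⟨𝓑₂, h𝓑₂, h2⟩ := h2
  obtain ⟨e, he, i, hi⟩ := hv _ (h𝓑₁.union h𝓑₂)
  rcases he with he | he
  · exact h1 ⟨e, he, i, fun b hb => hi b (.inl hb)⟩
  · exact h2 ⟨e, he, i, fun b hb => hi b (.inr hb)⟩

theorem eq_of_mem_limVerts_of_disjoint (htame : IsTame M) {o : Set α} (ho : M.IsCircuit o)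
    {b : Coc M} (hob : Disjoint o b.1) {v : Verts M} (hv : v ∈ Γ.limVerts o) {e : α} (he : e ∈ o) :
    v b = Γ.σ b.1 e := by
  obtain ⟨f, hf, i, hi⟩ := hv {b} (finite_singleton b)
  rw [← hi b rfl, endAt_of_notMem Γ (Set.disjoint_left.1 hob hf)]
  exact Γ.σ_eq_of_isCircuit htame ho hob hf he

end GraphFramework

/-! ### Signs -/

section Signs

open Set

theorem units_eq_of_ne_of_ne {a b c : ℤˣ} (hab : a ≠ b) (hbc : b ≠ c) : a = c := by
  rcases Int.units_eq_one_or a with rfl | rfl <;> rcases Int.units_eq_one_or b with rfl | rfl <;>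
    rcases Int.units_eq_one_or c with rfl | rfl <;> simp_all

theorem units_eq_neg_iff_ne {a b : ℤˣ} : a = -b ↔ a ≠ b := by
  rcases Int.units_eq_one_or a with rfl | rfl <;> rcases Int.units_eq_one_or b with rfl | rfl <;>
    decide

theorem finprod_mem_units_eq_neg_one_pow {ι : Type*} {A : Set ι} {f : ι → ℤˣ}
    (hA : (A ∩ Function.mulSupport f).Finite) :
    ∏ᶠ i ∈ A, f i = (-1) ^ (A ∩ Function.mulSupport f).ncard := by
  rw [← finprod_mem_inter_mulSupport, finprod_mem_eq_finite_toFinset_prod _ hA,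
    Set.ncard_eq_toFinset_card _ hA, ← Finset.prod_const]
  refine Finset.prod_congr rfl fun i hi => ?_
  exact (Int.units_eq_one_or _).resolve_left (hA.mem_toFinset.1 hi).2

end Signs

/-! ### The product formula over a base, and crossing of fundamental cocircuits -/

namespace GraphFramework

open Set

variable {α : Type u} {M : Matroid α} {S : Set α}

/-- The fundamental cocircuit of an element of a base. -/
def coc (hS : M.IsBase S) (e : S) : Coc M :=
  ⟨M.fundCocircuit e S, Matroid.fundCocircuit_isCocircuit e.2 hS⟩

theorem mem_coc_self (hS : M.IsBase S) (e : S) : e.1 ∈ (coc hS e).1 :=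
  M.mem_fundCocircuit _ _

theorem eq_of_mem_coc (hS : M.IsBase S) {e f : S} (h : f.1 ∈ (coc hS e).1) : f = e :=
  Subtype.ext (eq_of_mem_fundCocircuit_of_mem e.2 h f.2)

theorem mem_coc_iff_mem_fundCircuit (hS : M.IsBase S) {e : S} {f : α} :
    f ∈ (coc hS e).1 ↔ e.1 ∈ M.fundCircuit f S :=
  hS.mem_fundCocircuit_iff_mem_fundCircuit

/-- The difference between the vertices `v` and `w` at the cocircuit `b` is determined by their
differences at the fundamental cocircuits of the elements of `b` with respect to the base `S`. -/
structure Nice (hS : M.IsBase S) (b : Coc M) (v w : Verts M) : Prop where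
  finite : ({e : S | e.1 ∈ b.1} ∩
    Function.mulSupport fun e => v (coc hS e) * w (coc hS e)).Finite
  eq : v b * w b = ∏ᶠ e ∈ {e : S | e.1 ∈ b.1}, v (coc hS e) * w (coc hS e)

variable {hS : M.IsBase S} {b : Coc M} {v w x z : Verts M}

theorem Nice.symm (h : Nice hS b v w) : Nice hS b w v := by
  refine ⟨?_, ?_⟩
  · simp_rw [mul_comm (w _)]; exact h.finite
  · simp_rw [mul_comm (w _)]; exact h.eq

/-- The finiteness field is needed here: `finprod` takes the default value 1 on infinite support and
is multiplicative only when both supports are finite. -/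
theorem Nice.trans (h : Nice hS b v w) (h' : Nice hS b w x) : Nice hS b v x := by
  have heq : ∀ c : Coc M, v c * x c = (v c * w c) * (w c * x c) := fun c => by
    rw [mul_assoc, ← mul_assoc (w c), Int.units_mul_self, one_mul]
  refine ⟨(h.finite.union h'.finite).subset ?_, ?_⟩
  · rintro e ⟨he, hne⟩
    simp only [Function.mem_mulSupport, heq] at hne
    by_contra hcon
    simp only [Set.mem_union, Set.mem_inter_iff, he, true_and, Function.mem_mulSupport, not_or,
      not_not] at hcon
    exact hne (by rw [hcon.1, hcon.2, one_mul])
  · rw [heq, h.eq, h'.eq, ← finprod_mem_mul_distrib' h.finite h'.finite]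
    simp_rw [heq]

theorem Nice.of_finite {F : Set S} (hF : F.Finite) (hFb : ∀ e ∈ F, e.1 ∈ b.1)
    (hout : ∀ e : S, e.1 ∈ b.1 → e ∉ F → v (coc hS e) = w (coc hS e))
    (heq : v b * w b = ∏ᶠ e ∈ F, v (coc hS e) * w (coc hS e)) : Nice hS b v w := by
  have hsub : {e : S | e.1 ∈ b.1} ∩ Function.mulSupport (fun e => v (coc hS e) * w (coc hS e)) =
      F ∩ Function.mulSupport (fun e => v (coc hS e) * w (coc hS e)) := by
    ext e
    refine ⟨fun ⟨h1, h2⟩ => ⟨by_contra fun h3 => h2 ?_, h2⟩, fun ⟨h1, h2⟩ => ⟨hFb e h1, h2⟩⟩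
    simp only [hout e h1 h3, Int.units_mul_self]
  exact ⟨hsub ▸ hF.inter_of_left _, heq.trans (finprod_mem_inter_mulSupport_eq _ _ _ hsub.symm)⟩

theorem Nice.eq_of_finite (h : Nice hS b v w) {F : Set S} (hFb : ∀ e ∈ F, e.1 ∈ b.1)
    (hout : ∀ e : S, e.1 ∈ b.1 → e ∉ F → v (coc hS e) = w (coc hS e)) :
    v b * w b = ∏ᶠ e ∈ F, v (coc hS e) * w (coc hS e) := by
  rw [h.eq]
  refine finprod_mem_inter_mulSupport_eq _ _ _ ?_
  ext e
  refine ⟨fun ⟨h1, h2⟩ => ⟨by_contra fun h3 => h2 ?_, h2⟩, fun ⟨h1, h2⟩ => ⟨hFb e h1, h2⟩⟩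
  simp only [hout e h1 h3, Int.units_mul_self]

theorem Nice.eq_of_forall (h : Nice hS b v w)
    (heq : ∀ e : S, e.1 ∈ b.1 → v (coc hS e) = w (coc hS e)) : v b = w b := by
  have := h.eq_of_finite (F := ∅) (by simp) (fun e he _ => heq e he)
  rw [finprod_mem_empty] at this
  rw [← mul_left_inj (w b), this, Int.units_mul_self]

variable (Γ : GraphFramework M)

theorem endAt_mul_endAt_neg (i : ℤˣ) (e : α) (b : Coc M) [Decidable (e ∈ b.1)] :
    Γ.endAt i e b * Γ.endAt (-i) e b = if e ∈ b.1 then -1 else 1 := by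
  split_ifs with h
  · rw [endAt_neg_of_mem Γ h, mul_neg, Int.units_mul_self]
  · rw [Γ.endAt_congr_of_forall_notMem h, Int.units_mul_self]

open Classical in
-- The two ends of `f` differ exactly at the cocircuits containing `f`. For `f ∈ S` only one
-- fundamental cocircuit does. For `f ∉ S` the sign changes are counted by the fundamental circuit
-- of `f` intersected with `b`, without `f`, and that intersection is even.
theorem nice_endAt (htame : IsTame M) {f : α} (hf : f ∈ M.E) (i j : ℤˣ) :
    Nice hS b (Γ.endAt i f) (Γ.endAt j f) := by
  rcases units_eq_or j i with rfl | rfl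
  · exact Nice.of_finite finite_empty (by simp) (by simp) (by simp [Int.units_mul_self])
  have hset : {e : S | e.1 ∈ b.1} ∩ Function.mulSupport
      (fun e => Γ.endAt i f (coc hS e) * Γ.endAt (-i) f (coc hS e)) =
      {e : S | e.1 ∈ b.1 ∧ f ∈ (coc hS e).1} := by
    ext e
    simp only [mem_inter_iff, mem_ofPred_eq, Function.mem_mulSupport, endAt_mul_endAt_neg]
    split_ifs with h <;> simp [h]
  by_cases hfS : f ∈ S
  · have hset' : {e : S | e.1 ∈ b.1 ∧ f ∈ (coc hS e).1} = {e : S | e = ⟨f, hfS⟩ ∧ f ∈ b.1} := by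
      ext e
      simp only [mem_ofPred_eq]
      constructor
      · rintro ⟨h1, h2⟩
        have := eq_of_mem_coc hS (f := ⟨f, hfS⟩) h2
        subst this
        exact ⟨rfl, h1⟩
      · rintro ⟨rfl, h1⟩
        exact ⟨h1, mem_coc_self hS _⟩
    rw [hset'] at hset
    have hfin : {e : S | e = ⟨f, hfS⟩ ∧ f ∈ b.1}.Finite :=
      (finite_singleton (⟨f, hfS⟩ : S)).subset fun e he => he.1
    refine ⟨hset ▸ hfin, ?_⟩
    rw [finprod_mem_units_eq_neg_one_pow (hset ▸ hfin), hset, endAt_mul_endAt_neg]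
    split_ifs with h
    · simp [h]
    · simp [h]
  · have hC := hS.fundCircuit_isCircuit hf hfS
    have hfin := htame _ _ hC b.2
    have heven := Γ.isEvenMeeting htame _ _ hC b.2
    have himg : Subtype.val '' {e : S | e.1 ∈ b.1 ∧ f ∈ (coc hS e).1} =
        (M.fundCircuit f S ∩ b.1) \ {f} := by
      ext e
      constructor
      · rintro ⟨e, ⟨h1, h2⟩, rfl⟩
        exact ⟨⟨(mem_coc_iff_mem_fundCircuit hS).1 h2, h1⟩, fun h3 => hfS (by rw [← h3]; exact e.2)⟩
      · rintro ⟨⟨h1, h2⟩, h3⟩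
        have heS := (M.fundCircuit_subset_insert f S h1).resolve_left h3
        exact ⟨⟨e, heS⟩, ⟨h2, (mem_coc_iff_mem_fundCircuit hS).2 h1⟩, rfl⟩
    have hfin' : {e : S | e.1 ∈ b.1 ∧ f ∈ (coc hS e).1}.Finite :=
      Set.Finite.of_finite_image (himg ▸ hfin.sdiff) Subtype.val_injective.injOn
    refine ⟨hset ▸ hfin', ?_⟩
    rw [finprod_mem_units_eq_neg_one_pow (hset ▸ hfin'), hset, endAt_mul_endAt_neg,
      ← Set.ncard_image_of_injective _ Subtype.val_injective, himg]
    split_ifs with h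
    · have := Set.ncard_sdiff_singleton_add_one (a := f) (s := M.fundCircuit f S ∩ b.1)
        ⟨M.mem_fundCircuit f S, h⟩ hfin
      rw [← this] at heven
      have hodd : Odd ((M.fundCircuit f S ∩ b.1) \ {f}).ncard := by
        by_contra hcon
        rw [Nat.not_odd_iff_even] at hcon
        exact (Nat.even_add_one.1 heven) hcon
      rw [hodd.neg_one_pow]
    · rw [sdiff_singleton_eq_self fun h' => h h'.2, heven.neg_one_pow]

/-- All but finitely many of the fundamental cocircuits concerned miss `o`, and at those every
vertex in the closure of `o` has the same value. What is left of the formula depends on finitely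
many cocircuits, survives the crossing of an edge of `o`, and so holds at all ends on `o` and at
their limits. -/
theorem nice_of_mem_limVerts (htame : IsTame M) {o : Set α} (ho : M.IsCircuit o) {p : α}
    (hp : p ∈ o) (i : ℤˣ) (hv : v ∈ Γ.limVerts o) : Nice hS b v (Γ.endAt i p) := by
  set u := Γ.endAt i p with hu
  set F : Set S := {e | e.1 ∈ b.1 ∧ ((coc hS e).1 ∩ o).Nonempty} with hF
  have hFfin : F.Finite := by
    refine Set.Finite.of_finite_image (f := Subtype.val) ?_ Subtype.val_injective.injOn
    refine (finite_fundCocircuit_inter_nonempty htame (Γ.isEvenMeeting htame) hS ho b.2).subset ?_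
    rintro _ ⟨e, he, rfl⟩
    exact ⟨⟨e.2, he.1⟩, he.2⟩
  have hFb : ∀ e ∈ F, e.1 ∈ b.1 := fun e he => he.1
  have hdis : ∀ e : S, e.1 ∈ b.1 → e ∉ F → Disjoint o (coc hS e).1 := by
    intro e he heF
    rw [Set.disjoint_iff_inter_eq_empty, inter_comm]
    by_contra hcon
    exact heF ⟨he, Set.nonempty_iff_ne_empty.2 hcon⟩
  have h𝓑 : (insert b (coc hS '' F)).Finite := (hFfin.image _).insert _
  set T : Set (Verts M) := {w | w b * u b = ∏ᶠ e ∈ F, w (coc hS e) * u (coc hS e)} with hT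
  have hag : ∀ w w' : Verts M, (∀ c ∈ insert b (coc hS '' F), w c = w' c) → w ∈ T → w' ∈ T := by
    intro w w' h hw
    simp only [hT, mem_ofPred_eq] at hw ⊢
    rw [← h b (.inl rfl), hw]
    exact finprod_mem_congr rfl fun e he => by rw [h _ (.inr ⟨e, he, rfl⟩)]
  have hstep : ∀ f ∈ o, ∀ i j, Γ.endAt i f ∈ T → Γ.endAt j f ∈ T := by
    intro f hf i j hw
    have h1 := (nice_endAt (hS := hS) (b := b) Γ htame (ho.subset_ground hf) j i).eq_of_finite hFb
      fun e he heF => Γ.endAt_congr_of_forall_notMem (Set.disjoint_left.1 (hdis e he heF) hf)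
    simp only [hT, mem_ofPred_eq] at hw ⊢
    have heq : ∀ c : Coc M, Γ.endAt j f c * u c =
        (Γ.endAt j f c * Γ.endAt i f c) * (Γ.endAt i f c * u c) := fun c => by
      rw [mul_assoc, ← mul_assoc (Γ.endAt i f c), Int.units_mul_self, one_mul]
    rw [heq, h1, hw, ← finprod_mem_mul_distrib hFfin]
    exact finprod_mem_congr rfl fun e _ => (heq _).symm
  have huT : u ∈ T := by
    simp only [hT, mem_ofPred_eq, Int.units_mul_self]
    exact (finprod_mem_eq_one_of_forall_eq_one fun _ _ => rfl).symm
  have hall : ∀ f ∈ o, ∀ j, Γ.endAt j f ∈ T := fun f hf j =>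
    (Γ.endAt_mem_iff_of_isCircuit htame ho hp h𝓑 hag
      (fun f hf _ => ⟨hstep f hf _ _, hstep f hf _ _⟩) hf j).2 (hstep p hp _ _ huT)
  obtain ⟨f, hf, j, hj⟩ := hv _ h𝓑
  refine Nice.of_finite hFfin hFb (fun e he heF => ?_) (hag _ _ hj (hall f hf j))
  rw [Γ.eq_of_mem_limVerts_of_disjoint htame ho (hdis e he heF) hv hp, hu,
    endAt_of_notMem Γ (Set.disjoint_left.1 (hdis e he heF) hp)]

theorem nice_of_linked (htame : IsTame M) {e f : α} (he : e ∈ M.E)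
    (hef : Linked M e f) (i j : ℤˣ) : Nice hS b (Γ.endAt i e) (Γ.endAt j f) := by
  have hor : (e ∈ M.E ↔ f ∈ M.E) ∧ (e ∈ M.E → ∀ i j,
      Nice hS b (Γ.endAt i e) (Γ.endAt j f)) := by
    clear he
    induction hef with
    | rel e f h =>
      obtain ⟨o, ho, he, hf⟩ := h
      exact ⟨iff_of_true (ho.subset_ground he) (ho.subset_ground hf), fun _ i j =>
        Γ.nice_of_mem_limVerts htame ho hf j (Γ.endAt_mem_limVerts he i)⟩
    | refl e => exact ⟨Iff.rfl, fun he i j => Γ.nice_endAt htame he i j⟩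
    | symm e f _ ih => exact ⟨ih.1.symm, fun hf i j => (ih.2 (ih.1.2 hf) j i).symm⟩
    | trans e f g _ _ ih1 ih2 =>
      exact ⟨ih1.1.trans ih2.1, fun he i j => (ih1.2 he i 1).trans (ih2.2 (ih1.1.1 he) 1 j)⟩
  exact hor.2 he i j

/-- The vertices lying on an edge or in the closure of a circuit. -/
def Good (v : Verts M) : Prop :=
  (∃ e ∈ M.E, ∃ i, v = Γ.endAt i e) ∨ ∃ o, M.IsCircuit o ∧ v ∈ Γ.limVerts o

variable {Γ}

theorem Good.mem_limVerts (h : Γ.Good v) : v ∈ Γ.limVerts M.E := by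
  rcases h with ⟨e, he, i, rfl⟩ | ⟨o, ho, hv⟩
  · exact Γ.endAt_mem_limVerts he i
  · exact Γ.limVerts_mono ho.subset_ground hv

theorem Good.nice (hconn : IsConnectedMatroid M) (htame : IsTame M) (hv : Γ.Good v)
    (hw : Γ.Good w) : Nice hS b v w := by
  have key : ∀ v, Γ.Good v → ∃ e ∈ M.E, Nice hS b v (Γ.endAt 1 e) := by
    rintro v (⟨e, he, i, rfl⟩ | ⟨o, ho, hv⟩)
    · exact ⟨e, he, Γ.nice_endAt htame he i 1⟩
    · obtain ⟨e, he⟩ := ho.nonempty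
      exact ⟨e, ho.subset_ground he, Γ.nice_of_mem_limVerts htame ho he 1 hv⟩
  obtain ⟨e, he, hve⟩ := key v hv
  obtain ⟨f, hf, hwf⟩ := key w hw
  exact (hve.trans (Γ.nice_of_linked htame he (linked_of_isConnectedMatroid hconn he hf) 1 1)).trans
    hwf.symm

variable (Γ)

/-- If `f ∉ S`, its fundamental circuit contains both `e` and `f` and avoids the cocircuit of `p`.
-/
theorem σ_coc_eq_of_mem_coc (htame : IsTame M) {e p : S} {f : α} (hfe : f ∈ (coc hS e).1)
    (hfp : f ∉ (coc hS p).1) : Γ.σ (coc hS p).1 f = Γ.σ (coc hS p).1 e := by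
  by_cases hfS : f ∈ S
  · have := eq_of_mem_coc hS (f := ⟨f, hfS⟩) hfe
    subst this; rfl
  have hC := hS.fundCircuit_isCircuit ((coc hS e).2.subset_ground hfe) hfS
  refine Γ.σ_eq_of_isCircuit htame hC ?_ (M.mem_fundCircuit f S)
    ((mem_coc_iff_mem_fundCircuit hS).1 hfe)
  rw [Set.disjoint_left]
  intro g hg hgp
  rcases M.fundCircuit_subset_insert f S hg with rfl | hgS
  · exact hfp hgp
  · have := eq_of_mem_coc hS (f := ⟨g, hgS⟩) hgp
    subst this
    exact hfp ((mem_coc_iff_mem_fundCircuit hS).2 hg)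

/-- In the fundamental circuit of `f` both cocircuits are supported on the three elements `p`, `f`,
`e`, in this clockwise order. So `f` ends where `e` lies as seen from the cocircuit of `p`, and
starts where `p` lies as seen from that of `e`. -/
theorem endAt_coc_of_cyc {e p : S} (hep : e ≠ p) {f : α} (hfe : f ∈ (coc hS e).1)
    (hfp : f ∈ (coc hS p).1)
    (hR : Γ.toSigning.cyc Γ.σ (M.fundCircuit f S) p f e) :
    ∃ j, Γ.endAt j f (coc hS p) = Γ.σ (coc hS p).1 e ∧
      Γ.endAt (-j) f (coc hS e) = Γ.σ (coc hS e).1 p := by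
  have hep' : e.1 ∉ (coc hS p).1 := fun h => hep (eq_of_mem_coc hS h)
  have hpe' : p.1 ∉ (coc hS e).1 := fun h => hep (eq_of_mem_coc hS h).symm
  have hfS : f ∉ S := by
    intro hfS
    have h1 := eq_of_mem_coc hS (f := ⟨f, hfS⟩) hfe
    have h2 := eq_of_mem_coc hS (f := ⟨f, hfS⟩) hfp
    exact hep (h1.symm.trans h2)
  have hC := hS.fundCircuit_isCircuit ((coc hS e).2.subset_ground hfe) hfS
  have hcyc := Γ.isCyclicOrder _ hC
  have hpf : p.1 ≠ f := fun h => hfS (h ▸ p.2)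
  have hfe' : f ≠ e.1 := fun h => hfS (h ▸ e.2)
  set s : Set α := {e.1, f, p.1} with hs
  have hsC : s ⊆ M.fundCircuit f S := by
    rintro g (rfl | rfl | rfl)
    · exact (mem_coc_iff_mem_fundCircuit hS).1 hfe
    · exact M.mem_fundCircuit _ S
    · exact (mem_coc_iff_mem_fundCircuit hS).1 hfp
  have hsfin : s.Finite := by simp [hs]
  have hsub : ∀ q : S, q = e ∨ q = p → (coc hS q).1 ∩ M.fundCircuit f S ⊆ s := by
    rintro q hq g ⟨hg1, hg2⟩
    rcases M.fundCircuit_subset_insert f S hg2 with rfl | hgS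
    · simp [hs]
    · have := eq_of_mem_coc hS (f := ⟨g, hgS⟩) hg1
      rcases hq with rfl | rfl <;> simp [hs, ← this]
  have h1 : ClockwiseAdj (Γ.toSigning.cyc Γ.σ (M.fundCircuit f S)) s p f := by
    refine ⟨by simp [hs], by simp [hs], hpf, ?_⟩
    rintro g (rfl | rfl | rfl) hg1 hg2
    · exact hR
    · exact absurd rfl hg2
    · exact absurd rfl hg1
  have h2 : ClockwiseAdj (Γ.toSigning.cyc Γ.σ (M.fundCircuit f S)) s f e := by
    refine ⟨by simp [hs], by simp [hs], hfe', ?_⟩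
    rintro g (rfl | rfl | rfl) hg1 hg2
    · exact absurd rfl hg2
    · exact absurd rfl hg1
    · exact hcyc.cyclic _ _ _ hR
  refine ⟨Γ.c (M.fundCircuit f S) f, ?_, ?_⟩
  · rw [Γ.endAt_eq_of_clockwiseAdj hC _ hsfin (hsub p (.inr rfl)) hsC h2, endAt_of_notMem Γ hep']
  · rw [← Γ.endAt_eq_of_clockwiseAdj hC _ hsfin (hsub e (.inl rfl)) hsC h1, endAt_of_notMem Γ hpe']

theorem endAt_coc_of_mem_of_mem {e p : S} (hep : e ≠ p) {f : α} (hfe : f ∈ (coc hS e).1)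
    (hfp : f ∈ (coc hS p).1) :
    ∃ j, Γ.endAt j f (coc hS p) = Γ.σ (coc hS p).1 e ∧
      Γ.endAt (-j) f (coc hS e) = Γ.σ (coc hS e).1 p := by
  have hfS : f ∉ S := by
    intro hfS
    have h1 := eq_of_mem_coc hS (f := ⟨f, hfS⟩) hfe
    have h2 := eq_of_mem_coc hS (f := ⟨f, hfS⟩) hfp
    exact hep (h1.symm.trans h2)
  have hC := hS.fundCircuit_isCircuit ((coc hS e).2.subset_ground hfe) hfS
  rcases (Γ.isCyclicOrder _ hC).total p ((mem_coc_iff_mem_fundCircuit hS).1 hfp) f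
    (M.mem_fundCircuit f S) e ((mem_coc_iff_mem_fundCircuit hS).1 hfe)
    (fun h => hfS (h ▸ p.2)) (fun h => hfS (h ▸ e.2)) (fun h => hep (Subtype.ext h.symm)) with h | h
  · exact Γ.endAt_coc_of_cyc hep hfe hfp h
  · obtain ⟨j, h1, h2⟩ := Γ.endAt_coc_of_cyc hep.symm hfp hfe h
    exact ⟨-j, h2, by rw [neg_neg]; exact h1⟩

/-- No vertex in the closure of all edges lies on the far sides of the fundamental cocircuits of
two distinct elements of a base. -/
theorem σ_coc_or (hconn : IsConnectedMatroid M) (htame : IsTame M) {e p : S} (hep : e ≠ p)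
    (hv : v ∈ Γ.limVerts M.E) :
    v (coc hS p) = Γ.σ (coc hS p).1 e ∨ v (coc hS e) = Γ.σ (coc hS e).1 p := by
  by_contra hcon
  -- No edge has an end in `T` without having both there, so by linkage `T` contains all endvertices
  -- or none; those of `e` are outside.
  set T : Set (Verts M) := {v | ¬ (v (coc hS p) = Γ.σ (coc hS p).1 e ∨
    v (coc hS e) = Γ.σ (coc hS e).1 p)} with hT
  have h𝓑 : ({coc hS p, coc hS e} : Set (Coc M)).Finite := by simp
  have hag : ∀ v w : Verts M, (∀ b ∈ ({coc hS p, coc hS e} : Set (Coc M)), v b = w b) →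
      v ∈ T → w ∈ T := by
    intro v w h hv
    simp only [hT, mem_ofPred_eq] at hv ⊢
    rwa [← h _ (.inl rfl), ← h _ (.inr rfl)]
  have hep' : e.1 ∉ (coc hS p).1 := fun h => hep (eq_of_mem_coc hS h)
  have hstep : ∀ f i, Γ.endAt i f ∈ T → Γ.endAt (-i) f ∈ T := by
    intro f i
    by_cases hfe : f ∈ (coc hS e).1 <;> by_cases hfp : f ∈ (coc hS p).1
    · obtain ⟨j, h1, h2⟩ := Γ.endAt_coc_of_mem_of_mem hep hfe hfp
      intro h
      rcases units_eq_or i j with rfl | rfl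
      · exact absurd (.inl h1) h
      · exact absurd (.inr h2) h
    · intro h
      exact absurd (.inl (by rw [endAt_of_notMem Γ hfp, Γ.σ_coc_eq_of_mem_coc htame hfe hfp])) h
    · intro h
      exact absurd (.inr (by rw [endAt_of_notMem Γ hfe, Γ.σ_coc_eq_of_mem_coc htame hfp hfe])) h
    · refine hag _ _ ?_
      rintro b (rfl | rfl)
      · exact Γ.endAt_congr_of_forall_notMem hfp
      · exact Γ.endAt_congr_of_forall_notMem hfe
  obtain ⟨f, hf, i, hi⟩ := hv _ h𝓑
  have hfT : Γ.endAt i f ∈ T := hag v _ (fun b hb => (hi b hb).symm) hcon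
  have heE : e.1 ∈ M.E := hS.subset_ground e.2
  have := (Γ.endAt_mem_iff_of_linked htame h𝓑 hag
    (fun f => ⟨hstep f 1, fun h => by simpa using hstep f (-1) h⟩)
    (linked_of_isConnectedMatroid hconn hf heE) i 1).1 hfT
  exact this (.inl (endAt_of_notMem Γ hep' 1))

end GraphFramework

/-! ### Paths inside a base -/

namespace GraphFramework

open Set

variable {α : Type u} {M : Matroid α} {S : Set α}

/-- The elements of the base `S` whose fundamental cocircuits separate `x` from `z`. -/
def pathEdges (hS : M.IsBase S) (x z : Verts M) : Set S := {e | x (coc hS e) ≠ z (coc hS e)}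

/-- The edge set of the pseudo-arc in the base `S` between `x` and `z`. -/
def pathSet (hS : M.IsBase S) (x z : Verts M) : Set α := Subtype.val '' pathEdges hS x z

/-- The vertices of the pseudo-arc in the base `S` between `x` and `z`. -/
def pathVerts (Γ : GraphFramework M) (hS : M.IsBase S) (x z : Verts M) : Set (Verts M) :=
  Γ.limVerts (pathSet hS x z) ∪ {x, z}

variable {Γ : GraphFramework M} {hS : M.IsBase S} {b : Coc M} {v w x y z : Verts M}

theorem pathSet_subset_ground : pathSet hS x z ⊆ M.E := by
  rintro _ ⟨e, -, rfl⟩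
  exact hS.subset_ground e.2

theorem pathEdges_comm : pathEdges hS x z = pathEdges hS z x := by
  ext e; exact ne_comm

theorem endAt_mem_pathVerts {e : S} (he : e ∈ pathEdges hS x z) (i : ℤˣ) :
    Γ.endAt i e ∈ Γ.pathVerts hS x z :=
  .inl (Γ.endAt_mem_limVerts (mem_image_of_mem _ he) i)

theorem left_mem_pathVerts : x ∈ Γ.pathVerts hS x z := .inr (by simp)

theorem right_mem_pathVerts : z ∈ Γ.pathVerts hS x z := .inr (by simp)

/-- This symmetry makes the path a linear order: `f` comes after `e`, seen from `e`, exactly when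
`e` comes before `f`, seen from `f`. -/
theorem σ_coc_eq_iff (hconn : IsConnectedMatroid M) (htame : IsTame M) (hx : x ∈ Γ.limVerts M.E)
    (hz : z ∈ Γ.limVerts M.E) {e f : S} (he : e ∈ pathEdges hS x z) (hf : f ∈ pathEdges hS x z)
    (hef : e ≠ f) :
    Γ.σ (coc hS e).1 f = z (coc hS e) ↔ Γ.σ (coc hS f).1 e = x (coc hS f) := by
  have h1 := Γ.σ_coc_or (hS := hS) hconn htame hef hx
  have h2 := Γ.σ_coc_or (hS := hS) hconn htame hef hz
  constructor
  · intro h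
    refine (h1.resolve_right fun h' => he (h'.trans h)).symm
  · intro h
    exact (h2.resolve_left fun h' => hf (h.symm.trans h'.symm)).symm

theorem σ_coc_eq_iff' (hconn : IsConnectedMatroid M) (htame : IsTame M) (hx : x ∈ Γ.limVerts M.E)
    (hz : z ∈ Γ.limVerts M.E) {e f : S} (he : e ∈ pathEdges hS x z) (hf : f ∈ pathEdges hS x z)
    (hef : e ≠ f) :
    Γ.σ (coc hS e).1 f = x (coc hS e) ↔ Γ.σ (coc hS f).1 e = z (coc hS f) :=
  σ_coc_eq_iff hconn htame hz hx (pathEdges_comm ▸ he) (pathEdges_comm ▸ hf) hef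

/-- A path edge `p` on the far side of the cocircuit of `e` would force, by `σ_coc_or`, both `x` and
`z` onto the side of `e` at the cocircuit of `p`, which is supposed to separate them. -/
theorem coc_eq_of_notMem_pathEdges (hconn : IsConnectedMatroid M) (htame : IsTame M)
    (hx : x ∈ Γ.limVerts M.E) (hz : z ∈ Γ.limVerts M.E) {e : S} (he : e ∉ pathEdges hS x z)
    (hv : v ∈ Γ.pathVerts hS x z) : v (coc hS e) = x (coc hS e) := by
  have he' : x (coc hS e) = z (coc hS e) := not_not.1 he
  rcases hv with hv | rfl | rfl
  · obtain ⟨_, ⟨p, hp, rfl⟩, i, hi⟩ := hv {coc hS e} (finite_singleton _)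
    have hpe : p ≠ e := fun h => he (h ▸ hp)
    rw [← hi _ rfl, endAt_of_notMem Γ fun h => hpe (eq_of_mem_coc hS h)]
    by_contra hcon
    have h1 := (Γ.σ_coc_or hconn htame hpe hx).resolve_left fun h => hcon h.symm
    have h2 := (Γ.σ_coc_or hconn htame hpe hz).resolve_left fun h => hcon (h.symm.trans he'.symm)
    exact hp (h1.trans h2.symm)
  · rfl
  · exact he'.symm

theorem pathVerts_subset_limVerts (hx : x ∈ Γ.limVerts M.E) (hz : z ∈ Γ.limVerts M.E) :
    Γ.pathVerts hS x z ⊆ Γ.limVerts M.E := by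
  rintro v (hv | rfl | rfl)
  · exact Γ.limVerts_mono pathSet_subset_ground hv
  · exact hx
  · exact hz

theorem finite_pathEdges_inter (hconn : IsConnectedMatroid M) (htame : IsTame M) (hx : Γ.Good x)
    (hz : Γ.Good z) (b : Coc M) : {e ∈ pathEdges hS x z | e.1 ∈ b.1}.Finite := by
  refine (Good.nice (hS := hS) (b := b) hconn htame hx hz).finite.subset ?_
  rintro e ⟨he, heb⟩
  refine ⟨heb, fun h => he ?_⟩
  have h' : x (coc hS e) * z (coc hS e) = 1 := h
  rw [← mul_left_inj (z (coc hS e)), h', Int.units_mul_self]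

theorem finite_pathSet_inter (hconn : IsConnectedMatroid M) (htame : IsTame M) (hx : Γ.Good x)
    (hz : Γ.Good z) (b : Coc M) : (pathSet hS x z ∩ b.1).Finite := by
  refine ((finite_pathEdges_inter (hS := hS) hconn htame hx hz b).image Subtype.val).subset ?_
  rintro _ ⟨⟨e, he, rfl⟩, heb⟩
  exact ⟨e, ⟨he, heb⟩, rfl⟩

/-- Limit vertices of the path are not yet known to satisfy the product formula. They are first
replaced by path vertices that do and that agree with them at the finitely many relevant cocircuits.
-/
theorem eq_of_forall_pathEdges (hconn : IsConnectedMatroid M) (htame : IsTame M) (hx : Γ.Good x)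
    (hz : Γ.Good z) (hv : v ∈ Γ.pathVerts hS x z) (hw : w ∈ Γ.pathVerts hS x z)
    (h : ∀ e ∈ pathEdges hS x z, e.1 ∈ b.1 → v (coc hS e) = w (coc hS e)) : v b = w b := by
  have hfin := finite_pathEdges_inter (hS := hS) hconn htame hx hz b
  set 𝓑 : Set (Coc M) := insert b (coc hS '' {e ∈ pathEdges hS x z | e.1 ∈ b.1}) with h𝓑
  have h𝓑fin : 𝓑.Finite := (hfin.image _).insert _
  have key : ∀ v ∈ Γ.pathVerts hS x z, ∃ v' ∈ Γ.pathVerts hS x z, Γ.Good v' ∧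
      ∀ c ∈ 𝓑, v' c = v c := by
    rintro v (hv | rfl | rfl)
    · obtain ⟨_, ⟨e, he, rfl⟩, i, hi⟩ := hv 𝓑 h𝓑fin
      exact ⟨_, endAt_mem_pathVerts he i, .inl ⟨e, hS.subset_ground e.2, i, rfl⟩, hi⟩
    · exact ⟨v, left_mem_pathVerts, hx, fun _ _ => rfl⟩
    · exact ⟨v, right_mem_pathVerts, hz, fun _ _ => rfl⟩
  obtain ⟨v', hv', hgv, hvv⟩ := key v hv
  obtain ⟨w', hw', hgw, hww⟩ := key w hw
  rw [← hvv b (.inl rfl), ← hww b (.inl rfl)]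
  refine (Good.nice (hS := hS) hconn htame hgv hgw).eq_of_forall fun e heb => ?_
  by_cases he : e ∈ pathEdges hS x z
  · rw [hvv _ (.inr ⟨e, ⟨he, heb⟩, rfl⟩), hww _ (.inr ⟨e, ⟨he, heb⟩, rfl⟩), h e he heb]
  · rw [coc_eq_of_notMem_pathEdges hconn htame hx.mem_limVerts hz.mem_limVerts he hv',
      coc_eq_of_notMem_pathEdges hconn htame hx.mem_limVerts hz.mem_limVerts he hw']

/-- The edges in `F` that have been passed on the way to `v`. -/
def passed (hS : M.IsBase S) (z : Verts M) (F : Set S) (v : Verts M) : Set S :=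
  {e ∈ F | v (coc hS e) = z (coc hS e)}

theorem exists_endAt_coc_eq (Γ : GraphFramework M) (hS : M.IsBase S) (e : S) (u : ℤˣ) :
    ∃ i, Γ.endAt i e (coc hS e) = u :=
  ⟨u * Γ.d (coc hS e).1 e, by
    rw [endAt_of_mem Γ (mem_coc_self hS e), mul_assoc, Int.units_mul_self, mul_one]⟩

theorem passed_subset_passed (hconn : IsConnectedMatroid M) (htame : IsTame M) (hx : Γ.Good x)
    (hz : Γ.Good z) {F : Set S} (hF : F ⊆ pathEdges hS x z) (hv : v ∈ Γ.pathVerts hS x z) {e : S}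
    (he : e ∈ passed hS z F v) (i : ℤˣ) :
    passed hS z F (Γ.endAt i e) ⊆ passed hS z F v := by
  rintro f ⟨hfF, hf⟩
  by_cases hef : f = e
  · exact hef ▸ he
  refine ⟨hfF, ?_⟩
  rw [endAt_of_notMem Γ fun h => hef (eq_of_mem_coc hS h).symm] at hf
  have h1 := (σ_coc_eq_iff hconn htame hx.mem_limVerts hz.mem_limVerts (hF hfF) (hF he.1) hef).1 hf
  have h2 := (Γ.σ_coc_or hconn htame hef
    (pathVerts_subset_limVerts hx.mem_limVerts hz.mem_limVerts hv)).resolve_left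
    fun h => hF he.1 (by rw [← h1, ← h, he.2])
  rw [h2, hf]

/-- The edge is the last one passed before `v`, found as the one whose far end has passed the most
edges. -/
theorem exists_passed_endAt_eq (hconn : IsConnectedMatroid M) (htame : IsTame M) (hx : Γ.Good x)
    (hz : Γ.Good z) {F : Set S} (hFfin : F.Finite) (hF : F ⊆ pathEdges hS x z)
    (hv : v ∈ Γ.pathVerts hS x z) (hne : (passed hS z F v).Nonempty) :
    ∃ e ∈ passed hS z F v, ∃ i, passed hS z F (Γ.endAt i e) = passed hS z F v ∧
      passed hS z F (Γ.endAt (-i) e) = passed hS z F v \ {e} := by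
  choose i hi using fun e : S => exists_endAt_coc_eq Γ hS e (z (coc hS e))
  obtain ⟨e, he, hmax⟩ := Set.exists_max_image (passed hS z F v)
    (fun e => (passed hS z F (Γ.endAt (i e) e)).ncard) (hFfin.subset (Set.sep_subset _ _)) hne
  have hlim := hx.mem_limVerts
  have hlim' := hz.mem_limVerts
  have heq : passed hS z F (Γ.endAt (i e) e) = passed hS z F v := by
    refine subset_antisymm (passed_subset_passed hconn htame hx hz hF hv he _) fun f hf => ?_
    by_contra hcon
    have hfe : f ≠ e := by
      rintro rfl
      exact hcon ⟨hf.1, hi _⟩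
    have h1 : Γ.σ (coc hS f).1 e = x (coc hS f) := by
      have h2 : Γ.σ (coc hS f).1 e ≠ z (coc hS f) := fun h => hcon ⟨hf.1, by
        rw [endAt_of_notMem Γ fun h => hfe (eq_of_mem_coc hS h).symm, h]⟩
      exact units_eq_of_ne_of_ne h2 (hF hf.1).symm
    have h2 := (σ_coc_eq_iff' hconn htame hlim hlim' (hF hf.1) (hF he.1) hfe).1 h1
    have h3 : e ∈ passed hS z F (Γ.endAt (i f) f) := ⟨he.1, by
      rw [endAt_of_notMem Γ fun h => hfe (eq_of_mem_coc hS h), h2]⟩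
    have h4 := passed_subset_passed hconn htame hx hz hF (endAt_mem_pathVerts (hF hf.1) (i f)) h3
      (i e)
    have h5 := Set.ncard_lt_ncard (s := passed hS z F (Γ.endAt (i e) e))
      (t := passed hS z F (Γ.endAt (i f) f)) ⟨h4, fun h => hcon (h ⟨hf.1, hi f⟩)⟩
      (hFfin.subset (Set.sep_subset _ _))
    exact absurd (hmax f hf) (not_le.2 h5)
  refine ⟨e, he, i e, heq, ?_⟩
  rw [← heq]
  ext f
  simp only [passed, mem_sdiff, mem_ofPred_eq, mem_singleton_iff]
  by_cases hfe : f = e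
  · subst hfe
    refine iff_of_false (fun h => ?_) fun h => h.2 rfl
    rw [endAt_neg_of_mem Γ (mem_coc_self hS f), hi f] at h
    exact units_ne_neg _ h.2.symm
  · have hnm : e.1 ∉ (coc hS f).1 := fun h => hfe (eq_of_mem_coc hS h).symm
    rw [endAt_of_notMem Γ hnm, endAt_of_notMem Γ hnm]
    exact ⟨fun h => ⟨h, hfe⟩, fun h => h.1⟩

theorem exists_finite_determining (hconn : IsConnectedMatroid M) (htame : IsTame M)
    (hx : Γ.Good x) (hz : Γ.Good z) {𝓑 : Set (Coc M)} (h𝓑 : 𝓑.Finite) :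
    ∃ F ⊆ pathEdges hS x z, F.Finite ∧ (∀ e ∈ pathEdges hS x z, ∀ b ∈ 𝓑, e.1 ∈ b.1 → e ∈ F) ∧
      ∀ v ∈ Γ.pathVerts hS x z, ∀ w ∈ Γ.pathVerts hS x z,
        (∀ e ∈ F, v (coc hS e) = w (coc hS e)) → ∀ b ∈ 𝓑, v b = w b := by
  refine ⟨⋃ b ∈ 𝓑, {e ∈ pathEdges hS x z | e.1 ∈ b.1}, ?_,
    h𝓑.biUnion fun b _ => finite_pathEdges_inter hconn htame hx hz b, ?_, ?_⟩
  · exact iUnion₂_subset fun b _ => Set.sep_subset _ _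
  · exact fun e he b hb heb => mem_biUnion hb ⟨he, heb⟩
  · intro v hv w hw h b hb
    exact eq_of_forall_pathEdges hconn htame hx hz hv hw fun e he heb =>
      h e (mem_biUnion hb ⟨he, heb⟩)

theorem eq_on_of_passed_eq {F : Set S} (h : passed hS z F v = passed hS z F w) :
    ∀ e ∈ F, v (coc hS e) = w (coc hS e) := by
  intro e he
  have h1 := Set.ext_iff.1 h e
  simp only [passed, mem_ofPred_eq, he, true_and] at h1
  by_cases hv : v (coc hS e) = z (coc hS e)
  · rw [hv, h1.1 hv]
  · exact units_eq_of_ne_of_ne hv fun h => hv (h1.2 h.symm)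

/-- A set of vertices determined by finitely many cocircuits that contains `x` and does not
separate the endvertices of any edge of the path contains every vertex of the path. -/
theorem pathVerts_subset (hconn : IsConnectedMatroid M) (htame : IsTame M)
    (hx : Γ.Good x) (hz : Γ.Good z) {𝓑 : Set (Coc M)} (h𝓑 : 𝓑.Finite) {T : Set (Verts M)}
    (hag : ∀ v w : Verts M, (∀ b ∈ 𝓑, v b = w b) → v ∈ T → w ∈ T)
    (hT : ∀ e ∈ pathSet hS x z, (Γ.endAt 1 e ∈ T ↔ Γ.endAt (-1) e ∈ T)) (hxT : x ∈ T) :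
    Γ.pathVerts hS x z ⊆ T := by
  obtain ⟨F, hFP, hFfin, -, hF⟩ :=
    exists_finite_determining (hS := hS) hconn htame hx hz h𝓑
  have hT' : ∀ e ∈ pathEdges hS x z, ∀ i, Γ.endAt (-i) e ∈ T → Γ.endAt i e ∈ T := by
    intro e he i
    rcases Int.units_eq_one_or i with rfl | rfl
    · exact (hT e ⟨e, he, rfl⟩).2
    · rw [neg_neg]; exact (hT e ⟨e, he, rfl⟩).1
  -- A vertex that has passed no edge of `F` is indistinguishable from `x`; otherwise step back over
  -- the last edge passed.
  suffices h : ∀ n, ∀ v ∈ Γ.pathVerts hS x z, (passed hS z F v).ncard = n → v ∈ T from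
    fun v hv => h _ v hv rfl
  intro n
  induction n using Nat.strong_induction_on with
  | _ n ih =>
    intro v hv hn
    rcases Set.eq_empty_or_nonempty (passed hS z F v) with h0 | hne
    · refine hag x v (hF x left_mem_pathVerts v hv
        (eq_on_of_passed_eq (z := z) ?_)) hxT
      rw [h0]
      ext e
      simp only [passed, mem_ofPred_eq, mem_empty_iff_false, iff_false, not_and]
      exact fun he => hFP he
    · obtain ⟨e, he, i, h1, h2⟩ := exists_passed_endAt_eq hconn htame hx hz hFfin hFP hv hne
      have hmem := endAt_mem_pathVerts (Γ := Γ) (hFP he.1)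
      refine hag (Γ.endAt i e) v (hF _ (hmem i) v hv
        (eq_on_of_passed_eq h1)) (hT' e (hFP he.1) i ?_)
      refine ih _ ?_ _ (hmem (-i)) rfl
      rw [h2, ← hn]
      exact Set.ncard_sdiff_singleton_lt_of_mem he (hFfin.subset (Set.sep_subset _ _))

/-- `D` is the union of the circuits along a linking chain, or just `{e}` for the trivial chain,
whose only limits are the two ends of `e`. -/
theorem exists_isCircuit_union_of_linked (htame : IsTame M) {e f : α} (he : e ∈ M.E)
    (hef : Linked M e f) : f ∈ M.E ∧ ∃ D ⊆ M.E, e ∈ D ∧ f ∈ D ∧ (∀ v ∈ Γ.limVerts D, Γ.Good v) ∧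
      ∀ b : Coc M, Disjoint D b.1 → Γ.σ b.1 e = Γ.σ b.1 f := by
  have key : (e ∈ M.E ↔ f ∈ M.E) ∧ (e ∈ M.E → ∃ D ⊆ M.E, e ∈ D ∧ f ∈ D ∧
      (∀ v ∈ Γ.limVerts D, Γ.Good v) ∧
      ∀ b : Coc M, Disjoint D b.1 → Γ.σ b.1 e = Γ.σ b.1 f) := by
    clear he
    induction hef with
    | rel e f h =>
      obtain ⟨o, ho, he, hf⟩ := h
      exact ⟨iff_of_true (ho.subset_ground he) (ho.subset_ground hf), fun _ =>
        ⟨o, ho.subset_ground, he, hf, fun v hv => .inr ⟨o, ho, hv⟩, fun b hb =>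
          Γ.σ_eq_of_isCircuit htame ho hb he hf⟩⟩
    | refl e =>
      refine ⟨Iff.rfl, fun he => ⟨{e}, by simpa, rfl, rfl, fun v hv => ?_, fun b _ => rfl⟩⟩
      by_contra hcon
      have hne : ∀ i, ∃ b, Γ.endAt i e b ≠ v b := fun i =>
        Function.ne_iff.1 fun h => hcon (.inl ⟨e, he, i, h.symm⟩)
      choose b hb using hne
      obtain ⟨_, rfl, i, hi⟩ := hv (range b) (Set.finite_range b)
      exact hb i (hi _ ⟨i, rfl⟩)
    | symm e f _ ih =>
      refine ⟨ih.1.symm, fun hf => ?_⟩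
      obtain ⟨D, hD, h1, h2, h3, h4⟩ := ih.2 (ih.1.2 hf)
      exact ⟨D, hD, h2, h1, h3, fun b hb => (h4 b hb).symm⟩
    | trans e f g _ _ ih1 ih2 =>
      refine ⟨ih1.1.trans ih2.1, fun he => ?_⟩
      obtain ⟨D, hD, h1, h2, h3, h4⟩ := ih1.2 he
      obtain ⟨D', hD', h1', h2', h3', h4'⟩ := ih2.2 (ih1.1.1 he)
      refine ⟨D ∪ D', union_subset hD hD', .inl h1, .inr h2', fun v hv => ?_, fun b hb => ?_⟩
      · rw [limVerts_union] at hv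
        exact hv.elim (h3 v) (h3' v)
      · rw [Set.disjoint_union_left] at hb
        exact (h4 b hb.1).trans (h4' b hb.2)
  exact ⟨key.1.1 he, key.2 he⟩

/-- Only finitely many path edges meet the given cocircuits. As `y` is an end of none of them,
finitely many further cocircuits keep `y` away from their ends, and an approximating edge is then
none of them. -/
theorem exists_near_edge (hconn : IsConnectedMatroid M) (htame : IsTame M)
    (hx : Γ.Good x) (hz : Γ.Good z) (hy : y ∈ Γ.limVerts (pathSet hS x z)) (hyg : ¬ Γ.Good y)
    {𝓑 : Set (Coc M)} (h𝓑 : 𝓑.Finite) :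
    ∃ a ∈ pathEdges hS x z, ∀ b ∈ 𝓑, a.1 ∉ b.1 ∧ Γ.σ b.1 a = y b := by
  obtain ⟨F, hFP, hFfin, hF, -⟩ := exists_finite_determining (hS := hS) hconn htame hx hz h𝓑
  have hne : ∀ (a : S) (i : ℤˣ), ∃ b, Γ.endAt i a b ≠ y b := fun a i =>
    Function.ne_iff.1 fun h => hyg (.inl ⟨a, hS.subset_ground a.2, i, h.symm⟩)
  choose c hc using hne
  obtain ⟨_, ⟨a, ha, rfl⟩, i, hi⟩ := hy (𝓑 ∪ ⋃ a ∈ F, range (c a))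
    (h𝓑.union (hFfin.biUnion fun a _ => Set.finite_range _))
  have haF : a ∉ F := fun haF => hc a i (hi _ (.inr (mem_biUnion haF ⟨i, rfl⟩)))
  refine ⟨a, ha, fun b hb => ?_⟩
  have hab : a.1 ∉ b.1 := fun hab => haF (hF a ha b hb hab)
  exact ⟨hab, by rw [← hi b (.inl hb), endAt_of_notMem Γ hab]⟩

/-- Suppose `y` is not good. Path edges `e` before and `f` after `y` are joined outside a
neighbourhood of `y` by a union `D` of circuits. A path edge `p` near `y` then lies on a circuit `C`
within the path and `D`, and `C` must contain every path edge near `y`; so `y` is a limit of `C`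
after all. -/
theorem good_of_mem_limVerts_pathSet (hconn : IsConnectedMatroid M) (htame : IsTame M)
    (hx : Γ.Good x) (hz : Γ.Good z) (hy : y ∈ Γ.limVerts (pathSet hS x z)) : Γ.Good y := by
  by_contra hyg
  have hlim := hx.mem_limVerts
  have hlim' := hz.mem_limVerts
  have hyP : y ∈ Γ.pathVerts hS x z := .inl hy
  obtain ⟨e, he, hey⟩ : ∃ e ∈ pathEdges hS x z, y (coc hS e) = z (coc hS e) := by
    by_contra! hcon
    have hyx : y = x := funext fun b =>
      eq_of_forall_pathEdges hconn htame hx hz hyP left_mem_pathVerts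
        fun e he _ => units_eq_of_ne_of_ne (hcon e he) he.symm
    exact hyg (hyx ▸ hx)
  obtain ⟨f, hf, hfy⟩ : ∃ f ∈ pathEdges hS x z, y (coc hS f) = x (coc hS f) := by
    by_contra! hcon
    have hyx : y = z := funext fun b =>
      eq_of_forall_pathEdges hconn htame hx hz hyP right_mem_pathVerts
        fun e he _ => units_eq_of_ne_of_ne (hcon e he) he
    exact hyg (hyx ▸ hz)
  obtain ⟨hfE, D, hDE, heD, hfD, hDg, hDσ⟩ := exists_isCircuit_union_of_linked (Γ := Γ) htame
    (hS.subset_ground e.2) (linked_of_isConnectedMatroid hconn (hS.subset_ground e.2)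
      (hS.subset_ground f.2))
  obtain ⟨𝓑₀, h𝓑₀, hD𝓑⟩ : ∃ 𝓑₀ : Set (Coc M), 𝓑₀.Finite ∧
      ∀ q ∈ D, ∀ i, ¬ ∀ b ∈ 𝓑₀, Γ.endAt i q b = y b := by
    by_contra! hcon
    exact hyg (hDg y hcon)
  set 𝓑 : Set (Coc M) := 𝓑₀ ∪ {coc hS e, coc hS f} with h𝓑
  have h𝓑fin : 𝓑.Finite := h𝓑₀.union (by simp)
  obtain ⟨F, hFP, hFfin, hF, -⟩ := exists_finite_determining (hS := hS) hconn htame hx hz h𝓑fin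
  -- Adding the fundamental cocircuits of `F` ensures that any two edges near `y` lie on the same
  -- side of each edge of `F`.
  set 𝓑' : Set (Coc M) := 𝓑 ∪ coc hS '' F with h𝓑'
  have h𝓑'fin : 𝓑'.Finite := h𝓑fin.union (hFfin.image _)
  have hnotD : ∀ q i, (∀ b ∈ 𝓑', Γ.endAt i q b = y b) → q ∉ D := fun q i hq hqD =>
    hD𝓑 q hqD i fun b hb => hq b (.inl (.inl hb))
  have near_end : ∀ a : S, (∀ b ∈ 𝓑', a.1 ∉ b.1 ∧ Γ.σ b.1 a = y b) →
      ∀ i, ∀ b ∈ 𝓑', Γ.endAt i a b = y b := fun a ha i b hb => by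
    rw [endAt_of_notMem Γ (ha b hb).1, (ha b hb).2]
  obtain ⟨p, hp, hpn⟩ := exists_near_edge hconn htame hx hz hy hyg h𝓑'fin
  have hpD : p.1 ∉ D := hnotD p 1 (near_end p hpn 1)
  -- Otherwise a cocircuit `K` through `p` misses `D` and the rest of the path. Then `e` and `f` are
  -- on the same side of `K` because of `D`, and on different sides because the path from `e` to `f`
  -- crosses `K` exactly once, at `p`.
  obtain ⟨C, hC, hpC, hCP⟩ : ∃ C, M.IsCircuit C ∧ p.1 ∈ C ∧ C ⊆ pathSet hS x z ∪ D := by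
    by_contra! hcon
    have hcl : p.1 ∉ M.closure ((pathSet hS x z ∪ D) \ {p.1}) := by
      intro hcl
      rw [M.mem_closure_iff_exists_isCircuit fun h => h.2 rfl] at hcl
      obtain ⟨C, hCs, hC, hpC⟩ := hcl
      refine hcon C hC hpC (hCs.trans (insert_subset (.inl ⟨p, hp, rfl⟩) sdiff_subset))
    obtain ⟨K, hK, hpK, hKd⟩ := exists_isCocircuit_of_notMem_closure (hS.subset_ground p.2) hcl
    have hKD : Disjoint D K := by
      rw [Set.disjoint_left]
      exact fun q hqD hqK => Set.disjoint_left.1 hKd hqK ⟨.inr hqD, fun h => hpD (h ▸ hqD)⟩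
    have hep : e ≠ p := fun h => hpD (h ▸ heD)
    have hfp : f ≠ p := fun h => hpD (h ▸ hfD)
    have h1 : Γ.σ (coc hS p).1 e = x (coc hS p) :=
      (σ_coc_eq_iff hconn htame hlim hlim' he hp hep).1
        ((hpn _ (.inl (.inr (by simp)))).2.trans hey)
    have h2 : Γ.σ (coc hS p).1 f = z (coc hS p) :=
      (σ_coc_eq_iff' hconn htame hlim hlim' hf hp hfp).1
        ((hpn _ (.inl (.inr (by simp)))).2.trans hfy)
    have honly : ∀ q ∈ pathEdges hS x z, q.1 ∈ K → q = p := by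
      intro q hq hqK
      by_contra hqp
      exact Set.disjoint_left.1 hKd hqK ⟨.inl ⟨q, hq, rfl⟩, fun h => hqp (Subtype.ext h)⟩
    have h3 : ∀ (g : S), g ∈ pathEdges hS x z → g ≠ p → g.1 ∈ D → ∀ i,
        Γ.endAt i p (coc hS p) = Γ.σ (coc hS p).1 g →
        Γ.endAt i p ⟨K, hK⟩ = Γ.σ K g := by
      intro g hg hgp hgD i hi
      rw [eq_of_forall_pathEdges (b := ⟨K, hK⟩) (w := Γ.endAt 1 g) hconn htame hx hz
        (endAt_mem_pathVerts hp i)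
        (endAt_mem_pathVerts hg 1), endAt_of_notMem Γ (Set.disjoint_left.1 hKD hgD)]
      intro q hq hqK
      rw [honly q hq hqK, hi, endAt_of_notMem Γ fun h => hgp (eq_of_mem_coc hS h)]
    obtain ⟨i, hi⟩ := exists_endAt_coc_eq Γ hS p (x (coc hS p))
    have h4 := h3 e he hep heD i (hi.trans h1.symm)
    have h5 := h3 f hf hfp hfD (-i) (by
      rw [endAt_neg_of_mem Γ (mem_coc_self hS p), hi, h2]
      exact (units_eq_neg_iff_ne.2 (Ne.symm hp)).symm)
    rw [endAt_neg_of_mem Γ hpK, h4, hDσ ⟨K, hK⟩ hKD] at h5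
    exact units_ne_neg _ h5.symm
  have hmem : ∀ a ∈ pathEdges hS x z, (∀ b ∈ 𝓑', a.1 ∉ b.1 ∧ Γ.σ b.1 a = y b) → a.1 ∈ C := by
    intro a ha han
    by_contra haC
    have hap : a ≠ p := fun h => haC (h ▸ hpC)
    -- Leave `p` along `C` through its end towards `a`. The next relevant edge `q` of `C` is close
    -- to `y`, hence not in `D`; so it is a path edge in `F` strictly between `p` and `a`. But `p`
    -- and `a` are on the same side of `q`.
    obtain ⟨i, hi⟩ := exists_endAt_coc_eq Γ hS p (Γ.σ (coc hS p).1 a)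
    set 𝓒 : Set (Coc M) := 𝓑' ∪ {coc hS p, coc hS a} with h𝓒
    have h𝓒fin : 𝓒.Finite := h𝓑'fin.union (by simp)
    have hps : p.1 ∈ C ∩ ⋃ b ∈ 𝓒, b.1 :=
      ⟨hpC, mem_biUnion (x := coc hS p) (.inr (by simp)) (mem_coc_self hS p)⟩
    obtain ⟨k, hk, hkp⟩ : ∃ k ∈ C ∩ (coc hS p).1, k ≠ p := by
      by_contra! hcon
      refine hC.inter_isCocircuit_ne_singleton (coc hS p).2 (e := p.1) ?_
      exact Set.eq_singleton_iff_unique_mem.2 ⟨⟨hpC, mem_coc_self hS p⟩, hcon⟩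
    obtain ⟨q, ⟨hqC, hqU⟩, hqp, j, hj⟩ := Γ.exists_neighbour hC (𝓑 := 𝓒)
      (finite_inter_biUnion htame hC h𝓒fin)
      (fun b hb g hg => ⟨hg.2, mem_biUnion hb hg.1⟩) inter_subset_left
      ⟨p, hps, k, ⟨hk.1, mem_biUnion (x := coc hS p) (.inr (by simp)) hk.2⟩, hkp.symm⟩ hps i
    have hqD : q ∉ D := hnotD q j fun b hb => by
      rw [hj b (.inl hb), near_end p hpn i b hb]
    obtain ⟨q, hq, rfl⟩ := (hCP hqC).resolve_right hqD
    have hqp' : q ≠ p := fun h => hqp (h ▸ rfl)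
    have hqa : q ≠ a := fun h => haC (h ▸ hqC)
    have hqF : q ∈ F := by
      obtain ⟨b, hb, hqb⟩ := mem_iUnion₂.1 hqU
      rcases hb with (hb | ⟨g, hg, rfl⟩) | rfl | rfl
      · exact hF q hq b hb hqb
      · rwa [eq_of_mem_coc hS hqb]
      · exact absurd (eq_of_mem_coc hS hqb) hqp'
      · exact absurd (eq_of_mem_coc hS hqb) hqa
    have h1 : Γ.σ (coc hS p).1 q = Γ.σ (coc hS p).1 a := by
      rw [← hi, ← hj _ (.inr (by simp)), endAt_of_notMem Γ fun h => hqp' (eq_of_mem_coc hS h)]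
    have h2 : Γ.σ (coc hS a).1 q = Γ.σ (coc hS a).1 p := by
      have := hj (coc hS a) (.inr (by simp))
      rwa [endAt_of_notMem Γ fun h => hqa (eq_of_mem_coc hS h),
        endAt_of_notMem Γ fun h => hap (eq_of_mem_coc hS h).symm] at this
    have h3 : Γ.σ (coc hS q).1 p = Γ.σ (coc hS q).1 a :=
      (hpn _ (.inr ⟨q, hqF, rfl⟩)).2.trans (han _ (.inr ⟨q, hqF, rfl⟩)).2.symm
    by_cases h4 : Γ.σ (coc hS p).1 a = z (coc hS p)
    · have h5 := (σ_coc_eq_iff hconn htame hlim hlim' hp ha hap.symm).1 h4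
      have h6 := (σ_coc_eq_iff hconn htame hlim hlim' hp hq hqp'.symm).1 (h1.trans h4)
      have h7 := (σ_coc_eq_iff' hconn htame hlim hlim' ha hq hqa.symm).1 (h2.trans h5)
      exact hq (h6.symm.trans (h3.trans h7))
    · have h4 : Γ.σ (coc hS p).1 a = x (coc hS p) := units_eq_of_ne_of_ne h4 (Ne.symm hp)
      have h5 := (σ_coc_eq_iff' hconn htame hlim hlim' hp ha hap.symm).1 h4
      have h6 := (σ_coc_eq_iff' hconn htame hlim hlim' hp hq hqp'.symm).1 (h1.trans h4)
      have h7 := (σ_coc_eq_iff hconn htame hlim hlim' ha hq hqa.symm).1 (h2.trans h5)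
      exact hq (h7.symm.trans (h3.symm.trans h6))
  refine hyg (.inr ⟨C, hC, fun 𝓓 h𝓓 => ?_⟩)
  obtain ⟨a, ha, han⟩ := exists_near_edge hconn htame hx hz hy hyg (h𝓑'fin.union h𝓓)
  refine ⟨a, hmem a ha fun b hb => han b (.inl hb), 1, fun b hb => ?_⟩
  rw [endAt_of_notMem Γ (han b (.inr hb)).1, (han b (.inr hb)).2]

end GraphFramework

/-! ### Points and edges of a graph-like space -/

namespace GraphLikeSpace

open Set

variable {V E : Type*} (G : GraphLikeSpace V E)

/-- The set consisting of the vertices in `V'` and the interior points of the edges in `D`. -/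
def pts (V' : Set V) (D : Set E) : Set G.Carrier := {p | ∃ v ∈ V', p = G.vert v} ∪ G.innerPts D

variable {G}

@[simp] theorem vert_mem_pts {V' : Set V} {D : Set E} {v : V} : G.vert v ∈ G.pts V' D ↔ v ∈ V' := by
  constructor
  · rintro (⟨w, hw, h⟩ | ⟨e, -, r, h⟩)
    · cases h; exact hw
    · cases h
  · exact fun h => .inl ⟨v, h, rfl⟩

@[simp] theorem inner_mem_innerPts {D : Set E} {e : E} {r} : G.inner e r ∈ G.innerPts D ↔ e ∈ D := by
  constructor
  · rintro ⟨e, he, r, h⟩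
    cases h; exact he
  · exact fun h => ⟨e, h, r, rfl⟩

@[simp] theorem vert_notMem_innerPts {D : Set E} {v : V} : G.vert v ∉ G.innerPts D := by
  rintro ⟨e, he, r, h⟩
  cases h

@[simp] theorem inner_mem_pts {V' : Set V} {D : Set E} {e : E} {r} :
    G.inner e r ∈ G.pts V' D ↔ e ∈ D := by
  constructor
  · rintro (⟨w, hw, h⟩ | h)
    · cases h
    · exact inner_mem_innerPts.1 h
  · exact fun h => .inr (inner_mem_innerPts.2 h)

theorem vert_ne_inner {v : V} {e : E} {r} : G.vert v ≠ G.inner e r := by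
  intro h; cases h

theorem vert_injective : Function.Injective G.vert := by
  intro v w h; cases h; rfl

theorem inner_inj {e f : E} {r s} : G.inner e r = G.inner f s ↔ e = f ∧ r = s := by
  constructor
  · intro h; cases h; exact ⟨rfl, rfl⟩
  · rintro ⟨rfl, rfl⟩; rfl

theorem vert_or_inner (p : G.Carrier) : (∃ v, p = G.vert v) ∨ ∃ e r, p = G.inner e r := by
  cases p with
  | vert v => exact .inl ⟨v, rfl⟩
  | inner e r => exact .inr ⟨e, r, rfl⟩

theorem isOpen_inner_image (e : E) {U : Set (Ioo (0 : ℝ) 1)} (hU : IsOpen U) :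
    IsOpen (G.inner e '' U) :=
  G.isOpenMap_inner e U hU

theorem isOpen_innerPts (D : Set E) : IsOpen (G.innerPts D) := by
  have : G.innerPts D = ⋃ e ∈ D, G.inner e '' univ := by
    ext p
    simp only [innerPts, mem_ofPred_eq, mem_iUnion₂, image_univ, mem_range, exists_prop, eq_comm]
  rw [this]
  exact isOpen_biUnion fun e _ => isOpen_inner_image e isOpen_univ

theorem continuous_ι (e : E) : Continuous (G.ι e) := G.continuous_edgeMap e

theorem ι_zero (e : E) : G.ι e 0 = G.vert (G.src e) := by
  simp [ι, Pt.edgeMap]; rfl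

theorem ι_one (e : E) : G.ι e 1 = G.vert (G.tgt e) := by
  simp [ι, Pt.edgeMap]; rfl

theorem ι_of_mem (e : E) {x : unitInterval} (h : 0 < (x : ℝ) ∧ (x : ℝ) < 1) :
    G.ι e x = G.inner e ⟨x, h⟩ := dif_pos h

theorem inner_mem_range_ι (e : E) (r) : G.inner e r ∈ range (G.ι e) :=
  ⟨⟨r, r.2.1.le, r.2.2.le⟩, ι_of_mem e ⟨r.2.1, r.2.2⟩⟩

theorem range_ι (e : E) : range (G.ι e) = G.pts {G.src e, G.tgt e} {e} := by
  ext p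
  constructor
  · rintro ⟨x, rfl⟩
    by_cases h : 0 < (x : ℝ) ∧ (x : ℝ) < 1
    · rw [ι_of_mem e h]; simp
    · by_cases h0 : x = 0
      · rw [h0, ι_zero]; simp
      · have h1 : x = 1 := by
          refine Subtype.ext (le_antisymm x.2.2 (not_lt.1 fun h1 => h ⟨?_, h1⟩))
          exact lt_of_le_of_ne x.2.1 fun h => h0 (Subtype.ext h.symm)
        rw [h1, ι_one]; simp
  · rintro (⟨v, rfl | rfl, rfl⟩ | ⟨f, rfl, r, rfl⟩)
    · exact ⟨0, ι_zero e⟩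
    · exact ⟨1, ι_one e⟩
    · exact inner_mem_range_ι _ r

theorem isPreconnected_range_ι (e : E) : IsPreconnected (range (G.ι e)) :=
  isPreconnected_range (continuous_ι e)

end GraphLikeSpace

/-! ### The topology of `Γ.space`: neighbourhoods, compactness, connectedness -/

namespace GraphFramework

open Set GraphLikeSpace

variable {α : Type u} {M : Matroid α} {Γ : GraphFramework M}

theorem isOpen_subbasic (b : Coc M) (i : ℤˣ) (ε : M.E → Ioo (0 : ℝ) 1) :
    IsOpen (X := Γ.space.Carrier) (Γ.subbasic b i ε) :=
  TopologicalSpace.isOpen_generateFrom_of_mem (.inr ⟨b, i, ε, rfl⟩)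

theorem subbasic_mono {b : Coc M} {i : ℤˣ} {ε ε' : M.E → Ioo (0 : ℝ) 1} (h : ∀ e, ε e ≤ ε' e) :
    Γ.subbasic b i ε ⊆ Γ.subbasic b i ε' := by
  rintro (v | ⟨e, r⟩) hp
  · exact hp
  · have h' : (ε e : ℝ) ≤ ε' e := h e
    rw [mem_subbasic_inner] at hp ⊢
    rcases hp with hp | ⟨h1, h2, h3⟩ | ⟨h1, h2, h3⟩
    · exact .inl hp
    · exact .inr (.inl ⟨h1, h2, by linarith⟩)
    · exact .inr (.inr ⟨h1, h2, by linarith⟩)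

/-- The open set of points agreeing with the vertex `v` on the cocircuits in `𝓑`. -/
def basicSet (Γ : GraphFramework M) (v : Verts M) (𝓑 : Set (Coc M)) (ε : M.E → Ioo (0 : ℝ) 1) :
    Set Γ.space.Carrier :=
  ⋂ b ∈ 𝓑, Γ.subbasic b (v b) ε

theorem mem_basicSet {v : Verts M} {𝓑 : Set (Coc M)} {ε : M.E → Ioo (0 : ℝ) 1}
    {p : Γ.space.Carrier} : p ∈ Γ.basicSet v 𝓑 ε ↔ ∀ b ∈ 𝓑, p ∈ Γ.subbasic b (v b) ε :=
  mem_iInter₂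

theorem isOpen_basicSet {v : Verts M} {𝓑 : Set (Coc M)} (h𝓑 : 𝓑.Finite)
    (ε : M.E → Ioo (0 : ℝ) 1) : IsOpen (Γ.basicSet v 𝓑 ε) :=
  h𝓑.isOpen_biInter fun b _ => isOpen_subbasic b _ ε

theorem vert_mem_basicSet {v w : Verts M} {𝓑 : Set (Coc M)} {ε : M.E → Ioo (0 : ℝ) 1} :
    Γ.space.vert w ∈ Γ.basicSet v 𝓑 ε ↔ ∀ b ∈ 𝓑, w b = v b := mem_basicSet

/-- The constant function with value `1 / 2`. -/
noncomputable def half (M : Matroid α) : M.E → Ioo (0 : ℝ) 1 := fun _ => ⟨1 / 2, by norm_num⟩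

/-- The bound 1/2 on `ε` guarantees that an interior point in the basic set lies in the same half of
its edge for all cocircuits of `𝓑` containing that edge, so that one of the two ends agrees with `v`
throughout `𝓑`. -/
theorem exists_basicSet_subset {U : Set Γ.space.Carrier} (hU : IsOpen U) {v : Verts M}
    (hv : Γ.space.vert v ∈ U) :
    ∃ (𝓑 : Set (Coc M)) (ε : M.E → Ioo (0 : ℝ) 1), 𝓑.Finite ∧ (∀ e, ε e ≤ half M e) ∧
      Γ.basicSet v 𝓑 ε ⊆ U := by
  have key : ∃ (𝓑 : Set (Coc M)) (ε : M.E → Ioo (0 : ℝ) 1), 𝓑.Finite ∧ Γ.basicSet v 𝓑 ε ⊆ U := by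
    induction hU with
    | basic U hU =>
      rcases hU with ⟨e, U, -, rfl⟩ | ⟨b, i, ε, rfl⟩
      · obtain ⟨r, -, hr⟩ := hv
        cases hr
      · have hvi : v b = i := hv
        exact ⟨{b}, ε, finite_singleton b, fun p hp => hvi ▸ mem_basicSet.1 hp b rfl⟩
    | univ => exact ⟨∅, half M, finite_empty, subset_univ _⟩
    | inter U W _ _ ih1 ih2 =>
      obtain ⟨𝓑₁, ε₁, h𝓑₁, h1⟩ := ih1 hv.1
      obtain ⟨𝓑₂, ε₂, h𝓑₂, h2⟩ := ih2 hv.2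
      refine ⟨𝓑₁ ∪ 𝓑₂, fun e => min (ε₁ e) (ε₂ e), h𝓑₁.union h𝓑₂, fun p hp => ⟨h1 ?_, h2 ?_⟩⟩
      · exact mem_basicSet.2 fun b hb =>
          subbasic_mono (fun e => min_le_left _ _) (mem_basicSet.1 hp b (.inl hb))
      · exact mem_basicSet.2 fun b hb =>
          subbasic_mono (fun e => min_le_right _ _) (mem_basicSet.1 hp b (.inr hb))
    | sUnion 𝓤 _ ih =>
      obtain ⟨U, hU, hvU⟩ := hv
      obtain ⟨𝓑, ε, h𝓑, h⟩ := ih U hU hvU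
      exact ⟨𝓑, ε, h𝓑, h.trans (subset_sUnion_of_mem hU)⟩
  obtain ⟨𝓑, ε, h𝓑, h⟩ := key
  refine ⟨𝓑, fun e => min (ε e) (half M e), h𝓑, fun e => min_le_right _ _, fun p hp => h ?_⟩
  exact mem_basicSet.2 fun b hb => subbasic_mono (fun e => min_le_left _ _) (mem_basicSet.1 hp b hb)

theorem inner_mem_subbasic_of_notMem {b : Coc M} {i : ℤˣ} {ε : M.E → Ioo (0 : ℝ) 1} {e : M.E}
    {r} (h : e.1 ∉ b.1) : Γ.space.inner e r ∈ Γ.subbasic b i ε ↔ Γ.σ b.1 e = i := by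
  change Pt.inner e r ∈ _ ↔ _
  simp [mem_subbasic_inner, h]

/-- Every basic open set around a vertex that contains an interior point of an edge contains an
endvertex of that edge. -/
theorem exists_endAt_of_inner_mem_basicSet {v : Verts M} {𝓑 : Set (Coc M)}
    {ε : M.E → Ioo (0 : ℝ) 1} (hε : ∀ e, ε e ≤ half M e) {e : M.E} {r}
    (h : Γ.space.inner e r ∈ Γ.basicSet v 𝓑 ε) : ∃ i, ∀ b ∈ 𝓑, Γ.endAt i e b = v b := by
  have hε' : (ε e : ℝ) ≤ 1 / 2 := hε e
  rw [mem_basicSet] at h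
  by_cases hr : (r : ℝ) < 1 / 2
  · refine ⟨-1, fun b hb => ?_⟩
    rcases (mem_subbasic_inner Γ b _ ε e r).1 (h b hb) with ⟨h1, h2⟩ | ⟨h1, h2, h3⟩ | ⟨h1, h2, h3⟩
    · rw [endAt_of_notMem Γ h1, h2]
    · linarith
    · rw [endAt_of_mem Γ h1, h2, neg_one_mul, neg_neg]
  · refine ⟨1, fun b hb => ?_⟩
    rcases (mem_subbasic_inner Γ b _ ε e r).1 (h b hb) with ⟨h1, h2⟩ | ⟨h1, h2, h3⟩ | ⟨h1, h2, h3⟩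
    · rw [endAt_of_notMem Γ h1, h2]
    · rw [endAt_of_mem Γ h1, h2, one_mul]
    · linarith

theorem exists_inner_mem_basicSet {v : Verts M} {𝓑 : Set (Coc M)}
    (ε : M.E → Ioo (0 : ℝ) 1) {e : M.E} {i : ℤˣ} (h : ∀ b ∈ 𝓑, Γ.endAt i e b = v b) :
    ∃ r, Γ.space.inner e r ∈ Γ.basicSet v 𝓑 ε := by
  have h0 := (ε e).2.1
  have h1 := (ε e).2.2
  rcases Int.units_eq_one_or i with rfl | rfl
  · refine ⟨⟨1 - (ε e : ℝ) / 2, by linarith, by linarith⟩, mem_basicSet.2 fun b hb => ?_⟩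
    refine (mem_subbasic_inner Γ b _ ε e _).2 ?_
    have := h b hb
    by_cases heb : e.1 ∈ b.1
    · rw [endAt_of_mem Γ heb, one_mul] at this
      exact .inr (.inl ⟨heb, this, by simp; linarith⟩)
    · rw [endAt_of_notMem Γ heb] at this
      exact .inl ⟨heb, this⟩
  · refine ⟨⟨(ε e : ℝ) / 2, by linarith, by linarith⟩, mem_basicSet.2 fun b hb => ?_⟩
    refine (mem_subbasic_inner Γ b _ ε e _).2 ?_
    have := h b hb
    by_cases heb : e.1 ∈ b.1
    · rw [endAt_of_mem Γ heb, neg_one_mul, neg_eq_iff_eq_neg] at this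
      exact .inr (.inr ⟨heb, this, by simp; linarith⟩)
    · rw [endAt_of_notMem Γ heb] at this
      exact .inl ⟨heb, this⟩

theorem space_src (e : M.E) : Γ.space.src e = Γ.endAt (-1) e := Γ.srcVert_eq e

theorem space_tgt (e : M.E) : Γ.space.tgt e = Γ.endAt 1 e := Γ.tgtVert_eq e

theorem vert_mem_closure_innerPts {D : Set M.E} {v : Verts M} :
    Γ.space.vert v ∈ closure (Γ.space.innerPts D) ↔ v ∈ Γ.limVerts (Subtype.val '' D) := by
  rw [mem_closure_iff]
  constructor
  · intro h 𝓑 h𝓑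
    obtain ⟨_, hp, ⟨e, he, r, rfl⟩⟩ := h _ (isOpen_basicSet (v := v) h𝓑 (half M))
      (vert_mem_basicSet.2 fun _ _ => rfl)
    obtain ⟨i, hi⟩ := exists_endAt_of_inner_mem_basicSet (fun _ => le_rfl) hp
    exact ⟨e, ⟨e, he, rfl⟩, i, hi⟩
  · intro h U hU hvU
    obtain ⟨𝓑, ε, h𝓑, -, hsub⟩ := exists_basicSet_subset hU hvU
    obtain ⟨_, ⟨e, he, rfl⟩, i, hi⟩ := h 𝓑 h𝓑
    obtain ⟨r, hr⟩ := exists_inner_mem_basicSet ε hi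
    exact ⟨_, hsub hr, e, he, r, rfl⟩

/-- The opposite subbasic sets of `b` with constant `ε = 1 / 2` are disjoint and leave out only
interior points of edges in `b`. -/
theorem eq_of_isPreconnected {H : Set Γ.space.Carrier} (hH : IsPreconnected H) {b : Coc M}
    (hb : ∀ e r, Γ.space.inner e r ∈ H → e.1 ∉ b.1) {v w : Verts M} (hv : Γ.space.vert v ∈ H)
    (hw : Γ.space.vert w ∈ H) : v b = w b := by
  by_contra hvw
  have h := hH _ _ (isOpen_subbasic (Γ := Γ) b (v b) (half M))
    (isOpen_subbasic (Γ := Γ) b (-(v b)) (half M)) ?_ ⟨_, hv, rfl⟩ ⟨_, hw, ?_⟩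
  · obtain ⟨p, -, hp1, hp2⟩ := h
    exact Set.disjoint_left.1 (Γ.disjoint_subbasic b (v b)) hp1 hp2
  · intro p hp
    rcases vert_or_inner p with ⟨u, rfl⟩ | ⟨e, r, rfl⟩
    · exact units_eq_or (u b) (v b)
    · exact (units_eq_or (Γ.σ b.1 e) (v b)).imp
        (inner_mem_subbasic_of_notMem (hb e r hp)).2 (inner_mem_subbasic_of_notMem (hb e r hp)).2
  · exact units_eq_neg_iff_ne.2 (Ne.symm hvw)

/-- A set of vertices is closed if it contains all vertices that agree with elements of the set on
each finite set of cocircuits. -/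
def IsClosedVerts (V' : Set (Verts M)) : Prop :=
  ∀ v, (∀ 𝓑 : Set (Coc M), 𝓑.Finite → ∃ w ∈ V', ∀ b ∈ 𝓑, w b = v b) → v ∈ V'

theorem isClosedVerts_limVerts (D : Set α) : IsClosedVerts (Γ.limVerts D) := by
  intro v hv 𝓑 h𝓑
  obtain ⟨w, hw, hwv⟩ := hv 𝓑 h𝓑
  obtain ⟨e, he, i, hi⟩ := hw 𝓑 h𝓑
  exact ⟨e, he, i, fun b hb => (hi b hb).trans (hwv b hb)⟩

theorem IsClosedVerts.union {V₁ V₂ : Set (Verts M)} (h₁ : IsClosedVerts V₁)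
    (h₂ : IsClosedVerts V₂) : IsClosedVerts (V₁ ∪ V₂) := by
  intro v hv
  by_contra hcon
  rw [Set.mem_union, not_or] at hcon
  obtain ⟨𝓑₁, h𝓑₁, hv₁⟩ : ∃ 𝓑 : Set (Coc M), 𝓑.Finite ∧ ¬ ∃ w ∈ V₁, ∀ b ∈ 𝓑, w b = v b := by
    by_contra! h; exact hcon.1 (h₁ v h)
  obtain ⟨𝓑₂, h𝓑₂, hv₂⟩ : ∃ 𝓑 : Set (Coc M), 𝓑.Finite ∧ ¬ ∃ w ∈ V₂, ∀ b ∈ 𝓑, w b = v b := by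
    by_contra! h; exact hcon.2 (h₂ v h)
  obtain ⟨w, hw | hw, h⟩ := hv _ (h𝓑₁.union h𝓑₂)
  · exact hv₁ ⟨w, hw, fun b hb => h b (.inl hb)⟩
  · exact hv₂ ⟨w, hw, fun b hb => h b (.inr hb)⟩

theorem isClosedVerts_singleton (x : Verts M) : IsClosedVerts {x} := by
  intro v hv
  refine funext fun b => ?_
  obtain ⟨_, rfl, h⟩ := hv {b} (finite_singleton b)
  exact (h b rfl).symm

theorem isClosedVerts_pathVerts {S : Set α} {hS : M.IsBase S} {x z : Verts M} :
    IsClosedVerts (Γ.pathVerts hS x z) :=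
  (isClosedVerts_limVerts _).union
    (insert_eq x {z} ▸ (isClosedVerts_singleton x).union (isClosedVerts_singleton z))

theorem isCompact_range_ι (e : M.E) : IsCompact (range (Γ.space.ι e)) :=
  isCompact_range (continuous_ι e)

/-- An ultrafilter either lives on one edge, which is a compact arc, or avoids every finite set of
edges. In the latter case it ignores the finitely many edges in `b` and chooses a side of `b`, for
every cocircuit `b`; these choices are the coordinates of its limit. -/
theorem isCompact_pts {V' : Set (Verts M)} {D : Set M.E} (hV' : IsClosedVerts V')
    (hD : ∀ e ∈ D, ∀ i, Γ.endAt i e ∈ V') (hfin : ∀ b : Coc M, {e ∈ D | e.1 ∈ b.1}.Finite) :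
    IsCompact (Γ.space.pts V' D) := by
  rw [isCompact_iff_ultrafilter_le_nhds']
  intro 𝓤 h𝓤
  by_cases hedge : ∃ e ∈ D, Γ.space.innerPts {e} ∈ 𝓤
  · obtain ⟨e, he, hmem⟩ := hedge
    have hsub : range (Γ.space.ι e) ⊆ Γ.space.pts V' D := by
      rw [range_ι]
      rintro _ (⟨v, rfl | rfl, rfl⟩ | ⟨f, rfl, r, rfl⟩)
      · rw [vert_mem_pts, space_src]; exact hD e he _
      · rw [vert_mem_pts, space_tgt]; exact hD e he _
      · exact inner_mem_pts.2 he
    obtain ⟨p, hp, hle⟩ := isCompact_iff_ultrafilter_le_nhds'.1 (isCompact_range_ι e) 𝓤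
      (Filter.mem_of_superset hmem (by
        rintro _ ⟨f, rfl, r, rfl⟩; exact inner_mem_range_ι _ r))
    exact ⟨p, hsub hp, hle⟩
  · push Not at hedge
    have hfin' : ∀ F : Set M.E, F.Finite → F ⊆ D → Γ.space.innerPts F ∉ 𝓤 := by
      intro F hF hFD hmem
      have : Γ.space.innerPts F = ⋃ e ∈ F, Γ.space.innerPts {e} := by
        ext p
        simp [innerPts]
      rw [this, Ultrafilter.finite_biUnion_mem_iff hF] at hmem
      obtain ⟨e, he, h⟩ := hmem
      exact hedge e (hFD he) h
    have hval : ∀ b : Coc M, ∃ i : ℤˣ, Γ.space.pts {v ∈ V' | v b = i}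
        {e ∈ D | e.1 ∉ b.1 ∧ Γ.σ b.1 e = i} ∈ 𝓤 := by
      intro b
      have hcov : Γ.space.pts V' D ⊆ Γ.space.pts {v ∈ V' | v b = 1}
          {e ∈ D | e.1 ∉ b.1 ∧ Γ.σ b.1 e = 1} ∪ (Γ.space.pts {v ∈ V' | v b = -1}
          {e ∈ D | e.1 ∉ b.1 ∧ Γ.σ b.1 e = -1} ∪ Γ.space.innerPts {e ∈ D | e.1 ∈ b.1}) := by
        intro p hp
        rcases vert_or_inner p with ⟨u, rfl⟩ | ⟨e, r, rfl⟩
        · rw [vert_mem_pts] at hp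
          rcases Int.units_eq_one_or (u b) with h | h
          · exact .inl (vert_mem_pts.2 ⟨hp, h⟩)
          · exact .inr (.inl (vert_mem_pts.2 ⟨hp, h⟩))
        · rw [inner_mem_pts] at hp
          by_cases heb : e.1 ∈ b.1
          · exact .inr (.inr (inner_mem_innerPts.2 ⟨hp, heb⟩))
          · rcases Int.units_eq_one_or (Γ.σ b.1 e) with h | h
            · exact .inl (inner_mem_pts.2 ⟨hp, heb, h⟩)
            · exact .inr (.inl (inner_mem_pts.2 ⟨hp, heb, h⟩))
      have h := Filter.mem_of_superset h𝓤 hcov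
      rw [Ultrafilter.mem_coe, Ultrafilter.union_mem_iff, Ultrafilter.union_mem_iff] at h
      rcases h with h | h | h
      · exact ⟨1, h⟩
      · exact ⟨-1, h⟩
      · exact absurd h (hfin' _ (hfin b) (Set.sep_subset _ _))
    choose v hv using hval
    refine ⟨Γ.space.vert v, vert_mem_pts.2 (hV' v fun 𝓑 h𝓑 => ?_), ?_⟩
    · have hmem : (⋂ b ∈ 𝓑, Γ.space.pts {w ∈ V' | w b = v b}
          {e ∈ D | e.1 ∉ b.1 ∧ Γ.σ b.1 e = v b}) ∩ Γ.space.pts V' D ∈ 𝓤 :=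
        Filter.inter_mem ((Filter.biInter_mem h𝓑).2 fun b _ => hv b) h𝓤
      obtain ⟨p, hp, hp'⟩ := 𝓤.nonempty_of_mem hmem
      rw [mem_iInter₂] at hp
      rcases vert_or_inner p with ⟨u, rfl⟩ | ⟨e, r, rfl⟩
      · exact ⟨u, vert_mem_pts.1 hp', fun b hb => (vert_mem_pts.1 (hp b hb)).2⟩
      · refine ⟨Γ.endAt 1 e, hD e (inner_mem_pts.1 hp') 1, fun b hb => ?_⟩
        obtain ⟨-, h1, h2⟩ := inner_mem_pts.1 (hp b hb)
        rw [endAt_of_notMem Γ h1, h2]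
    · intro U hU
      obtain ⟨U', hU'U, hU', hvU'⟩ := mem_nhds_iff.1 hU
      obtain ⟨𝓑, ε, h𝓑, -, hsub⟩ := exists_basicSet_subset hU' hvU'
      refine Filter.mem_of_superset ((Filter.biInter_mem h𝓑).2 fun b _ => hv b)
        (fun p hp => hU'U (hsub (mem_basicSet.2 fun b hb => ?_)))
      rw [mem_iInter₂] at hp
      have hpb := hp b hb
      rcases vert_or_inner p with ⟨u, rfl⟩ | ⟨e, r, rfl⟩
      · exact (vert_mem_pts.1 hpb).2
      · obtain ⟨-, h1, h2⟩ := inner_mem_pts.1 hpb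
        exact (inner_mem_subbasic_of_notMem h1).2 h2

/-- Membership of a vertex of `V'` in one of two open sets that partition `V'` is determined by
finitely many cocircuits. -/
theorem exists_finite_of_isOpen {V' : Set (Verts M)} (hV' : IsClosedVerts V')
    {U W : Set Γ.space.Carrier} (hU : IsOpen U) (hW : IsOpen W)
    (hcov : ∀ v ∈ V', Γ.space.vert v ∈ U ∪ W)
    (hdis : ∀ v ∈ V', Γ.space.vert v ∈ U → Γ.space.vert v ∉ W) :
    ∃ 𝓑 : Set (Coc M), 𝓑.Finite ∧ ∀ v ∈ V', ∀ w ∈ V', (∀ b ∈ 𝓑, v b = w b) →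
      Γ.space.vert v ∈ U → Γ.space.vert w ∈ U := by
  have hcomp := isCompact_pts (Γ := Γ) (D := ∅) hV' (by simp) (by simp)
  have key := hcomp.induction_on (p := fun s => ∃ 𝓑 : Set (Coc M), 𝓑.Finite ∧ ∀ v ∈ V',
    Γ.space.vert v ∈ s → ∀ w ∈ V', (∀ b ∈ 𝓑, v b = w b) →
      Γ.space.vert v ∈ U → Γ.space.vert w ∈ U) ?_ ?_ ?_ ?_
  · obtain ⟨𝓑, h𝓑, h⟩ := key
    exact ⟨𝓑, h𝓑, fun v hv w hw => h v hv (vert_mem_pts.2 hv) w hw⟩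
  · exact ⟨∅, finite_empty, fun v _ h => absurd h (by simp)⟩
  · rintro s t hst ⟨𝓑, h𝓑, h⟩
    exact ⟨𝓑, h𝓑, fun v hv hvs => h v hv (hst hvs)⟩
  · rintro s t ⟨𝓑₁, h𝓑₁, h1⟩ ⟨𝓑₂, h𝓑₂, h2⟩
    refine ⟨𝓑₁ ∪ 𝓑₂, h𝓑₁.union h𝓑₂, fun v hv hvst w hw hag => ?_⟩
    rcases hvst with hvs | hvt
    · exact h1 v hv hvs w hw fun b hb => hag b (.inl hb)
    · exact h2 v hv hvt w hw fun b hb => hag b (.inr hb)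
  · intro p hp
    rcases vert_or_inner p with ⟨v₀, rfl⟩ | ⟨e, r, rfl⟩
    · rw [vert_mem_pts] at hp
      rcases hcov v₀ hp with h | h
      · obtain ⟨𝓑, ε, h𝓑, -, hsub⟩ := exists_basicSet_subset hU h
        refine ⟨Γ.basicSet v₀ 𝓑 ε, mem_nhdsWithin_of_mem_nhds
          ((isOpen_basicSet h𝓑 ε).mem_nhds (vert_mem_basicSet.2 fun _ _ => rfl)), 𝓑, h𝓑, ?_⟩
        intro v _ hv w _ hvw _
        exact hsub (vert_mem_basicSet.2 fun b hb =>
          (hvw b hb).symm.trans (vert_mem_basicSet.1 hv b hb))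
      · exact ⟨W, mem_nhdsWithin_of_mem_nhds (hW.mem_nhds h), ∅, finite_empty,
          fun v hv hvW w _ _ hvU => absurd hvW (hdis v hv hvU)⟩
    · simp at hp

/-- Any set of vertices determined by finitely many cocircuits and not separating the endvertices
of any edge in `D` contains all or none of `V'`. -/
def IsChainConnected (Γ : GraphFramework M) (V' : Set (Verts M)) (D : Set M.E) : Prop :=
  ∀ (𝓑 : Set (Coc M)) (T : Set (Verts M)), 𝓑.Finite →
    (∀ v w : Verts M, (∀ b ∈ 𝓑, v b = w b) → v ∈ T → w ∈ T) →
    (∀ e ∈ D, (Γ.endAt 1 e.1 ∈ T ↔ Γ.endAt (-1) e.1 ∈ T)) → ∀ v ∈ V', ∀ w ∈ V', v ∈ T → w ∈ T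

theorem IsChainConnected.isPreconnected {V' : Set (Verts M)} {D : Set M.E}
    (h : Γ.IsChainConnected V' D) (hV' : IsClosedVerts V') (hD : ∀ e ∈ D, ∀ i, Γ.endAt i e ∈ V') :
    IsPreconnected (Γ.space.pts V' D) := by
  rw [isPreconnected_iff_subset_of_disjoint]
  intro U W hU hW hcov hdis
  have hdis' : ∀ p ∈ Γ.space.pts V' D, p ∈ U → p ∉ W := fun p hp hpU hpW =>
    Set.notMem_empty p (hdis ▸ ⟨hp, hpU, hpW⟩)
  have hedge : ∀ e ∈ D, range (Γ.space.ι e) ⊆ Γ.space.pts V' D := by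
    intro e he
    rw [range_ι]
    rintro _ (⟨v, rfl | rfl, rfl⟩ | ⟨f, rfl, r, rfl⟩)
    · rw [vert_mem_pts, space_src]; exact hD e he _
    · rw [vert_mem_pts, space_tgt]; exact hD e he _
    · exact inner_mem_pts.2 he
  have hedge' : ∀ e ∈ D, range (Γ.space.ι e) ⊆ U ∨ range (Γ.space.ι e) ⊆ W := by
    intro e he
    refine isPreconnected_iff_subset_of_disjoint.1 (isPreconnected_range_ι e) U W hU hW
      ((hedge e he).trans hcov) ?_
    rw [← Set.subset_empty_iff, ← hdis]
    exact inter_subset_inter_left _ (hedge e he)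
  obtain ⟨𝓑, h𝓑, hfin⟩ := exists_finite_of_isOpen hV' hU hW
    (fun v hv => hcov (vert_mem_pts.2 hv)) fun v hv => hdis' _ (vert_mem_pts.2 hv)
  have hend : ∀ e i, Γ.space.vert (Γ.endAt i e) ∈ range (Γ.space.ι e) := by
    intro e i
    rw [range_ι, vert_mem_pts, space_src, space_tgt]
    rcases Int.units_eq_one_or i with rfl | rfl <;> simp
  -- `T` saturates `U` with respect to the finite set `𝓑`; by the choice of `𝓑` this adds no vertex
  -- of `V'`.
  set T : Set (Verts M) := {u | ∃ v ∈ V', Γ.space.vert v ∈ U ∧ ∀ b ∈ 𝓑, v b = u b} with hT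
  have hTV : ∀ v ∈ V', (v ∈ T ↔ Γ.space.vert v ∈ U) := fun v hv =>
    ⟨fun ⟨w, hw, hwU, hwv⟩ => hfin w hw v hv hwv hwU, fun h => ⟨v, hv, h, fun _ _ => rfl⟩⟩
  have hall := h 𝓑 T h𝓑
    (fun v w hvw ⟨u, hu, huU, huv⟩ => ⟨u, hu, huU, fun b hb => (huv b hb).trans (hvw b hb)⟩) (by
      intro e he
      rw [hTV _ (hD e he 1), hTV _ (hD e he (-1))]
      rcases hedge' e he with hs | hs
      · exact iff_of_true (hs (hend e _)) (hs (hend e _))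
      · exact iff_of_false (fun h => hdis' _ (hedge e he (hend e _)) h (hs (hend e _)))
          fun h => hdis' _ (hedge e he (hend e _)) h (hs (hend e _)))
  have hinner : ∀ e ∈ D, ∀ r, ∀ Y : Set Γ.space.Carrier, (range (Γ.space.ι e) ⊆ Y) →
      Γ.space.inner e r ∈ Y := fun e _ r Y hY => hY (inner_mem_range_ι e r)
  by_cases hex : ∃ v ∈ V', Γ.space.vert v ∈ U
  · obtain ⟨v, hv, hvU⟩ := hex
    have hVU : ∀ w ∈ V', Γ.space.vert w ∈ U := fun w hw =>
      (hTV w hw).1 (hall v hv w hw ((hTV v hv).2 hvU))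
    left
    rintro _ (⟨w, hw, rfl⟩ | ⟨e, he, r, rfl⟩)
    · exact hVU w hw
    · refine hinner e he r U ((hedge' e he).resolve_right fun hs => ?_)
      exact hdis' _ (hedge e he (hend e 1)) (hVU _ (hD e he 1)) (hs (hend e 1))
  · push Not at hex
    right
    rintro _ (⟨w, hw, rfl⟩ | ⟨e, he, r, rfl⟩)
    · exact (hcov (vert_mem_pts.2 hw)).resolve_left (hex w hw)
    · refine hinner e he r W ((hedge' e he).resolve_left fun hs => ?_)
      exact hex _ (hD e he 1) (hs (hend e 1))

/-- An edge in no cocircuit cannot be separated from its endvertex, since basic neighbourhoods of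
that vertex contain all of its interior. -/
theorem t2Space (hloop : ∀ e ∈ M.E, ∃ b : Coc M, e ∈ b.1) : T2Space Γ.space.Carrier := by
  have hvi : ∀ v e r, ∃ U W : Set Γ.space.Carrier, IsOpen U ∧ IsOpen W ∧ Γ.space.vert v ∈ U ∧
      Γ.space.inner e r ∈ W ∧ Disjoint U W := by
    intro v e r
    obtain ⟨b, hb⟩ := hloop e e.2
    have h0 := r.2.1
    have h1 := r.2.2
    have hpos : 0 < min (r : ℝ) (1 - r) / 2 := by
      have : 0 < min (r : ℝ) (1 - r) := lt_min h0 (by linarith)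
      linarith
    have hle1 := min_le_left (r : ℝ) (1 - r)
    have hle2 := min_le_right (r : ℝ) (1 - r)
    refine ⟨Γ.subbasic b (v b) fun _ => ⟨min (r : ℝ) (1 - r) / 2, hpos, by linarith⟩,
      Γ.space.inner e '' {s | min (r : ℝ) (1 - r) / 2 < s ∧ (s : ℝ) < 1 - min (r : ℝ) (1 - r) / 2},
      isOpen_subbasic _ _ _, isOpen_inner_image e ?_, rfl,
      ⟨r, ⟨by linarith, by linarith⟩, rfl⟩, ?_⟩
    · exact (isOpen_lt continuous_const continuous_subtype_val).inter
        (isOpen_lt continuous_subtype_val continuous_const)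
    · refine Set.disjoint_left.2 ?_
      rintro _ hs ⟨s, ⟨hs1, hs2⟩, rfl⟩
      rcases (mem_subbasic_inner Γ b _ _ e s).1 hs with ⟨k1, k2⟩ | ⟨k1, k2, k3⟩ | ⟨k1, k2, k3⟩
      · exact k1 hb
      · exact absurd hs2 (not_lt.2 k3.le)
      · exact absurd hs1 (not_lt.2 k3.le)
  constructor
  intro p q hpq
  rcases vert_or_inner p with ⟨v, rfl⟩ | ⟨e, r, rfl⟩ <;>
    rcases vert_or_inner q with ⟨w, rfl⟩ | ⟨f, s, rfl⟩
  · obtain ⟨U, W, hU, hW, hd, -, hv, hw⟩ := Γ.space.exists_separation v w fun h => hpq (h ▸ rfl)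
    exact ⟨U, W, hU, hW, hv, hw, hd⟩
  · exact hvi v f s
  · obtain ⟨U, W, hU, hW, h1, h2, hd⟩ := hvi w e r
    exact ⟨W, U, hW, hU, h2, h1, hd.symm⟩
  · by_cases hef : e = f
    · subst hef
      obtain ⟨U, W, hU, hW, hr, hs, hd⟩ := t2_separation (x := r) (y := s) fun h => hpq (h ▸ rfl)
      refine ⟨_, _, isOpen_inner_image e hU, isOpen_inner_image e hW, ⟨r, hr, rfl⟩, ⟨s, hs, rfl⟩, ?_⟩
      rw [Set.disjoint_left]
      rintro _ ⟨t, ht, rfl⟩ ⟨t', ht', h⟩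
      obtain ⟨-, rfl⟩ := inner_inj.1 h
      exact Set.disjoint_left.1 hd ht ht'
    · refine ⟨_, _, isOpen_innerPts {e}, isOpen_innerPts {f}, inner_mem_innerPts.2 rfl,
        inner_mem_innerPts.2 rfl, ?_⟩
      rw [Set.disjoint_left]
      rintro _ ⟨e', he', r, rfl⟩ h
      exact hef ((mem_singleton_iff.1 he').symm.trans (mem_singleton_iff.1 (inner_mem_innerPts.1 h)))

end GraphFramework

/-! ### Subspaces given by vertices and edges -/

namespace GraphLikeSpace

open Set Topology

variable {V E : Type*}

/-- The subspace of a graph-like space with vertex set `V'` and edge set `D`. -/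
def sub (G : GraphLikeSpace V E) (V' : Set V) (D : Set E) (hs : ∀ e ∈ D, G.src e ∈ V')
    (ht : ∀ e ∈ D, G.tgt e ∈ V') : GraphLikeSpace V' D where
  top := G.top.induced (ptMap Subtype.val fun e => .inl (e.1, true))
  src e := ⟨G.src e, hs e e.2⟩
  tgt e := ⟨G.tgt e, ht e e.2⟩
  continuous_edgeMap e := by
    rw [continuous_induced_rng]
    convert! G.continuous_edgeMap e using 1
    funext x
    simp only [Function.comp, Pt.edgeMap]
    split_ifs <;> rfl
  isOpenMap_inner e := by
    intro O hO
    refine ⟨_, G.isOpenMap_inner e O hO, ?_⟩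
    ext p
    cases p with
    | vert x => simp [ptMap]
    | inner f r => simp [ptMap, Subtype.ext_iff]
  exists_separation x y hxy := by
    obtain ⟨U, W, hU, hW, hd, hc, hx, hy⟩ :=
      G.exists_separation x y (fun h => hxy (Subtype.ext h))
    exact ⟨_, _, ⟨U, hU, rfl⟩, ⟨W, hW, rfl⟩, hd.preimage _, fun z => hc z, hx, hy⟩

theorem Map.continuous {V V' E E' : Type*} {G : GraphLikeSpace V E} {H : GraphLikeSpace V' E'}
    (φ : Map G H) : Continuous φ.toFun := φ.continuous_ptMap

variable {G : GraphLikeSpace V E} {V' : Set V} {D : Set E} {hs : ∀ e ∈ D, G.src e ∈ V'}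
  {ht : ∀ e ∈ D, G.tgt e ∈ V'}

/-- The inclusion of a subspace. -/
def sub.incl (G : GraphLikeSpace V E) (V' : Set V) (D : Set E) (hs : ∀ e ∈ D, G.src e ∈ V')
    (ht : ∀ e ∈ D, G.tgt e ∈ V') : Map (G.sub V' D hs ht) G where
  onVerts := Subtype.val
  onEdges e := .inl (e.1, true)
  continuous_ptMap := continuous_induced_dom

@[simp] theorem sub.incl_vert (v : V') : (sub.incl G V' D hs ht).toFun
    ((G.sub V' D hs ht).vert v) = G.vert v := rfl

@[simp] theorem sub.incl_inner (e : D) (r) : (sub.incl G V' D hs ht).toFun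
    ((G.sub V' D hs ht).inner e r) = G.inner e r := rfl

theorem sub.injective_incl : Function.Injective (sub.incl G V' D hs ht).toFun := by
  intro p q h
  rcases vert_or_inner p with ⟨v, rfl⟩ | ⟨e, r, rfl⟩ <;>
    rcases vert_or_inner q with ⟨w, rfl⟩ | ⟨f, s, rfl⟩
  · exact congrArg _ (Subtype.ext (vert_injective h))
  · exact absurd h vert_ne_inner
  · exact absurd h.symm vert_ne_inner
  · obtain ⟨h1, rfl⟩ := inner_inj.1 h
    rw [Subtype.ext h1]

theorem sub.isEmbedding_incl : IsEmbedding (sub.incl G V' D hs ht).toFun :=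
  ⟨⟨rfl⟩, sub.injective_incl⟩

theorem sub.range_incl : range (sub.incl G V' D hs ht).toFun = G.pts V' D := by
  ext p
  constructor
  · rintro ⟨q, rfl⟩
    rcases vert_or_inner q with ⟨v, rfl⟩ | ⟨e, r, rfl⟩
    · rw [sub.incl_vert, vert_mem_pts]; exact v.2
    · rw [sub.incl_inner, inner_mem_pts]; exact e.2
  · rintro (⟨v, hv, rfl⟩ | ⟨e, he, r, rfl⟩)
    · exact ⟨(G.sub V' D hs ht).vert ⟨v, hv⟩, rfl⟩
    · exact ⟨(G.sub V' D hs ht).inner ⟨e, he⟩ r, rfl⟩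

theorem vert_mem_removeEdges {R : Set E} {v : V} : G.vert v ∈ G.removeEdges R :=
  vert_notMem_innerPts

theorem inner_mem_removeEdges {R : Set E} {e : E} {r} : G.inner e r ∈ G.removeEdges R ↔ e ∉ R :=
  not_congr inner_mem_innerPts

theorem sub.image_incl_removeEdges (R : Set D) :
    (sub.incl G V' D hs ht).toFun '' (G.sub V' D hs ht).removeEdges R =
      G.pts V' (D \ Subtype.val '' R) := by
  ext p
  constructor
  · rintro ⟨q, hq, rfl⟩
    rcases vert_or_inner q with ⟨v, rfl⟩ | ⟨e, r, rfl⟩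
    · rw [sub.incl_vert, vert_mem_pts]; exact v.2
    · rw [sub.incl_inner, inner_mem_pts]
      refine ⟨e.2, ?_⟩
      rintro ⟨f, hf, hfe⟩
      exact inner_mem_removeEdges.1 hq (Subtype.ext hfe ▸ hf)
  · rintro (⟨v, hv, rfl⟩ | ⟨e, ⟨he, heR⟩, r, rfl⟩)
    · exact ⟨(G.sub V' D hs ht).vert ⟨v, hv⟩, vert_mem_removeEdges, rfl⟩
    · exact ⟨(G.sub V' D hs ht).inner ⟨e, he⟩ r,
        inner_mem_removeEdges.2 fun h => heR ⟨_, h, rfl⟩, rfl⟩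

theorem sub.compactSpace (h : IsCompact (G.pts V' D)) : CompactSpace (G.sub V' D hs ht).Carrier := by
  rw [← isCompact_univ_iff, (sub.isEmbedding_incl (G := G) (hs := hs) (ht := ht)).isCompact_iff,
    image_univ, sub.range_incl]
  exact h

theorem sub.connectedSpace (h : IsPreconnected (G.pts V' D)) (hne : V'.Nonempty) :
    ConnectedSpace (G.sub V' D hs ht).Carrier := by
  have : PreconnectedSpace (G.sub V' D hs ht).Carrier := by
    refine ⟨(sub.isEmbedding_incl (G := G) (hs := hs) (ht := ht)).isInducing.isPreconnected_image.1 ?_⟩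
    rwa [image_univ, sub.range_incl]
  obtain ⟨v, hv⟩ := hne
  exact { toNonempty := ⟨(G.sub V' D hs ht).vert ⟨v, hv⟩⟩ }

theorem sub.isPreconnected_removeEdges_iff (R : Set D) :
    IsPreconnected ((G.sub V' D hs ht).removeEdges R) ↔
      IsPreconnected (G.pts V' (D \ Subtype.val '' R)) := by
  rw [← sub.image_incl_removeEdges (hs := hs) (ht := ht)]
  exact (sub.isEmbedding_incl.isInducing.isPreconnected_image).symm

theorem sub.not_separatedByRemoving {R : Set D} {x y : V'}
    (h : ¬ (G.sub V' D hs ht).SeparatedByRemoving R x y) :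
    ∃ H ⊆ G.pts V' (D \ Subtype.val '' R), IsPreconnected H ∧ G.vert x ∈ H ∧ G.vert y ∈ H := by
  have h' := not_not.1 h
  refine ⟨_, ?_, (isPreconnected_connectedComponentIn (x := (G.sub V' D hs ht).vert x)
    (F := (G.sub V' D hs ht).removeEdges R)).image _
      (sub.incl G V' D hs ht).continuous.continuousOn,
    mem_image_of_mem _ (mem_connectedComponentIn vert_mem_removeEdges), mem_image_of_mem _ h'⟩
  rw [← sub.image_incl_removeEdges (hs := hs) (ht := ht)]
  exact image_mono (connectedComponentIn_subset _ _)

/-- The inclusion of a subspace all of whose vertices lie on edges or pseudo-circles. -/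
def sub.inclHat (G : GraphLikeSpace V E) (V' : Set V) (D : Set E) (hs : ∀ e ∈ D, G.src e ∈ V')
    (ht : ∀ e ∈ D, G.tgt e ∈ V') (hV' : V' ⊆ G.hatVerts) : Map (G.sub V' D hs ht) G.hat where
  onVerts v := ⟨v.1, hV' v.2⟩
  onEdges e := .inl (e.1, true)
  continuous_ptMap := by
    refine (@continuous_induced_rng _ _ _ _ _ G.top (G.sub V' D hs ht).top).2 ?_
    convert! (sub.incl G V' D hs ht).continuous_ptMap using 1
    funext p
    cases p <;> rfl

theorem sub.injective_inclHat (hV' : V' ⊆ G.hatVerts) :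
    Function.Injective (sub.inclHat G V' D hs ht hV').toFun := by
  intro p q h
  rcases vert_or_inner p with ⟨v, rfl⟩ | ⟨e, r, rfl⟩ <;>
    rcases vert_or_inner q with ⟨w, rfl⟩ | ⟨f, s, rfl⟩
  · cases v; cases w; cases h; rfl
  · cases h
  · cases h
  · cases e; cases f; cases h; rfl

theorem sub.range_inclHat (hV' : V' ⊆ G.hatVerts) :
    range (sub.inclHat G V' D hs ht hV').toFun = G.hat.pts (Subtype.val ⁻¹' V') D := by
  ext p
  constructor
  · rintro ⟨q, rfl⟩
    rcases vert_or_inner q with ⟨v, rfl⟩ | ⟨e, r, rfl⟩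
    · exact .inl ⟨⟨v.1, hV' v.2⟩, v.2, rfl⟩
    · exact .inr ⟨e, e.2, r, rfl⟩
  · rintro (⟨v, hv, rfl⟩ | ⟨e, he, r, rfl⟩)
    · exact ⟨(G.sub V' D hs ht).vert ⟨v.1, hv⟩, rfl⟩
    · exact ⟨(G.sub V' D hs ht).inner ⟨e, he⟩ r, rfl⟩

end GraphLikeSpace

/-! ### Closures of circuits are pseudo-circles; paths in a base are pseudo-lines -/

namespace GraphFramework

open Set GraphLikeSpace

variable {α : Type u} {M : Matroid α} {Γ : GraphFramework M}

theorem IsChainConnected.mono {V' : Set (Verts M)} {D D' : Set M.E} (h : Γ.IsChainConnected V' D)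
    (hD : D ⊆ D') : Γ.IsChainConnected V' D' :=
  fun 𝓑 T h𝓑 hag hT => h 𝓑 T h𝓑 hag fun e he => hT e (hD he)

theorem isChainConnected_limVerts (htame : IsTame M) {o : Set α} (ho : M.IsCircuit o) {e : α}
    (he : e ∈ o) : Γ.IsChainConnected (Γ.limVerts o) {f | f.1 ∈ o ∧ f.1 ≠ e} := by
  intro 𝓑 T h𝓑 hag hT v hv w hw hvT
  have key := fun f (hf : f ∈ o) i => Γ.endAt_mem_iff_of_isCircuit htame ho he h𝓑 hag
    (fun f hf hfe => hT ⟨f, ho.subset_ground hf⟩ ⟨hf, hfe⟩) hf i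
  obtain ⟨f, hf, i, hi⟩ := hv 𝓑 h𝓑
  obtain ⟨g, hg, j, hj⟩ := hw 𝓑 h𝓑
  have h1 := (key f hf i).1 (hag v _ (fun b hb => (hi b hb).symm) hvT)
  exact hag _ w hj ((key g hg j).2 h1)

theorem isChainConnected_pathVerts (hconn : IsConnectedMatroid M) (htame : IsTame M) {S : Set α}
    {hS : M.IsBase S} {x z : Verts M} (hx : Γ.Good x) (hz : Γ.Good z) :
    Γ.IsChainConnected (Γ.pathVerts hS x z) {f | f.1 ∈ pathSet hS x z} := by
  intro 𝓑 T h𝓑 hag hT v hv w hw hvT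
  have hT' : ∀ e ∈ pathSet hS x z, (Γ.endAt 1 e ∈ T ↔ Γ.endAt (-1) e ∈ T) := fun e he =>
    hT ⟨e, pathSet_subset_ground he⟩ he
  by_cases hxT : x ∈ T
  · exact pathVerts_subset hconn htame hx hz h𝓑 hag hT' hxT hw
  · refine absurd hvT (pathVerts_subset (T := Tᶜ) hconn htame hx hz h𝓑 ?_ ?_ hxT hv)
    · exact fun v w h hv hw => hv (hag w v (fun b hb => (h b hb).symm) hw)
    · exact fun e he => not_congr (hT' e he)

/-- The edges of `Γ.space` that lie in `D`. -/
def edges (M : Matroid α) (D : Set α) : Set M.E := Subtype.val ⁻¹' D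

theorem src_mem_limVerts {D : Set α} : ∀ e ∈ edges M D, Γ.space.src e ∈ Γ.limVerts D :=
  fun e he => by rw [space_src]; exact Γ.endAt_mem_limVerts he _

theorem tgt_mem_limVerts {D : Set α} : ∀ e ∈ edges M D, Γ.space.tgt e ∈ Γ.limVerts D :=
  fun e he => by rw [space_tgt]; exact Γ.endAt_mem_limVerts he _

theorem separatedByRemoving_sub {V' : Set (Verts M)} {D : Set M.E} {hs ht} {R : Set D} {x y : V'}
    (b : Coc M) (hb : ∀ e : D, e ∉ R → e.1.1 ∉ b.1) (hxy : x.1 b ≠ y.1 b) :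
    (Γ.space.sub V' D hs ht).SeparatedByRemoving R x y := by
  by_contra hcon
  obtain ⟨H, hH, hpre, hx, hy⟩ := sub.not_separatedByRemoving hcon
  refine hxy (eq_of_isPreconnected hpre (fun e r he => ?_) hx hy)
  obtain ⟨heD, heR⟩ := inner_mem_pts.1 (hH he)
  exact hb ⟨e, heD⟩ fun h => heR ⟨_, h, rfl⟩

theorem finite_edges_inter {D : Set α} {b : Coc M} (h : (D ∩ b.1).Finite) :
    {e ∈ edges M D | e.1 ∈ b.1}.Finite :=
  Set.Finite.of_finite_image (f := Subtype.val) (h.subset (by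
    rintro _ ⟨e, he, rfl⟩; exact he)) Subtype.val_injective.injOn

theorem exists_isBase_of_isCircuit {o : Set α} (ho : M.IsCircuit o) {g : α} (hg : g ∈ o) :
    ∃ S, M.IsBase S ∧ g ∉ S ∧ o \ {g} ⊆ S ∧ M.fundCircuit g S = o := by
  obtain ⟨S, hS, hoS⟩ := (ho.sdiff_singleton_indep hg).exists_isBase_superset
  have hgS : g ∉ S := by
    intro hgS
    refine ho.not_indep (hS.indep.subset fun y hy => ?_)
    by_cases hyg : y = g
    · exact hyg ▸ hgS
    · exact hoS ⟨hy, hyg⟩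
  refine ⟨S, hS, hgS, hoS, (ho.eq_fundCircuit_of_subset hS.indep fun y hy => ?_).symm⟩
  by_cases hyg : y = g
  · exact .inl hyg
  · exact .inr (hoS ⟨hy, hyg⟩)

theorem isPseudoCircle_sub (hconn : IsConnectedMatroid M) (htame : IsTame M) {o : Set α}
    (ho : M.IsCircuit o) :
    (Γ.space.sub (Γ.limVerts o) (edges M o) src_mem_limVerts tgt_mem_limVerts).IsPseudoCircle := by
  obtain ⟨g, hg⟩ := ho.nonempty
  have hends : ∀ e ∈ edges M o, ∀ i, Γ.endAt i e ∈ Γ.limVerts o := fun e he i =>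
    Γ.endAt_mem_limVerts he i
  have hclosed := isClosedVerts_limVerts (Γ := Γ) o
  have hne : (Γ.limVerts o).Nonempty := ⟨_, Γ.endAt_mem_limVerts hg 1⟩
  have hpre : ∀ e ∈ o, ∀ D, {f | f.1 ∈ o ∧ f.1 ≠ e} ⊆ D → D ⊆ edges M o →
      IsPreconnected (Γ.space.pts (Γ.limVerts o) D) := fun e he D h1 h2 =>
    ((isChainConnected_limVerts htame ho he).mono h1).isPreconnected hclosed
      fun f hf => hends f (h2 hf)
  -- the fundamental cocircuit of `f` meets the circuit in `{e, f}` only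
  have hcoc : ∀ (S : Set α) (hS : M.IsBase S) (g : α), g ∈ o → g ∉ S → o \ {g} ⊆ S →
      M.fundCircuit g S = o → ∀ f : S, f.1 ∈ o → g ∈ (coc hS f).1 ∧
        ∀ h ∈ o, h ∈ (coc hS f).1 → h = g ∨ h = f.1 := by
    intro S hS g hg hgS hoS hfun f hfo
    refine ⟨(mem_coc_iff_mem_fundCircuit hS).2 (hfun ▸ hfo), fun h hh hhf => ?_⟩
    by_cases hhg : h = g
    · exact .inl hhg
    · exact .inr (congrArg Subtype.val (eq_of_mem_coc hS (f := ⟨h, hoS ⟨hh, hhg⟩⟩) hhf))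
  refine ⟨?_, ?_, ?_, ?_, ?_, ?_⟩
  · exact sub.compactSpace (isCompact_pts hclosed hends fun b =>
      finite_edges_inter (htame o b.1 ho b.2))
  · exact sub.connectedSpace (hpre g hg _ (fun f hf => hf.1) subset_rfl) hne
  · exact ⟨⟨⟨g, ho.subset_ground hg⟩, hg⟩⟩
  · intro e
    refine ⟨⟨_, vert_mem_removeEdges (v := ⟨_, Γ.endAt_mem_limVerts hg 1⟩)⟩, ?_⟩
    rw [sub.isPreconnected_removeEdges_iff]
    refine hpre e.1.1 e.2 _ (fun f hf => ⟨hf.1, ?_⟩) sdiff_subset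
    rintro ⟨_, rfl, h⟩
    exact hf.2 (congrArg Subtype.val h).symm
  · intro e f hef hcon
    have h := (sub.isPreconnected_removeEdges_iff _).1 hcon.isPreconnected
    -- With `o` without `e` inside the base, the fundamental cocircuit of `f` meets `o` in exactly
    -- `e` and `f` and separates the two ends of `e`.
    obtain ⟨S, hS, heS, hoS, hfun⟩ := exists_isBase_of_isCircuit ho e.2
    have hfe : f.1.1 ≠ e.1.1 := fun h => hef (Subtype.ext (Subtype.ext h.symm))
    have hfS : f.1.1 ∈ S := hoS ⟨f.2, hfe⟩
    obtain ⟨h1, h2⟩ := hcoc S hS e.1 e.2 heS hoS hfun ⟨f.1, hfS⟩ f.2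
    have h3 := eq_of_isPreconnected h (b := coc hS ⟨f.1, hfS⟩) (fun k r hk hkb => ?_)
      (vert_mem_pts.2 (Γ.endAt_mem_limVerts e.2 1)) (vert_mem_pts.2 (Γ.endAt_mem_limVerts e.2 (-1)))
    · rw [endAt_neg_of_mem Γ h1] at h3
      exact units_ne_neg _ h3
    · obtain ⟨hko, hk'⟩ := inner_mem_pts.1 hk
      rcases h2 k hko hkb with h | h
      · exact hk' ⟨e, .inl rfl, Subtype.ext h.symm⟩
      · exact hk' ⟨f, .inr rfl, Subtype.ext h.symm⟩
  · intro x y hxy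
    obtain ⟨b, hb⟩ := Function.ne_iff.1 fun h => hxy (Subtype.ext h)
    obtain ⟨S, hS, hgS, hoS, hfun⟩ := exists_isBase_of_isCircuit ho hg
    have hnice := Good.nice (hS := hS) (b := b) hconn htame (Γ := Γ) (.inr ⟨o, ho, x.2⟩)
      (.inr ⟨o, ho, y.2⟩)
    obtain ⟨e, he⟩ : ∃ e : S, x.1 (coc hS e) ≠ y.1 (coc hS e) := by
      by_contra! hcon
      exact hb (hnice.eq_of_forall fun e _ => hcon e)
    -- Otherwise the fundamental cocircuit of `e` could meet `o` at most in `g`, hence not at all,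
    -- and would not distinguish limits of `o`.
    have heo : e.1 ∈ o := by
      by_contra heo
      have hsub : ∀ h ∈ o, h ∈ (coc hS e).1 → h = g := by
        intro h hh hhe
        by_contra hhg
        have := eq_of_mem_coc hS (f := ⟨h, hoS ⟨hh, hhg⟩⟩) hhe
        exact heo (this ▸ hh)
      have hdis : Disjoint o (coc hS e).1 := by
        rw [Set.disjoint_left]
        intro h hh hhe
        refine ho.inter_isCocircuit_ne_singleton (coc hS e).2 (e := h) ?_
        refine Set.eq_singleton_iff_unique_mem.2 ⟨⟨hh, hhe⟩, fun k hk => ?_⟩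
        rw [hsub k hk.1 hk.2, hsub h hh hhe]
      exact he ((Γ.eq_of_mem_limVerts_of_disjoint htame ho hdis x.2 hg).trans
        (Γ.eq_of_mem_limVerts_of_disjoint htame ho hdis y.2 hg).symm)
    obtain ⟨-, h2⟩ := hcoc S hS g hg hgS hoS hfun e heo
    refine ⟨⟨⟨g, ho.subset_ground hg⟩, hg⟩, ⟨⟨e, ho.subset_ground heo⟩, heo⟩, ?_,
      separatedByRemoving_sub (coc hS e) (fun k hk hkb => ?_) he⟩
    · intro h
      have : g = e.1 := congrArg (fun p => p.1.1) h
      exact hgS (this ▸ e.2)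
    · rcases h2 k.1 k.2 hkb with h | h
      · exact hk (.inl (Subtype.ext (Subtype.ext h)))
      · exact hk (.inr (Subtype.ext (Subtype.ext h)))

theorem Good.mem_hatVerts (hconn : IsConnectedMatroid M) (htame : IsTame M) {v : Verts M}
    (h : Γ.Good v) : v ∈ Γ.space.hatVerts := by
  rcases h with ⟨e, he, i, rfl⟩ | ⟨o, ho, hv⟩
  · refine .inl ⟨⟨e, he⟩, ?_⟩
    rw [space_src, space_tgt]
    rcases Int.units_eq_one_or i with rfl | rfl
    · exact .inr rfl
    · exact .inl rfl
  · refine .inr ⟨_, ⟨_, _, _, sub.incl _ _ _ _ _, isPseudoCircle_sub hconn htame ho,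
      sub.injective_incl, rfl⟩, ?_⟩
    rw [sub.range_incl, vert_mem_pts]
    exact hv

theorem src_mem_pathVerts {S : Set α} {hS : M.IsBase S} {x z : Verts M} :
    ∀ e ∈ edges M (pathSet hS x z), Γ.space.src e ∈ Γ.pathVerts hS x z :=
  fun e he => .inl (src_mem_limVerts e he)

theorem tgt_mem_pathVerts {S : Set α} {hS : M.IsBase S} {x z : Verts M} :
    ∀ e ∈ edges M (pathSet hS x z), Γ.space.tgt e ∈ Γ.pathVerts hS x z :=
  fun e he => .inl (tgt_mem_limVerts e he)

theorem isPseudoLine_sub (hconn : IsConnectedMatroid M) (htame : IsTame M) {S : Set α}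
    {hS : M.IsBase S} {x z : Verts M} (hx : Γ.Good x) (hz : Γ.Good z) :
    (Γ.space.sub (Γ.pathVerts hS x z) (edges M (pathSet hS x z)) src_mem_pathVerts
      tgt_mem_pathVerts).IsPseudoLine ⟨x, left_mem_pathVerts⟩ ⟨z, right_mem_pathVerts⟩ := by
  have hends : ∀ e ∈ edges M (pathSet hS x z), ∀ i, Γ.endAt i e ∈ Γ.pathVerts hS x z :=
    fun e he i => .inl (Γ.endAt_mem_limVerts he i)
  have hcoc : ∀ e : S, ∀ k ∈ edges M (pathSet hS x z), k.1 ∈ (coc hS e).1 → k.1 = e.1 := by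
    rintro e k ⟨f, -, hf⟩ hk
    rw [← hf] at hk ⊢
    rw [eq_of_mem_coc hS hk]
  refine ⟨?_, ?_, ?_, ?_⟩
  · exact sub.compactSpace (isCompact_pts isClosedVerts_pathVerts hends fun b =>
      finite_edges_inter (finite_pathSet_inter hconn htame hx hz b))
  · exact sub.connectedSpace ((isChainConnected_pathVerts hconn htame hx hz).isPreconnected
      isClosedVerts_pathVerts hends) ⟨x, left_mem_pathVerts⟩
  · rintro ⟨e, f, hf, hfe⟩
    refine separatedByRemoving_sub (coc hS f) (fun k hk hkb => hk ?_) hf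
    exact Subtype.ext (Subtype.ext ((hcoc f k k.2 hkb).trans hfe))
  · intro v w hvw
    obtain ⟨b, hb⟩ := Function.ne_iff.1 fun h => hvw (Subtype.ext h)
    obtain ⟨f, hf, hfvw⟩ : ∃ f ∈ pathEdges hS x z, v.1 (coc hS f) ≠ w.1 (coc hS f) := by
      by_contra! hcon
      exact hb (eq_of_forall_pathEdges hconn htame hx hz v.2 w.2 fun e he _ => hcon e he)
    refine ⟨⟨⟨f, hS.subset_ground f.2⟩, ⟨f, hf, rfl⟩⟩,
      separatedByRemoving_sub (coc hS f) (fun k hk hkb => hk ?_) hfvw⟩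
    exact Subtype.ext (Subtype.ext (hcoc f k k.2 hkb))

theorem good_of_mem_pathVerts (hconn : IsConnectedMatroid M) (htame : IsTame M) {S : Set α}
    {hS : M.IsBase S} {x y z : Verts M} (hx : Γ.Good x) (hz : Γ.Good z)
    (hy : y ∈ Γ.pathVerts hS x z) : Γ.Good y := by
  rcases hy with hy | rfl | rfl
  · exact good_of_mem_limVerts_pathSet hconn htame hx hz hy
  · exact hx
  · exact hz

/-- Any two vertices of `Γ.space.hat` are joined by a pseudo-arc all of whose edges lie in a given
base. -/
theorem isPseudoArc_hat (hconn : IsConnectedMatroid M) (htame : IsTame M) {S : Set α}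
    (hS : M.IsBase S) {x z : Γ.space.hatVerts} (hx : Γ.Good x.1) (hz : Γ.Good z.1) :
    Γ.space.hat.IsPseudoArc (Γ.space.hat.pts (Subtype.val ⁻¹' Γ.pathVerts hS x.1 z.1)
      (edges M (pathSet hS x.1 z.1))) x z :=
  ⟨_, _, _, _, _, sub.inclHat _ _ _ _ _ fun _ hy =>
      (good_of_mem_pathVerts hconn htame hx hz hy).mem_hatVerts hconn htame,
    isPseudoLine_sub hconn htame hx hz, sub.injective_inclHat _, rfl, rfl,
    (sub.range_inclHat _).symm⟩

end GraphFramework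

/-! ### Injective maps of graph-like spaces -/

namespace GraphLikeSpace

open Set Topology

variable {V E V₀ E₀ : Type*} {G : GraphLikeSpace V E} {C : GraphLikeSpace V₀ E₀}

theorem Map.toFun_vert (φ : Map C G) (v : V₀) : φ.toFun (C.vert v) = G.vert (φ.onVerts v) := rfl

theorem Map.toFun_inner_of_inr (φ : Map C G) {e : E₀} {v : V} (h : φ.onEdges e = .inr v) (r) :
    φ.toFun (C.inner e r) = G.vert v := by
  change ptMap φ.onVerts φ.onEdges (Pt.inner e r) = _
  simp only [ptMap, h]
  rfl

theorem Map.exists_edge (φ : Map C G) (hφ : Function.Injective φ.toFun) (e : E₀) :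
    ∃ f : E, (∀ r, ∃ r', φ.toFun (C.inner e r) = G.inner f r') ∧
      ∀ r, ∃ r', φ.toFun (C.inner e r') = G.inner f r := by
  rcases h : φ.onEdges e with ⟨f, _ | _⟩ | v
  · have key : ∀ r : Ioo (0 : ℝ) 1, φ.toFun (C.inner e r) =
        G.inner f ⟨1 - (r : ℝ), by linarith [r.2.2], by linarith [r.2.1]⟩ := by
      intro r
      change ptMap φ.onVerts φ.onEdges (Pt.inner e r) = _
      simp only [ptMap, h]
      rfl
    refine ⟨f, fun r => ⟨_, key r⟩, fun r =>
      ⟨⟨1 - (r : ℝ), by linarith [r.2.2], by linarith [r.2.1]⟩, (key _).trans ?_⟩⟩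
    exact congrArg (G.inner f) (Subtype.ext (sub_sub_cancel _ _))
  · have key : ∀ r : Ioo (0 : ℝ) 1, φ.toFun (C.inner e r) = G.inner f r := by
      intro r
      change ptMap φ.onVerts φ.onEdges (Pt.inner e r) = _
      simp only [ptMap, h]
      rfl
    exact ⟨f, fun r => ⟨_, key r⟩, fun r => ⟨_, key r⟩⟩
  · have h1 := (φ.toFun_inner_of_inr h ⟨1 / 2, by norm_num⟩).trans
      (φ.toFun_inner_of_inr h ⟨1 / 3, by norm_num⟩).symm
    have h2 := congrArg Subtype.val (inner_inj.1 (hφ h1)).2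
    norm_num at h2

/-- The image of a compact graph-like space under an injective map. -/
theorem Map.exists_image_removeEdges (φ : Map C G) (hφ : Function.Injective φ.toFun) :
    ∃ f : E₀ → E, Function.Injective f ∧ ∀ R : Set E₀,
      φ.toFun '' C.removeEdges R = G.pts (range φ.onVerts) (range f \ f '' R) := by
  choose f hf1 hf2 using φ.exists_edge hφ
  have hinj : Function.Injective f := by
    intro e e' h
    obtain ⟨r, hr⟩ := hf2 e ⟨1 / 2, by norm_num⟩
    obtain ⟨s, hs⟩ := hf2 e' ⟨1 / 2, by norm_num⟩
    rw [← h] at hs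
    exact (inner_inj.1 (hφ (hr.trans hs.symm))).1
  refine ⟨f, hinj, fun R => ?_⟩
  ext p
  constructor
  · rintro ⟨q, hq, rfl⟩
    rcases vert_or_inner q with ⟨v, rfl⟩ | ⟨e, r, rfl⟩
    · rw [φ.toFun_vert, vert_mem_pts]; exact ⟨v, rfl⟩
    · obtain ⟨r', hr'⟩ := hf1 e r
      rw [hr', inner_mem_pts]
      refine ⟨⟨e, rfl⟩, ?_⟩
      rintro ⟨e', he', h⟩
      exact inner_mem_removeEdges.1 hq (hinj h ▸ he')
  · rintro (⟨_, ⟨v, rfl⟩, rfl⟩ | ⟨_, ⟨⟨e, rfl⟩, he⟩, r, rfl⟩)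
    · exact ⟨C.vert v, vert_mem_removeEdges, rfl⟩
    · obtain ⟨r', hr'⟩ := hf2 e r
      exact ⟨C.inner e r', inner_mem_removeEdges.2 fun h => he ⟨e, h, rfl⟩, hr'⟩

theorem removeEdges_empty : G.removeEdges ∅ = univ := by
  ext p
  simp [removeEdges, innerPts]

end GraphLikeSpace

/-! ### Vertices of pseudo-circles are limits of circuits -/

namespace GraphFramework

open Set GraphLikeSpace

variable {α : Type u} {M : Matroid α} {Γ : GraphFramework M}

/-- If `D` were independent, it would extend to a base, and the fundamental cocircuit of an element
of `D` would meet `D` in that element alone. -/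
theorem exists_isCircuit_subset {D : Set M.E} (hne : D.Nonempty)
    (h : ∀ b : Coc M, ∀ e ∈ D, e.1 ∈ b.1 → ∃ f ∈ D, f ≠ e ∧ f.1 ∈ b.1) :
    ∃ o, M.IsCircuit o ∧ o ⊆ Subtype.val '' D := by
  by_contra! hcon
  have hDE : Subtype.val '' D ⊆ M.E := by
    rintro _ ⟨e, -, rfl⟩; exact e.2
  have hind : M.Indep (Subtype.val '' D) := by
    by_contra hnot
    obtain ⟨o, ho, hoC⟩ := ((M.not_indep_iff hDE).1 hnot).exists_isCircuit_subset
    exact hcon o hoC ho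
  obtain ⟨S, hS, hDS⟩ := hind.exists_isBase_superset
  obtain ⟨e, he⟩ := hne
  have heS : e.1 ∈ S := hDS ⟨e, he, rfl⟩
  obtain ⟨f, hf, hfe, hfb⟩ := h (coc hS ⟨e, heS⟩) e he (mem_coc_self hS _)
  have heq := eq_of_mem_coc hS (e := ⟨e.1, heS⟩) (f := ⟨f.1, hDS ⟨f, hf, rfl⟩⟩) hfb
  exact hfe (Subtype.ext (Subtype.mk.inj heq))

/-- A basic set around `x` free of points of edges in `D` would split off from the rest of the
connected set. -/
theorem mem_limVerts_of_isPreconnected {V₁ : Set (Verts M)} {D : Set M.E}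
    (hpre : IsPreconnected (Γ.space.pts V₁ D)) (hne : D.Nonempty) {x : Verts M} (hx : x ∈ V₁) :
    x ∈ Γ.limVerts (Subtype.val '' D) := by
  by_contra hcon
  obtain ⟨𝓑, h𝓑, hno⟩ : ∃ 𝓑 : Set (Coc M), 𝓑.Finite ∧
      ∀ e ∈ Subtype.val '' D, ∀ i, ¬ ∀ b ∈ 𝓑, Γ.endAt i e b = x b := by
    by_contra! h
    exact hcon h
  have hinner : ∀ e ∈ D, ∀ r, Γ.space.inner e r ∉ Γ.basicSet x 𝓑 (half M) := by
    intro e he r hr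
    obtain ⟨i, hi⟩ := exists_endAt_of_inner_mem_basicSet (fun _ => le_rfl) hr
    exact hno e ⟨e, he, rfl⟩ i hi
  obtain ⟨e, he⟩ := hne
  have hW : IsOpen (Γ.space.innerPts univ ∪ ⋃ b : Coc M, ⋃ _ : b ∈ 𝓑,
      (Γ.subbasic b (-(x b)) (half M) : Set Γ.space.Carrier)) :=
    (isOpen_innerPts _).union (isOpen_biUnion fun b _ => isOpen_subbasic b _ _)
  have hcov : Γ.space.pts V₁ D ⊆ Γ.basicSet x 𝓑 (half M) ∪ (Γ.space.innerPts univ ∪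
      ⋃ b : Coc M, ⋃ _ : b ∈ 𝓑, (Γ.subbasic b (-(x b)) (half M) : Set Γ.space.Carrier)) := by
    rintro _ (⟨v, hv, rfl⟩ | ⟨f, hf, r, rfl⟩)
    · by_cases h : ∀ b ∈ 𝓑, v b = x b
      · exact .inl (vert_mem_basicSet.2 h)
      · push Not at h
        obtain ⟨b, hb, hvb⟩ := h
        exact .inr (.inr (mem_iUnion₂.2 ⟨b, hb, units_eq_neg_iff_ne.2 hvb⟩))
    · exact .inr (.inl (inner_mem_innerPts.2 (mem_univ f)))
  obtain ⟨p, hp, hp1, hp2⟩ := hpre _ _ (isOpen_basicSet (v := x) h𝓑 (half M)) hW hcov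
    ⟨Γ.space.vert x, vert_mem_pts.2 hx, vert_mem_basicSet.2 fun _ _ => rfl⟩
    ⟨Γ.space.inner e ⟨1 / 2, by norm_num⟩, inner_mem_pts.2 he,
      .inl (inner_mem_innerPts.2 (mem_univ e))⟩
  rcases hp2 with hp2 | hp2
  · obtain ⟨f, -, r, rfl⟩ := hp2
    exact hinner f (inner_mem_pts.1 hp) r hp1
  · obtain ⟨b, hb, hpb⟩ := mem_iUnion₂.1 hp2
    exact Set.disjoint_left.1 (Γ.disjoint_subbasic b (x b)) (mem_basicSet.1 hp1 b hb) hpb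

/-- No cocircuit meets `D` in a single edge, whose deletion would separate its ends; so `D` contains
a circuit `o`. If `g ∈ D` were not on `o`, deleting `g` and then some `p ∈ o` would leave a
connected space, the rest of `o` still joining the ends of `p`. Hence `D` is contained in `o`. -/
theorem exists_isCircuit_of_isPreconnected [T2Space Γ.space.Carrier] (htame : IsTame M)
    {V₁ : Set (Verts M)} {D : Set M.E} (hclosed : IsClosed (Γ.space.pts V₁ D)) (hne : D.Nonempty)
    (hpre : IsPreconnected (Γ.space.pts V₁ D))
    (h1 : ∀ e ∈ D, IsPreconnected (Γ.space.pts V₁ (D \ {e})))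
    (h2 : ∀ e ∈ D, ∀ f ∈ D, e ≠ f → ¬ IsPreconnected (Γ.space.pts V₁ (D \ {e, f}))) :
    ∃ o, M.IsCircuit o ∧ V₁ ⊆ Γ.limVerts o := by
  have hlim : Γ.limVerts (Subtype.val '' D) ⊆ V₁ := by
    intro v hv
    rw [← vert_mem_pts (G := Γ.space) (D := D), ← hclosed.closure_eq]
    exact closure_mono subset_union_right (vert_mem_closure_innerPts.2 hv)
  have hend : ∀ e ∈ D, ∀ i, Γ.endAt i e ∈ V₁ := fun e he i =>
    hlim (Γ.endAt_mem_limVerts (mem_image_of_mem _ he) i)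
  obtain ⟨o, ho, hoD⟩ := exists_isCircuit_subset (M := M) hne fun b e he heb => by
    by_contra! hcon
    have h := eq_of_isPreconnected (h1 e he) (b := b)
      (fun f r hf => hcon f (inner_mem_pts.1 hf).1 (inner_mem_pts.1 hf).2)
      (vert_mem_pts.2 (hend e he 1)) (vert_mem_pts.2 (hend e he (-1)))
    rw [endAt_neg_of_mem Γ heb] at h
    exact units_ne_neg _ h
  suffices hDo : Subtype.val '' D ⊆ o from
    ⟨o, ho, fun x hx => Γ.limVerts_mono hDo (mem_limVerts_of_isPreconnected hpre hne hx)⟩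
  rintro _ ⟨g, hg, rfl⟩
  by_contra hgo
  obtain ⟨_, hp⟩ := ho.nonempty
  obtain ⟨p, hpD, rfl⟩ := hoD hp
  have hgp : g ≠ p := fun h => hgo (h ▸ hp)
  refine h2 g hg p hpD hgp (isPreconnected_iff_subset_of_disjoint.2 fun U W hU hW hcov hdis => ?_)
  set H := Γ.space.pts V₁ (D \ {g, p}) with hH
  set Ko := Γ.space.pts (Γ.limVerts o) {f | f.1 ∈ o ∧ f.1 ≠ p.1} with hKo
  have hKoH : Ko ⊆ H := by
    rintro _ (⟨v, hv, rfl⟩ | ⟨f, hf, r, rfl⟩)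
    · exact vert_mem_pts.2 (hlim (Γ.limVerts_mono hoD hv))
    · obtain ⟨f', hf', hff⟩ := hoD hf.1
      obtain rfl := Subtype.ext hff
      refine inner_mem_pts.2 ⟨hf', ?_⟩
      rintro (rfl | rfl)
      · exact hgo hf.1
      · exact hf.2 rfl
  have hKopre : IsPreconnected Ko :=
    (isChainConnected_limVerts htame ho hp).isPreconnected (isClosedVerts_limVerts o)
      fun f hf i => Γ.endAt_mem_limVerts hf.1 i
  have key : ∀ U W : Set Γ.space.Carrier, IsOpen U → IsOpen W → H ⊆ U ∪ W → H ∩ (U ∩ W) = ∅ →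
      Ko ⊆ U → H ⊆ U ∨ H ⊆ W := by
    intro U W hU hW hcov hdis hKoU
    have hι : IsClosed (range (Γ.space.ι p)) := (isCompact_range_ι p).isClosed
    have hιpts : ∀ q ∈ range (Γ.space.ι p), q ∈ Ko ∨ q ∈ Γ.space.innerPts {p} := by
      intro q hq
      rw [range_ι] at hq
      rcases hq with ⟨v, rfl | rfl, rfl⟩ | hq
      · exact .inl (vert_mem_pts.2 (src_mem_limVerts p hp))
      · exact .inl (vert_mem_pts.2 (tgt_mem_limVerts p hp))
      · exact .inr hq
    have hHp : ∀ q ∈ H, q ∉ Γ.space.innerPts {p} := by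
      rintro q hq ⟨f, rfl, r, rfl⟩
      exact (inner_mem_pts.1 hq).2 (.inr rfl)
    have hcases : ∀ q ∈ Γ.space.pts V₁ (D \ {g}), q ∈ H ∨ q ∈ Γ.space.innerPts {p} := by
      rintro _ (⟨v, hv, rfl⟩ | ⟨f, hf, r, rfl⟩)
      · exact .inl (vert_mem_pts.2 hv)
      · by_cases hfp : f = p
        · exact .inr (inner_mem_innerPts.2 hfp)
        · exact .inl (inner_mem_pts.2 ⟨hf.1, fun h => h.elim hf.2 hfp⟩)
    have hHsub : H ⊆ Γ.space.pts V₁ (D \ {g}) := by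
      rintro _ (⟨v, hv, rfl⟩ | ⟨f, hf, r, rfl⟩)
      · exact vert_mem_pts.2 hv
      · exact inner_mem_pts.2 ⟨hf.1, fun h => hf.2 (.inl h)⟩
    -- Put the edge `p` back on the side of `Ko`, which contains its ends, and remove the closed arc
    -- `p` from the other side: a separation of `H` becomes one of the connected set with only `g`
    -- removed.
    have hcov' : Γ.space.pts V₁ (D \ {g}) ⊆
        (U ∪ Γ.space.innerPts {p}) ∪ (W \ range (Γ.space.ι p)) := by
      intro q hq
      rcases hcases q hq with hqH | hqp
      · by_cases hqU : q ∈ U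
        · exact .inl (.inl hqU)
        · refine .inr ⟨(hcov hqH).resolve_left hqU, fun hqι => ?_⟩
          rcases hιpts q hqι with h | h
          · exact hqU (hKoU h)
          · exact hHp q hqH h
      · exact .inl (.inr hqp)
    have hdis' : Γ.space.pts V₁ (D \ {g}) ∩
        ((U ∪ Γ.space.innerPts {p}) ∩ (W \ range (Γ.space.ι p))) = ∅ := by
      rw [Set.eq_empty_iff_forall_notMem]
      rintro q ⟨hq, hqU | hqp, hqW, hqι⟩
      · rcases hcases q hq with hqH | hqp
        · exact Set.notMem_empty q (hdis ▸ ⟨hqH, hqU, hqW⟩)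
        · obtain ⟨f, rfl, r, rfl⟩ := hqp
          exact hqι (inner_mem_range_ι _ r)
      · obtain ⟨f, rfl, r, rfl⟩ := hqp
        exact hqι (inner_mem_range_ι _ r)
    rcases isPreconnected_iff_subset_of_disjoint.1 (h1 g hg) _ _ (hU.union (isOpen_innerPts _))
      (hW.sdiff hι) hcov' hdis' with h | h
    · exact .inl fun q hq => (h (hHsub hq)).resolve_right (hHp q hq)
    · exact .inr fun q hq => (h (hHsub hq)).1
  have hKodis : Ko ∩ (U ∩ W) = ∅ := by
    rw [← Set.subset_empty_iff, ← hdis]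
    exact inter_subset_inter_left _ hKoH
  rcases isPreconnected_iff_subset_of_disjoint.1 hKopre U W hU hW (hKoH.trans hcov) hKodis with h | h
  · exact key U W hU hW hcov hdis h
  · exact (key W U hW hU (by rwa [union_comm]) (by rwa [inter_comm W U]) h).symm

theorem eq_of_linked_of_isLoop {e f : α} (he : M.IsLoop e) (hef : Linked M e f) : f = e := by
  have hcirc : ∀ o, M.IsCircuit o → e ∈ o → o = {e} := fun o ho heo =>
    ((Matroid.singleton_isCircuit.2 he).eq_of_subset_isCircuit ho (singleton_subset_iff.2 heo)).symm
  have key : ∀ a b, Linked M a b → (a = e ↔ b = e) := by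
    intro a b hab
    induction hab with
    | rel a b h =>
      obtain ⟨o, ho, ha, hb⟩ := h
      constructor
      · rintro rfl
        rw [hcirc o ho ha] at hb
        exact hb
      · rintro rfl
        rw [hcirc o ho hb] at ha
        exact ha
    | refl a => rfl
    | symm a b _ ih => exact ih.symm
    | trans a b c _ _ ih1 ih2 => exact ih1.trans ih2
  exact (key e f hef).1 rfl

theorem good_of_mem_isPseudoCircleIn (hconn : IsConnectedMatroid M) (htame : IsTame M)
    {P : Set Γ.space.Carrier} (hP : Γ.space.IsPseudoCircleIn P) {x : Verts M}
    (hx : Γ.space.vert x ∈ P) : Γ.Good x := by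
  by_cases hloop : ∀ e ∈ M.E, ∃ b : Coc M, e ∈ b.1
  · have := Γ.t2Space hloop
    obtain ⟨V₀, E₀, C, φ, hC, hφ, rfl⟩ := hP
    have := hC.compact
    obtain ⟨f, hf, himg⟩ := φ.exists_image_removeEdges hφ
    have hemb : Topology.IsClosedEmbedding φ.toFun := φ.continuous.isClosedEmbedding hφ
    have hpre : ∀ R : Set E₀, IsPreconnected (C.removeEdges R) ↔
        IsPreconnected (Γ.space.pts (range φ.onVerts) (range f \ f '' R)) := fun R => by
      rw [← himg R, hemb.isInducing.isPreconnected_image]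
    have hrange : range φ.toFun = Γ.space.pts (range φ.onVerts) (range f) := by
      rw [← image_univ, ← removeEdges_empty, himg, image_empty, sdiff_empty]
    have := hC.connected
    obtain ⟨e₀⟩ := hC.nonempty_edges
    obtain ⟨o, ho, hsub⟩ := exists_isCircuit_of_isPreconnected (Γ := Γ) (V₁ := range φ.onVerts)
      (D := range f) htame (hrange ▸ hemb.isClosed_range) ⟨f e₀, e₀, rfl⟩
      (hrange ▸ isPreconnected_range φ.continuous) (by
        rintro _ ⟨e, rfl⟩
        have := (hpre {e}).1 (hC.remove_one e).isPreconnected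
        rwa [image_singleton] at this) (by
        rintro _ ⟨e, rfl⟩ _ ⟨e', rfl⟩ hee hcon
        rw [← image_pair, ← hpre] at hcon
        refine hC.remove_two e e' (fun h => hee (h ▸ rfl)) ⟨⟨C.vert (C.src e), ?_⟩, hcon⟩
        exact vert_mem_removeEdges)
    rw [hrange, vert_mem_pts] at hx
    exact .inr ⟨o, ho, hsub hx⟩
  -- An edge in no cocircuit is a loop. By connectedness it is the only edge, so there are no
  -- cocircuits and only one vertex, the end of the loop.
  · push Not at hloop
    obtain ⟨e, he, hb⟩ := hloop
    have hl : M.IsLoop e := by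
      rw [← Matroid.singleton_dep, ← Matroid.not_indep_iff]
      intro hind
      obtain ⟨S, hS, heS⟩ := hind.exists_isBase_superset
      exact hb (coc hS ⟨e, heS rfl⟩) (mem_coc_self hS _)
    refine .inl ⟨e, he, 1, funext fun b => ?_⟩
    obtain ⟨f, hf⟩ := b.2.nonempty
    have hfe := eq_of_linked_of_isLoop hl
      (linked_of_isConnectedMatroid hconn he (b.2.subset_ground hf))
    exact absurd (hfe ▸ hf) (hb b)

theorem good_of_mem_hatVerts (hconn : IsConnectedMatroid M) (htame : IsTame M) {x : Verts M}
    (hx : x ∈ Γ.space.hatVerts) : Γ.Good x := by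
  rcases hx with ⟨e, rfl | rfl⟩ | ⟨P, hP, hxP⟩
  · exact .inl ⟨e, e.2, -1, space_src e⟩
  · exact .inl ⟨e, e.2, 1, space_tgt e⟩
  · exact good_of_mem_isPseudoCircleIn hconn htame hP hxP

end GraphFramework

/-! ### The hat space, and connectedness from pseudo-arcs -/

namespace GraphLikeSpace

open Set Topology

variable {V E : Type*} {G : GraphLikeSpace V E}

/-- The inclusion of `G.hat` into `G`. -/
def hatIncl (G : GraphLikeSpace V E) : G.hat.Carrier → G.Carrier :=
  ptMap Subtype.val fun e => .inl (e, true)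

@[simp] theorem hatIncl_vert (v : G.hatVerts) : G.hatIncl (G.hat.vert v) = G.vert v.1 := rfl

theorem isInducing_hatIncl : IsInducing G.hatIncl := ⟨rfl⟩

theorem image_hatIncl_pts {V' : Set V} (hV' : V' ⊆ G.hatVerts) (D : Set E) :
    G.hatIncl '' G.hat.pts (Subtype.val ⁻¹' V') D = G.pts V' D := by
  ext p
  constructor
  · rintro ⟨_, ⟨v, hv, rfl⟩ | ⟨e, he, r, rfl⟩, rfl⟩
    · exact vert_mem_pts.2 hv
    · exact inner_mem_pts.2 he
  · rintro (⟨v, hv, rfl⟩ | ⟨e, he, r, rfl⟩)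
    · exact ⟨_, vert_mem_pts (v := ⟨v, hV' hv⟩).2 hv, rfl⟩
    · exact ⟨_, inner_mem_pts.2 he, rfl⟩

theorem image_hatIncl_innerPts (D : Set E) :
    G.hatIncl '' G.hat.innerPts D = G.innerPts D := by
  ext p
  constructor
  · rintro ⟨_, ⟨e, he, r, rfl⟩, rfl⟩
    exact inner_mem_innerPts.2 he
  · rintro ⟨e, he, r, rfl⟩
    exact ⟨_, inner_mem_innerPts.2 he, rfl⟩

theorem inner_mem_stdSubspace {X : Set E} {e : E} {r} :
    G.inner e r ∈ G.stdSubspace X ↔ e ∈ X := by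
  constructor
  · rintro (h | ⟨⟨v, hv⟩, -⟩)
    · exact inner_mem_innerPts.1 h
    · exact absurd hv.symm vert_ne_inner
  · exact fun h => .inl (inner_mem_innerPts.2 h)

theorem vert_mem_stdSubspace {X : Set E} {v : V} :
    G.vert v ∈ G.stdSubspace X ↔ G.vert v ∈ closure (G.innerPts X) := by
  constructor
  · rintro (h | ⟨-, h⟩)
    · exact absurd h vert_notMem_innerPts
    · exact h
  · exact fun h => .inr ⟨⟨v, rfl⟩, h⟩

theorem IsPseudoArc.isPreconnected {P : Set G.Carrier} {x y : V} (h : G.IsPseudoArc P x y) :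
    IsPreconnected P ∧ G.vert x ∈ P ∧ G.vert y ∈ P := by
  obtain ⟨V₀, E₀, L, s, t, φ, hL, -, rfl, rfl, rfl⟩ := h
  have := hL.connected
  exact ⟨isPreconnected_range φ.continuous, ⟨L.vert s, rfl⟩, ⟨L.vert t, rfl⟩⟩

theorem IsPseudoArcConnected.isPreconnected {X : Set E}
    (h : G.IsPseudoArcConnected (G.stdSubspace X)) : IsPreconnected (G.stdSubspace X) := by
  rcases h with ⟨e, -, h⟩ | ⟨hv, he⟩
  · exact h
  have key : ∀ p ∈ G.stdSubspace X, ∃ x, G.vert x ∈ G.stdSubspace X ∧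
      ∃ t ⊆ G.stdSubspace X, p ∈ t ∧ G.vert x ∈ t ∧ IsPreconnected t := by
    intro p hp
    rcases vert_or_inner p with ⟨x, rfl⟩ | ⟨e, r, rfl⟩
    · exact ⟨x, hp, {G.vert x}, singleton_subset_iff.2 hp, rfl, rfl, isPreconnected_singleton⟩
    · obtain ⟨γ, hγ, -, h0, h1, hr⟩ := he e r hp
      have hsub : range γ ⊆ G.stdSubspace X := hr.trans inter_subset_left
      have hmem : ∀ x, γ 1 = G.vert x → ∃ x, G.vert x ∈ G.stdSubspace X ∧
          ∃ t ⊆ G.stdSubspace X, G.inner e r ∈ t ∧ G.vert x ∈ t ∧ IsPreconnected t :=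
        fun x hx => ⟨x, hx ▸ hsub ⟨1, rfl⟩, range γ, hsub, ⟨0, h0⟩, ⟨1, hx⟩,
          isPreconnected_range hγ⟩
      exact h1.elim (hmem _) (hmem _)
  refine isPreconnected_of_forall_pair fun p hp q hq => ?_
  obtain ⟨x, hx, t, htX, hpt, hxt, ht⟩ := key p hp
  obtain ⟨y, hy, t', htX', hqt', hyt', ht'⟩ := key q hq
  obtain ⟨P, hP, hPX⟩ := hv x y hx hy
  obtain ⟨hPc, hxP, hyP⟩ := hP.isPreconnected
  exact ⟨t ∪ P ∪ t', union_subset (union_subset htX hPX) htX', .inl (.inl hpt), .inr hqt',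
    (ht.union _ hxt hxP hPc).union _ (.inr hyP) hyt' ht'⟩

theorem exists_arc_to_src {X : Set E} {e : E} (he : e ∈ X)
    (hsrc : G.vert (G.src e) ∈ G.stdSubspace X) (r : Ioo (0 : ℝ) 1) :
    ∃ γ : unitInterval → G.Carrier,
        Continuous γ ∧ Function.Injective γ ∧ γ 0 = G.inner e r ∧
          (γ 1 = G.vert (G.src e) ∨ γ 1 = G.vert (G.tgt e)) ∧
          range γ ⊆ G.stdSubspace X ∩ range (G.ι e) := by
  have h0 := r.2.1
  have h1 := r.2.2
  -- Runs linearly from `r` down to 0 and never reaches 1, so the arc stays injective even when both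
  -- ends of `e` coincide.
  set g : unitInterval → unitInterval := fun t =>
    ⟨(r : ℝ) * (1 - t), mul_nonneg h0.le (by linarith [t.2.2]), by nlinarith [t.2.1, t.2.2]⟩ with hg
  have hg1 : ∀ t, (g t : ℝ) < 1 := fun t => by
    change (r : ℝ) * (1 - t) < 1
    nlinarith [t.2.1, t.2.2]
  have hgc : Continuous g := by
    refine Continuous.subtype_mk ?_ _
    fun_prop
  have hginj : Function.Injective g := by
    intro s t hst
    have h : (r : ℝ) * (1 - s) = r * (1 - t) := congrArg Subtype.val hst
    have := mul_left_cancel₀ h0.ne' h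
    exact Subtype.ext (by linarith)
  have hcases : ∀ x : unitInterval, (x : ℝ) < 1 → x = 0 ∨ 0 < (x : ℝ) := fun x _ => by
    rcases x.2.1.eq_or_lt with h | h
    · exact .inl (Subtype.ext h.symm)
    · exact .inr h
  refine ⟨G.ι e ∘ g, (continuous_ι e).comp hgc, ?_, ?_, .inl ?_, ?_⟩
  · intro s t hst
    apply hginj
    have hs := hg1 s
    have ht := hg1 t
    change G.ι e (g s) = G.ι e (g t) at hst
    rcases hcases _ hs with hs0 | hs0 <;> rcases hcases _ ht with ht0 | ht0
    · rw [hs0, ht0]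
    · rw [hs0, ι_zero, ι_of_mem e ⟨ht0, ht⟩] at hst
      exact absurd hst vert_ne_inner
    · rw [ht0, ι_zero, ι_of_mem e ⟨hs0, hs⟩] at hst
      exact absurd hst.symm vert_ne_inner
    · rw [ι_of_mem e ⟨hs0, hs⟩, ι_of_mem e ⟨ht0, ht⟩] at hst
      have := congrArg Subtype.val (inner_inj.1 hst).2
      exact Subtype.ext this
  · have hr : (g 0 : ℝ) = r := by simp [hg]
    change G.ι e (g 0) = _
    rw [ι_of_mem e ⟨hr ▸ h0, hg1 0⟩]
    exact congrArg _ (Subtype.ext hr)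
  · have hr : g 1 = 0 := Subtype.ext (by simp [hg])
    change G.ι e (g 1) = _
    rw [hr, ι_zero]
  · rintro _ ⟨t, rfl⟩
    refine ⟨?_, ⟨g t, rfl⟩⟩
    change G.ι e (g t) ∈ _
    rcases hcases _ (hg1 t) with h | h
    · rw [h, ι_zero]; exact hsrc
    · rw [ι_of_mem e ⟨h, hg1 t⟩]; exact inner_mem_stdSubspace.2 he

end GraphLikeSpace

/-! ### Topological cuts and bonds, and pseudo-arcs inside the standard subspace -/

namespace GraphFramework

open Set GraphLikeSpace

variable {α : Type u} {M : Matroid α} {Γ : GraphFramework M}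

theorem hat_vert_mem_stdSubspace {X : Set M.E} {v : Γ.space.hatVerts} :
    Γ.space.hat.vert v ∈ Γ.space.hat.stdSubspace X ↔ v.1 ∈ Γ.limVerts (Subtype.val '' X) := by
  rw [vert_mem_stdSubspace, ← vert_mem_closure_innerPts,
    isInducing_hatIncl.closure_eq_preimage_closure_image, mem_preimage, image_hatIncl_innerPts,
    hatIncl_vert]

/-- Only the vertices in the given open set matter: a small basic set around one of them meets an
edge only if an endvertex of that edge already lies in `U`. This turns a partition of the vertices
into an open cover whose two members overlap exactly in cut edges. -/
theorem isOpen_pts_of_isOpen {U : Set Γ.space.hat.Carrier} (hU : IsOpen U) :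
    IsOpen (Γ.space.hat.pts {v | Γ.space.hat.vert v ∈ U}
      {e | Γ.space.hat.vert (Γ.space.hat.src e) ∈ U ∨ Γ.space.hat.vert (Γ.space.hat.tgt e) ∈ U}) := by
  rw [isOpen_iff_forall_mem_open]
  rintro _ (⟨v, hv, rfl⟩ | ⟨e, he, r, rfl⟩)
  · obtain ⟨U₀, hU₀, rfl⟩ := isInducing_hatIncl.isOpen_iff.1 hU
    obtain ⟨𝓑, ε, h𝓑, hε, hsub⟩ := exists_basicSet_subset hU₀ (v := v.1) hv
    refine ⟨Γ.space.hatIncl ⁻¹' Γ.basicSet v.1 𝓑 ε, ?_,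
      (isOpen_basicSet h𝓑 ε).preimage isInducing_hatIncl.continuous,
      vert_mem_basicSet.2 fun _ _ => rfl⟩
    intro p hp
    rcases vert_or_inner p with ⟨w, rfl⟩ | ⟨e, r, rfl⟩
    · exact vert_mem_pts.2 (hsub hp)
    · rw [inner_mem_pts]
      obtain ⟨i, hi⟩ := exists_endAt_of_inner_mem_basicSet hε hp
      have h := hsub (vert_mem_basicSet.2 hi)
      rcases Int.units_eq_one_or i with rfl | rfl
      · exact .inr (by rw [← space_tgt] at h; exact h)
      · exact .inl (by rw [← space_src] at h; exact h)
  · refine ⟨Γ.space.hat.innerPts {e}, ?_, isOpen_innerPts _, inner_mem_innerPts.2 rfl⟩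
    rintro _ ⟨f, rfl, s, rfl⟩
    exact inner_mem_pts.2 he

/-- A connected set that meets both sides of a topological cut contains an interior point of an
edge of the cut. -/
theorem exists_inner_mem_of_isPreconnected {H U W : Set Γ.space.hat.Carrier}
    (hH : IsPreconnected H) (hUW : Γ.space.hat.IsVertexPartition U W)
    (hmeet : Γ.space.hat.MeetsBothSides H U W) :
    ∃ e r, Γ.space.hat.inner e r ∈ H ∧ e ∈ Γ.space.hat.cut U W := by
  obtain ⟨hU, hW, hdis, hcov⟩ := hUW
  obtain ⟨⟨x, hxH, hxU⟩, ⟨y, hyH, hyW⟩⟩ := hmeet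
  have hc : H ⊆ Γ.space.hat.pts {v | Γ.space.hat.vert v ∈ U}
      {e | Γ.space.hat.vert (Γ.space.hat.src e) ∈ U ∨ Γ.space.hat.vert (Γ.space.hat.tgt e) ∈ U} ∪
      Γ.space.hat.pts {v | Γ.space.hat.vert v ∈ W}
      {e | Γ.space.hat.vert (Γ.space.hat.src e) ∈ W ∨
        Γ.space.hat.vert (Γ.space.hat.tgt e) ∈ W} := by
    intro p _
    rcases vert_or_inner p with ⟨v, rfl⟩ | ⟨e, r, rfl⟩
    · exact (hcov v).imp vert_mem_pts.2 vert_mem_pts.2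
    · exact (hcov (Γ.space.hat.src e)).imp (fun h => inner_mem_pts.2 (.inl h))
        fun h => inner_mem_pts.2 (.inl h)
  obtain ⟨p, hpH, hpU, hpW⟩ := hH _ _ (isOpen_pts_of_isOpen hU) (isOpen_pts_of_isOpen hW) hc
    ⟨_, hxH, vert_mem_pts.2 hxU⟩ ⟨_, hyH, vert_mem_pts.2 hyW⟩
  rcases vert_or_inner p with ⟨v, rfl⟩ | ⟨e, r, rfl⟩
  · rw [vert_mem_pts] at hpU hpW
    exact absurd hpW (Set.disjoint_left.1 hdis hpU)
  · refine ⟨e, r, hpH, ?_⟩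
    rcases inner_mem_pts.1 hpU with h1 | h1 <;> rcases inner_mem_pts.1 hpW with h2 | h2
    · exact absurd h2 (Set.disjoint_left.1 hdis h1)
    · exact .inl ⟨h1, h2⟩
    · exact .inr ⟨h2, h1⟩
    · exact absurd h2 (Set.disjoint_left.1 hdis h1)

/-- The side of a cocircuit in `Γ.space.hat`. -/
def side (Γ : GraphFramework M) (b : Coc M) (i : ℤˣ) : Set Γ.space.hat.Carrier :=
  Γ.space.hatIncl ⁻¹' Γ.subbasic b i (half M)

theorem isTopCutWithSides_side (b : Coc M) (i : ℤˣ) :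
    Γ.space.hat.IsTopCutWithSides (edges M b.1) (Γ.side b i) (Γ.side b (-i)) := by
  refine ⟨⟨(isOpen_subbasic _ _ _).preimage isInducing_hatIncl.continuous,
    (isOpen_subbasic _ _ _).preimage isInducing_hatIncl.continuous,
    (Γ.disjoint_subbasic b i).preimage _, fun v => units_eq_or (v.1 b) i⟩, ?_⟩
  ext e
  have hs : ∀ j, Γ.space.hat.vert (Γ.space.hat.src e) ∈ Γ.side b j ↔ Γ.endAt (-1) e b = j := by
    intro j; rw [← space_src]; exact Iff.rfl
  have ht : ∀ j, Γ.space.hat.vert (Γ.space.hat.tgt e) ∈ Γ.side b j ↔ Γ.endAt 1 e b = j := by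
    intro j; rw [← space_tgt]; exact Iff.rfl
  simp only [cut, mem_ofPred_eq, hs, ht]
  change e.1 ∈ b.1 ↔ _
  by_cases he : e.1 ∈ b.1
  · refine iff_of_true he ?_
    rw [endAt_neg_of_mem Γ he]
    rcases units_eq_or (Γ.endAt 1 e b) i with h | h
    · exact .inr ⟨by rw [h], h⟩
    · exact .inl ⟨by rw [h, neg_neg], h⟩
  · refine iff_of_false he ?_
    rw [Γ.endAt_congr_of_forall_notMem (i := -1) (j := 1) he]
    rintro (⟨h1, h2⟩ | ⟨h1, h2⟩)
    · exact units_ne_neg i (h1.symm.trans h2)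
    · exact units_ne_neg i (h2.symm.trans h1)

theorem isPreconnected_hat_pts (hconn : IsConnectedMatroid M) (htame : IsTame M) {o : Set α}
    (ho : M.IsCircuit o) {e : α} (he : e ∈ o) :
    IsPreconnected (Γ.space.hat.pts (Subtype.val ⁻¹' Γ.limVerts o) {f | f.1 ∈ o ∧ f.1 ≠ e}) := by
  rw [← isInducing_hatIncl.isPreconnected_image, image_hatIncl_pts fun v hv =>
    Good.mem_hatVerts hconn htame (.inr ⟨o, ho, hv⟩)]
  exact (isChainConnected_limVerts htame ho he).isPreconnected (isClosedVerts_limVerts o)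
    fun f hf i => Γ.endAt_mem_limVerts hf.1 i

/-- Any nonempty cut `t` contains a cocircuit: otherwise some circuit meets `t` in a single edge,
although the circuit without that edge is connected and joins both sides. If `t` is inside `b`, this
cocircuit must be `b`. -/
theorem isTopBond_of_isCocircuit (hconn : IsConnectedMatroid M) (htame : IsTame M) (b : Coc M) :
    Γ.space.hat.IsTopBond (edges M b.1) := by
  obtain ⟨g, hg⟩ := b.2.nonempty
  refine ⟨⟨⟨_, _, isTopCutWithSides_side b 1⟩, ⟨⟨g, b.2.subset_ground hg⟩, hg⟩⟩, ?_⟩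
  rintro _ ⟨⟨U, W, hUW, rfl⟩, ⟨e, he⟩⟩ hsub
  set t := Γ.space.hat.cut U W with ht
  have hcl : e.1 ∉ M.closure (M.E \ Subtype.val '' t) := by
    intro hcl
    rw [M.mem_closure_iff_exists_isCircuit fun h => h.2 ⟨e, he, rfl⟩] at hcl
    obtain ⟨C, hCs, hC, heC⟩ := hcl
    have hsrc : Γ.space.hat.vert (Γ.space.hat.src e) ∈ Γ.space.hat.pts
        (Subtype.val ⁻¹' Γ.limVerts C) {f | f.1 ∈ C ∧ f.1 ≠ e.1} :=
      vert_mem_pts.2 (src_mem_limVerts e heC)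
    have htgt : Γ.space.hat.vert (Γ.space.hat.tgt e) ∈ Γ.space.hat.pts
        (Subtype.val ⁻¹' Γ.limVerts C) {f | f.1 ∈ C ∧ f.1 ≠ e.1} :=
      vert_mem_pts.2 (tgt_mem_limVerts e heC)
    obtain ⟨f, r, hf, hft⟩ := exists_inner_mem_of_isPreconnected
      (isPreconnected_hat_pts (Γ := Γ) hconn htame hC heC) hUW (by
        rcases he with ⟨h1, h2⟩ | ⟨h1, h2⟩
        · exact ⟨⟨_, hsrc, h1⟩, ⟨_, htgt, h2⟩⟩
        · exact ⟨⟨_, htgt, h2⟩, ⟨_, hsrc, h1⟩⟩)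
    obtain ⟨hfC, hfe⟩ := inner_mem_pts.1 hf
    rcases hCs hfC with h | h
    · exact hfe h
    · exact h.2 ⟨f, hft, rfl⟩
  obtain ⟨K, hK, heK, hKd⟩ := exists_isCocircuit_of_notMem_closure e.2 hcl
  have hKt : K ⊆ Subtype.val '' t := by
    intro k hk
    by_contra hkt
    exact Set.disjoint_left.1 hKd hk ⟨hK.subset_ground hk, hkt⟩
  have hKb : K ⊆ b.1 := hKt.trans (by rintro _ ⟨f, hf, rfl⟩; exact hsub hf)
  have hKeq : K = b.1 := hK.eq_of_subset_isCircuit b.2 hKb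
  intro f hf
  obtain ⟨f', hf', hff⟩ := hKt (hKeq ▸ hf : f.1 ∈ K)
  exact Subtype.ext hff ▸ hf'

/-- For `e ∈ S` outside `X`, the fundamental cocircuit misses `I`. It then misses `X`, since an
element of `X` in it would close a circuit with `I` that meets it only once. -/
theorem pathSet_subset_of_forall_coc {X S I : Set α} (hS : M.IsBase S) (hI : M.IsBasis I X)
    (hIS : I ⊆ S) {x z : Verts M}
    (h : ∀ e : S, Disjoint (coc hS e).1 X → x (coc hS e) = z (coc hS e)) :
    pathSet hS x z ⊆ X := by
  rintro _ ⟨e, he, rfl⟩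
  by_contra heX
  have heI : e.1 ∉ I := fun h => heX (hI.subset h)
  refine he (h e (Set.disjoint_left.2 fun f hfe hfX => ?_))
  have hcoc : ∀ g ∈ I, g ∉ (coc hS e).1 := by
    intro g hg hge
    have := eq_of_mem_coc hS (f := ⟨g, hIS hg⟩) hge
    exact heI (this ▸ hg)
  have hfI : f ∉ I := fun h => hcoc f h hfe
  have hcl : f ∈ M.closure I := hI.subset_closure hfX
  rw [M.mem_closure_iff_exists_isCircuit hfI] at hcl
  obtain ⟨C, hCs, hC, hfC⟩ := hcl
  refine hC.inter_isCocircuit_ne_singleton (coc hS e).2 (e := f) ?_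
  refine Set.eq_singleton_iff_unique_mem.2 ⟨⟨hfC, hfe⟩, fun g hg => ?_⟩
  exact (hCs hg.1).resolve_right fun h => hcoc g h hg.2

theorem isPseudoArcConnected_of_forall_isTopBond (hconn : IsConnectedMatroid M) (htame : IsTame M)
    {X : Set M.E}
    (h : ∀ (b : Set M.E) (U W : Set Γ.space.hat.Carrier),
        Γ.space.hat.IsTopBond b → Γ.space.hat.IsTopCutWithSides b U W →
        Γ.space.hat.MeetsBothSides (Γ.space.hat.stdSubspace X) U W → (X ∩ b).Nonempty) :
    Γ.space.hat.IsPseudoArcConnected (Γ.space.hat.stdSubspace X) := by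
  refine .inr ⟨fun x y hx hy => ?_, fun e r he => ?_⟩
  · have hXE : Subtype.val '' X ⊆ M.E := by
      rintro _ ⟨e, -, rfl⟩; exact e.2
    -- A base extending a basis of `X` is the choice that keeps the path inside `X`.
    obtain ⟨I, hI⟩ := M.exists_isBasis (Subtype.val '' X)
    obtain ⟨S, hS, hIS⟩ := hI.indep.exists_isBase_superset
    have hsub : pathSet hS x.1 y.1 ⊆ Subtype.val '' X := by
      refine pathSet_subset_of_forall_coc hS hI hIS fun e he => ?_
      by_contra hne
      obtain ⟨f, hfX, hfb⟩ := h _ _ _ (isTopBond_of_isCocircuit hconn htame (coc hS e))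
        (isTopCutWithSides_side (coc hS e) (x.1 (coc hS e)))
        ⟨⟨x, hx, rfl⟩, ⟨y, hy, units_eq_neg_iff_ne.2 (Ne.symm hne)⟩⟩
      exact Set.disjoint_left.1 he hfb ⟨f, hfX, rfl⟩
    refine ⟨_, isPseudoArc_hat hconn htame hS (good_of_mem_hatVerts hconn htame x.2)
      (good_of_mem_hatVerts hconn htame y.2), ?_⟩
    rintro _ (⟨v, hv | hv | hv, rfl⟩ | ⟨e, he, r, rfl⟩)
    · exact hat_vert_mem_stdSubspace.2 (Γ.limVerts_mono hsub hv)
    · rwa [Subtype.ext hv]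
    · rwa [Subtype.ext (mem_singleton_iff.1 hv)]
    · obtain ⟨f, hf, hfe⟩ := hsub he
      exact inner_mem_stdSubspace.2 (Subtype.ext hfe ▸ hf)
  · have heX := inner_mem_stdSubspace.1 he
    refine exists_arc_to_src heX (hat_vert_mem_stdSubspace.2 ?_) r
    change Γ.space.src e ∈ _
    rw [space_src]
    exact Γ.endAt_mem_limVerts (mem_image_of_mem _ heX) _

end GraphFramework

end InfGraphic

theorem mainTheorem5 {α : Type*} (M : Matroid α)
    (hconn : InfGraphic.IsConnectedMatroid M) (htame : InfGraphic.IsTame M)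
    (Γ : InfGraphic.GraphFramework M) (X : Set M.E) :
    List.TFAE [
      IsPreconnected (α := Γ.space.hat.Carrier) (Γ.space.hat.stdSubspace X),
      Γ.space.hat.IsPseudoArcConnected (Γ.space.hat.stdSubspace X),
      ∀ (b : Set M.E) (U W : Set Γ.space.hat.Carrier),
        Γ.space.hat.IsTopCutWithSides b U W →
        Γ.space.hat.MeetsBothSides (Γ.space.hat.stdSubspace X) U W → (X ∩ b).Nonempty,
      ∀ (b : Set M.E) (U W : Set Γ.space.hat.Carrier),
        Γ.space.hat.IsTopBond b → Γ.space.hat.IsTopCutWithSides b U W →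
        Γ.space.hat.MeetsBothSides (Γ.space.hat.stdSubspace X) U W → (X ∩ b).Nonempty] := by
  tfae_have 1 → 3 := by
    rintro h b U W ⟨hUW, rfl⟩ hmeet
    obtain ⟨e, r, he, hec⟩ :=
      InfGraphic.GraphFramework.exists_inner_mem_of_isPreconnected h hUW hmeet
    exact ⟨e, InfGraphic.GraphLikeSpace.inner_mem_stdSubspace.1 he, hec⟩
  tfae_have 3 → 4 := fun h b U W _ => h b U W
  tfae_have 4 → 2 :=
    InfGraphic.GraphFramework.isPseudoArcConnected_of_forall_isTopBond hconn htame
  tfae_have 2 → 1 := fun h => h.isPreconnected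
  tfae_finish
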